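/- Setting. A Max-CSP instance $\Phi$ consists of $n$ variables $x_1,\dots,x_n\in\{\pm1\}$ and $m$ constraints $(P_\ell,S_\ell)$, where $S_\ell$ is an ordered list of at most $k$ distinct variables and $P_\ell:\{\pm1\}^{|S_\ell|}\to\{0,1\}$. It is triangle-free if two distinct constraints share at most one variable and no three distinct constraints intersect pairwise without having a common variable. Two instances on the same variables are neighboring if one arises from the other by adding or removing one constraint. Write $\mathrm{val}_\Phi(x)=\sum_\ell P_\ell(x_{S_\ell})$, $\mathrm{OPT}=\max_x \mathrm{val}_\Phi(x)$, $\bar P_\ell=P_\ell-\mathbb E[P_\ell]$, $\mathfrak P(x)=\frac1m\sum_\ell \bar P_\ell(x_{S_\ell})$, and let $\mu$ be the expected fraction of constraints satisfied by a uniformly random assignment. Algorithm $\mathcal A_\varepsilon$. Put each variable independently with probability $1/2$ into $G$ and otherwise into $F$. Assign the variables of $F$ independently and uniformly at random. A constraint is active if exactly one of its variables lies in $G$. For $x_j\in G$ let $N_j$ be the set of active constraints containing $x_j$, $A_j\subseteq F$ the set of the other variables of these constraints, $Q_\ell=\partial_j\bar P_\ell=\frac12(\bar P_\ell|_{x_j=1}-\bar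 P_\ell|_{x_j=-1})$, and $\theta_j$ a median of $\sum_{\ell\in N_j}Q_\ell$ under a uniformly random assignment. Let $Z_j=\mathrm{sgn}(\sum_{\ell\in N_j}Q_\ell-\theta_j)$, where a tie is broken at random with the bias that makes $Z_j$ unbiased, and set $x_j=Y_jZ_j$, where $Y_j=1$ with probability $e^\varepsilon/(1+e^\varepsilon)$ and $Y_j=-1$ otherwise, with all random choices independent. Output $x$. Theorem. Let $0\le\varepsilon\le1$. 1. (Polynomial time.) For every constant $k$ there are a program for a random access machine with logarithmic cost, which can draw uniformly random integers below a given number and flip a coin of bias $e^\varepsilon/(1+e^\varepsilon)$, and a polynomial $T$, both depending only on $k$, such that on every triangle-free instance the output of the program has exactly the law of the output of $\mathcal A_\varepsilon$, and the program always stops within time $T(n+m)$. 2. (Privacy.) $\mathcal A_\varepsilon$ is $\varepsilon$-differentially private: for all neighboring $\Phi,\Phi'$ and every set $O$ of assignments, $\Pr[\mathcal A_\varepsilon(\Phi)\in O]\le e^\varepsilon\Pr[\mathcal A_\varepsilon(\Phi')\in O]$. The same holds conditionally on the partition and on the assignment of $F$. 3. (Marginals.) Let $\Phi$ be triangle-free.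 Conditionally on the partition, each $x_j\in G$ is uniform on $\{\pm1\}$, and its law given the assignment of $F$ depends only on the values of the variables in $A_j$. 4. (Gain of a variable.) There are absolute constants $c,C>0$ such that for every triangle-free $\Phi$, conditionally on the partition, for each $x_j\in G$ such that every constraint in $N_j$ depends on $x_j$ and on at least one other variable, $$\mathbb E\Big[x_j\sum_{\ell\in N_j}Q_\ell\Big]\ \ge\ c\,\varepsilon\,e^{-Ck}\sqrt{|N_j|}.$$ 5. (Advantage.) For every $k$ there is $c_k>0$ such that for every $D$ and every triangle-free $\Phi$ with $m\ge1$ in which each variable occurs in at most $D$ constraints and each predicate depends on at least two of its variables, the output $x$ of $\mathcal A_\varepsilon$ satisfies $$\mathbb E[\mathfrak P(x)]\ \ge\ \frac{c_k\,\varepsilon}{\sqrt D}\qquad\text{and}\qquad \mathbb E[\mathrm{val}_\Phi(x)]\ \ge\ \Big(\mu+\frac{c_k\,\varepsilon}{\sqrt D}\Big)\mathrm{OPT}.$$ -/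

import Mathlib

open scoped ENNReal

noncomputable section

namespace MaxCSP

/-! ### Elementary finite probability -/

/-- Average of `f` over the uniform distribution on a finite type. -/
def avg {Ω : Type*} [Fintype Ω] (f : Ω → ℝ) : ℝ :=
  (∑ ω, f ω) / (Fintype.card Ω : ℝ)

open Classical in
/-- Probability of the event `E` under the uniform distribution on a finite type. -/
def prob {Ω : Type*} [Fintype Ω] (E : Ω → Prop) : ℝ :=
  ((Finset.univ.filter E).card : ℝ) / (Fintype.card Ω : ℝ)

/-- Expectation of a real function under a law on a finite type. -/
def expect {α : Type*} [Fintype α] (p : PMF α) (f : α → ℝ) : ℝ :=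
  ∑ a, (p a).toReal * f a

/-- The law on `{+1, -1}` that gives `+1` with probability `p`. -/
def signLaw (p : ℝ) (h0 : 0 ≤ p) (h1 : p ≤ 1) : PMF ℤˣ :=
  PMF.ofFintype (fun s => if s = 1 then ENNReal.ofReal p else ENNReal.ofReal (1 - p)) (by
    have hu : (Finset.univ : Finset ℤˣ) = {1, -1} := by decide
    rw [hu, Finset.sum_pair (by decide), if_pos rfl, if_neg (by decide),
      ← ENNReal.ofReal_add h0 (by linarith)]
    simp)

/-- The law of a family of independent random variables with laws `p i`. -/
def piLaw {ι α : Type*} [Fintype ι] [DecidableEq ι] [Fintype α] (p : ι → PMF α) :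
    PMF (ι → α) :=
  PMF.ofFintype (fun x => ∏ i, p i (x i)) (by
    classical
    have h := Finset.prod_univ_sum (fun _ : ι => (Finset.univ : Finset α)) (fun i a => p i a)
    rw [Fintype.piFinset_univ] at h
    rw [← h]
    refine Finset.prod_eq_one fun i _ => ?_
    rw [← tsum_fintype (L := .unconditional _)]
    exact (p i).tsum_coe)

/-- The smallest median of `f` under the uniform distribution: the smallest value `v` of `f`
with `P(f ≤ v) ≥ 1/2`. -/
def median {Ω : Type*} [Fintype Ω] (f : Ω → ℝ) : ℝ :=
  sInf {v | v ∈ Set.range f ∧ 1 / 2 ≤ prob (fun ω => f ω ≤ v)}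

/-- The probability with which a tie `f = median f` has to be counted as positive, so that
`P(f > median f) + tieProb f * P(f = median f) = 1/2`. -/
def tieProb {Ω : Type*} [Fintype Ω] (f : Ω → ℝ) : ℝ :=
  (1 / 2 - prob (fun ω => median f < f ω)) / prob (fun ω => f ω = median f)

/-- The median is one of the admissible values. -/
theorem median_mem {Ω : Type*} [Fintype Ω] [Nonempty Ω] (f : Ω → ℝ) :
    median f ∈ {v | v ∈ Set.range f ∧ 1 / 2 ≤ prob (fun ω => f ω ≤ v)} := by
  apply Set.Nonempty.csInf_mem
  · obtain ⟨ω, hω⟩ := Finite.exists_max f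
    refine ⟨f ω, ⟨ω, rfl⟩, ?_⟩
    have hc : (Fintype.card Ω : ℝ) ≠ 0 := by exact_mod_cast Fintype.card_ne_zero
    simp only [prob, hω, Finset.filter_true, Finset.card_univ]
    rw [div_self hc]; norm_num
  · exact (Set.finite_range f).subset fun v hv => hv.1

theorem tieProb_nonneg {Ω : Type*} [Fintype Ω] [Nonempty Ω] (f : Ω → ℝ) : 0 ≤ tieProb f := by
  classical
  have hc : (0 : ℝ) < Fintype.card Ω := by exact_mod_cast Fintype.card_pos
  have h := (median_mem f).2
  refine div_nonneg ?_ (div_nonneg (Nat.cast_nonneg _) hc.le)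
  have hs := Finset.card_filter_add_card_filter_not (s := (Finset.univ : Finset Ω))
    (fun ω => f ω ≤ median f)
  simp only [not_le, Finset.card_univ] at hs
  have hs' : prob (fun ω => f ω ≤ median f) + prob (fun ω => median f < f ω) = 1 := by
    unfold prob
    rw [← add_div, div_eq_one_iff_eq hc.ne']
    rw [← Nat.cast_add]
    exact_mod_cast hs
  linarith

theorem tieProb_le_one {Ω : Type*} [Fintype Ω] [Nonempty Ω] (f : Ω → ℝ) : tieProb f ≤ 1 := by
  classical
  have hc : (0 : ℝ) < Fintype.card Ω := by exact_mod_cast Fintype.card_pos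
  obtain ⟨ω₀, hω₀⟩ := (median_mem f).1
  have hpos : 0 < prob (fun ω => f ω = median f) := by
    unfold prob
    refine div_pos ?_ hc
    exact_mod_cast Finset.card_pos.2 ⟨ω₀, by simp [hω₀]⟩
  have hlt : prob (fun ω => f ω < median f) ≤ 1 / 2 := by
    by_contra hcon
    push Not at hcon
    have hne : (Finset.univ.filter (fun ω => f ω < median f)).Nonempty := by
      by_contra hemp
      rw [Finset.not_nonempty_iff_eq_empty] at hemp
      have : prob (fun ω => f ω < median f) = 0 := by
        unfold prob
        convert zero_div _
        simp only [Nat.cast_eq_zero, Finset.card_eq_zero]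
        convert hemp
      linarith
    obtain ⟨ω₁, h₁, hmax⟩ := Finset.exists_max_image _ f hne
    simp only [Finset.mem_filter, Finset.mem_univ, true_and] at h₁ hmax
    have hle : median f ≤ f ω₁ := by
      apply csInf_le (((Set.finite_range f).subset fun v hv => hv.1).bddBelow)
      refine ⟨⟨ω₁, rfl⟩, ?_⟩
      have : (fun ω => f ω ≤ f ω₁) = (fun ω => f ω < median f) := by
        funext ω
        exact propext ⟨fun h => lt_of_le_of_lt h h₁, fun h => hmax ω h⟩
      rw [this]; exact hcon.le
    linarith
  rw [tieProb, div_le_one hpos]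
  have e1 : prob (fun ω => f ω < median f) + prob (fun ω => f ω = median f)
      = prob (fun ω => f ω ≤ median f) := by
    unfold prob
    rw [← add_div, ← Nat.cast_add, ← Finset.card_union_of_disjoint]
    · congr 3
      ext ω
      simp [le_iff_lt_or_eq]
    · rw [Finset.disjoint_filter]
      intro ω _ h
      exact h.ne
  have e2 : prob (fun ω => f ω ≤ median f) + prob (fun ω => median f < f ω) = 1 := by
    have hs := Finset.card_filter_add_card_filter_not (s := (Finset.univ : Finset Ω))
      (fun ω => f ω ≤ median f)
    simp only [not_le, Finset.card_univ] at hs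
    unfold prob
    rw [← add_div, div_eq_one_iff_eq hc.ne', ← Nat.cast_add]
    exact_mod_cast hs
  linarith

/-- The law of `sgn(f ω - median f)`; on a tie the sign is `+1` with probability `tieProb f`, so
that the sign is unbiased when `ω` is uniform. -/
def medianSign {Ω : Type*} [Fintype Ω] [Nonempty Ω] (f : Ω → ℝ) (ω : Ω) : PMF ℤˣ :=
  if median f < f ω then PMF.pure 1
  else if f ω < median f then PMF.pure (-1)
  else signLaw (tieProb f) (tieProb_nonneg f) (tieProb_le_one f)

/-! ### Max-CSP instances -/

/-- An assignment of `±1` to `n` variables. -/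
abbrev Assignment (n : ℕ) : Type := Fin n → ℤˣ

/-- A constraint of arity at most `k` on `n` variables: a predicate and an ordered scope of
distinct variables. -/
structure Constraint (n k : ℕ) where
  arity : ℕ
  arity_le : arity ≤ k
  pred : (Fin arity → ℤˣ) → Bool
  scope : Fin arity ↪ Fin n

namespace Constraint

variable {n k : ℕ}

/-- The set of variables in the scope. -/
def vars (c : Constraint n k) : Finset (Fin n) := Finset.univ.map c.scope

/-- The constraint is satisfied by `x`. -/
def Sat (c : Constraint n k) (x : Assignment n) : Prop := c.pred (fun i => x (c.scope i)) = true

instance (c : Constraint n k) (x : Assignment n) : Decidable (c.Sat x) :=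
  inferInstanceAs (Decidable (_ = true))

/-- The value `P(x_S) ∈ {0, 1}`. -/
def value (c : Constraint n k) (x : Assignment n) : ℝ := if c.Sat x then 1 else 0

/-- The centred value `P(x_S) - E[P]`. -/
def centred (c : Constraint n k) (x : Assignment n) : ℝ := c.value x - avg c.value

/-- The discrete derivative of the centred value in the direction of the variable `j`. -/
def deriv (c : Constraint n k) (j : Fin n) (x : Assignment n) : ℝ :=
  (c.centred (Function.update x j 1) - c.centred (Function.update x j (-1))) / 2

/-- The truth value of the constraint depends on the variable `j`. -/
def DependsOn (c : Constraint n k) (j : Fin n) : Prop :=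
  ∃ x : Assignment n, ¬ (c.Sat (Function.update x j 1) ↔ c.Sat (Function.update x j (-1)))

/-- The constraint depends on at least two variables, i.e. it is neither constant nor a condition
on a single variable. -/
def Nondegenerate (c : Constraint n k) : Prop :=
  ∃ i j, i ≠ j ∧ c.DependsOn i ∧ c.DependsOn j

end Constraint

/-- An instance: `m` constraints of arity at most `k` on `n` variables (repetitions allowed). -/
structure Instance (n k : ℕ) where
  m : ℕ
  con : Fin m → Constraint n k

namespace Instance

variable {n k : ℕ}

/-- No two distinct constraints share more than one variable, and no three distinct constraints
intersect pairwise without having a common variable. -/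
def TriangleFree (Φ : Instance n k) : Prop :=
  (∀ a b : Fin Φ.m, a ≠ b → ((Φ.con a).vars ∩ (Φ.con b).vars).card ≤ 1) ∧
  ∀ a b c : Fin Φ.m, a ≠ b → b ≠ c → a ≠ c →
    ((Φ.con a).vars ∩ (Φ.con b).vars).Nonempty →
    ((Φ.con b).vars ∩ (Φ.con c).vars).Nonempty →
    ((Φ.con a).vars ∩ (Φ.con c).vars).Nonempty →
    ((Φ.con a).vars ∩ (Φ.con b).vars ∩ (Φ.con c).vars).Nonempty

/-- The number of constraints in which the variable `i` takes part. -/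
def degree (Φ : Instance n k) (i : Fin n) : ℕ :=
  (Finset.univ.filter fun l : Fin Φ.m => i ∈ (Φ.con l).vars).card

/-- The number of constraints satisfied by `x`. -/
def val (Φ : Instance n k) (x : Assignment n) : ℕ :=
  (Finset.univ.filter fun l : Fin Φ.m => (Φ.con l).Sat x).card

/-- The largest number of constraints that can be satisfied simultaneously. -/
def opt (Φ : Instance n k) : ℕ := Finset.univ.sup Φ.val

/-- The expected fraction of constraints satisfied by a uniformly random assignment. -/
def mu (Φ : Instance n k) : ℝ := avg (fun x : Assignment n => (Φ.val x : ℝ)) / (Φ.m : ℝ)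

/-- The associated polynomial: the advantage of `x` over a random assignment. -/
def advantage (Φ : Instance n k) (x : Assignment n) : ℝ :=
  1 / (Φ.m : ℝ) * ∑ l, (Φ.con l).centred x

/-- `Φ'` arises from `Φ` by adding one constraint (the order of constraints is irrelevant). -/
def AddsOne (Φ Φ' : Instance n k) : Prop :=
  Φ'.m = Φ.m + 1 ∧ ∃ f : Fin Φ.m ↪ Fin Φ'.m, ∀ l, Φ'.con (f l) = Φ.con l

/-- One instance arises from the other by adding or by removing one constraint. -/
def Neighboring (Φ Φ' : Instance n k) : Prop := AddsOne Φ Φ' ∨ AddsOne Φ' Φ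

/-! Notions relative to a partition of the variables into `G` and its complement `F`. -/

/-- `N_j`: the active constraints (exactly one variable in `G`) that contain `j`. -/
def activeAt (Φ : Instance n k) (G : Finset (Fin n)) (j : Fin n) : Finset (Fin Φ.m) :=
  Finset.univ.filter fun l => ((Φ.con l).vars ∩ G).card = 1 ∧ j ∈ (Φ.con l).vars

/-- `A_j`: the variables of `F` that occur in a constraint of `N_j`. -/
def activeVars (Φ : Instance n k) (G : Finset (Fin n)) (j : Fin n) : Finset (Fin n) :=
  (Φ.activeAt G j).biUnion fun l => (Φ.con l).vars \ G

/-- `∑_{l ∈ N_j} Q_l`, where `Q_l` is the derivative of the `l`-th constraint at `j`. -/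
def gain (Φ : Instance n k) (G : Finset (Fin n)) (j : Fin n) (x : Assignment n) : ℝ :=
  ∑ l ∈ Φ.activeAt G j, (Φ.con l).deriv j x

end Instance

/-! ### The algorithm -/

/-- The law of the randomized-response sign: `+1` with probability `e^ε / (1 + e^ε)`. -/
def responseLaw (ε : ℝ) : PMF ℤˣ :=
  signLaw (Real.exp ε / (1 + Real.exp ε)) (by positivity)
    ((div_le_one (by positivity)).2 (by linarith))

/-- The law of `Y_j * Z_j` with `Z_j = sgn(∑_{l ∈ N_j} Q_l - θ_j)` and `Y_j` the
randomized-response sign, given that the variables of `F` are assigned as in `y`.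
(For `j ∈ G` the sum does not depend on the values of `y` on `G`.) -/
def privateSign {n k : ℕ} (ε : ℝ) (Φ : Instance n k) (G : Finset (Fin n)) (y : Assignment n)
    (j : Fin n) : PMF ℤˣ :=
  (medianSign (Φ.gain G j) y).bind fun Z => (responseLaw ε).bind fun Y => PMF.pure (Y * Z)

/-- The law of the output, given the partition and the assignment `y` of `F`: variables of `F`
keep their value, variables of `G` are drawn independently. -/
def algGivenF {n k : ℕ} (ε : ℝ) (Φ : Instance n k) (G : Finset (Fin n)) (y : Assignment n) :
    PMF (Assignment n) :=
  piLaw fun j => if j ∈ G then privateSign ε Φ G y j else PMF.pure (y j)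

/-- The law of the output, given the partition. -/
def algGiven {n k : ℕ} (ε : ℝ) (Φ : Instance n k) (G : Finset (Fin n)) : PMF (Assignment n) :=
  (PMF.uniformOfFintype (Assignment n)).bind (algGivenF ε Φ G)

/-- The law of the output of the algorithm: random partition, then as above. -/
def alg {n k : ℕ} (ε : ℝ) (Φ : Instance n k) : PMF (Assignment n) :=
  (PMF.uniformOfFintype (Finset (Fin n))).bind (algGiven ε Φ)

/-- Pure differential privacy of a randomized map. -/
def IsDP {α β : Type*} (ε : ℝ) (nbr : α → α → Prop) (M : α → PMF β) : Prop :=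
  ∀ d d', nbr d d' → ∀ S : Set β,
    (M d).toOuterMeasure S ≤ ENNReal.ofReal (Real.exp ε) * (M d').toOuterMeasure S

/-! ### Randomized random access machines with logarithmic cost -/

/-- The memory: two-dimensional arrays of natural numbers, numbered by `ℕ`. -/
abbrev Memory : Type := ℕ → ℕ → ℕ → ℕ

/-- Arithmetic instructions. -/
inductive AOp
  | add | sub | mul | div | mod | le | eq

/-- Meaning of the arithmetic instructions (truncated subtraction, comparisons give `0` or `1`). -/
def AOp.apply : AOp → ℕ → ℕ → ℕ
  | add, a, b => a + b
  | sub, a, b => a - b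
  | mul, a, b => a * b
  | div, a, b => a / b
  | mod, a, b => a % b
  | le, a, b => if a ≤ b then 1 else 0
  | eq, a, b => if a = b then 1 else 0

/-- Expressions: literals, entries of arrays, arithmetic. -/
inductive RExp
  | lit (v : ℕ)
  | get (arr : ℕ) (row col : RExp)
  | op (o : AOp) (s t : RExp)

/-- Value of an expression. -/
def RExp.eval (σ : Memory) : RExp → ℕ
  | lit v => v
  | get arr row col => σ arr (row.eval σ) (col.eval σ)
  | op o s t => o.apply (s.eval σ) (t.eval σ)

/-- Cost of an expression: each instruction costs one plus the bit lengths of its operands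
(for a memory access: of the address and of the content). -/
def RExp.cost (σ : Memory) : RExp → ℕ
  | lit v => 1 + Nat.size v
  | get arr row col => row.cost σ + col.cost σ + 1 + Nat.size (row.eval σ) +
      Nat.size (col.eval σ) + Nat.size (σ arr (row.eval σ) (col.eval σ))
  | op _ s t => s.cost σ + t.cost σ + 1 + Nat.size (s.eval σ) + Nat.size (t.eval σ)

/-- Programs. -/
inductive RCmd
  | skip
  | set (arr : ℕ) (row col e : RExp)
  | seq (c d : RCmd)
  | ite (e : RExp) (c d : RCmd)
  | loop (arr : ℕ) (e : RExp) (c : RCmd)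
  | unif (arr : ℕ) (row col e : RExp)
  | flip (arr : ℕ) (row col : RExp)

/-- A machine state: the memory and the time used so far. -/
structure MState where
  mem : Memory
  time : ℕ

/-- Overwrite one memory cell and add `t` to the time. -/
def MState.write (s : MState) (arr row col v t : ℕ) : MState where
  mem := fun a r c => if a = arr ∧ r = row ∧ c = col then v else s.mem a r c
  time := s.time + t

/-- Run `body 0`, ..., `body (N - 1)` one after the other. -/
def iterate (body : ℕ → MState → PMF MState) : ℕ → MState → PMF MState
  | 0, s => PMF.pure s
  | N + 1, s => (iterate body N s).bind (body N)

/-- A uniformly random element of `{0, ..., N - 1}` (and `0` if `N = 0`). -/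
def uniformBelow : ℕ → PMF ℕ
  | 0 => PMF.pure 0
  | N + 1 => (PMF.uniformOfFintype (Fin (N + 1))).map Fin.val

/-- Execution of a program. `set` stores the value of `e`; `ite` branches on `e ≠ 0`;
`loop arr e c` evaluates `e` once and then runs `c` that many times, with the number of the round
(from `0`) in cell `(0, 0)` of the array `arr`; `unif` stores a uniformly random number below the
value of `e`; `flip` stores `1` if the given biased coin shows `+1` and `0` otherwise. -/
def RCmd.exec (coin : PMF ℤˣ) : RCmd → MState → PMF MState
  | skip, s => PMF.pure s
  | set arr row col e, s =>
      let r := row.eval s.mem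
      let q := col.eval s.mem
      let v := e.eval s.mem
      PMF.pure (s.write arr r q v (row.cost s.mem + col.cost s.mem + e.cost s.mem + 1 +
        Nat.size r + Nat.size q + Nat.size v))
  | seq c d, s => (c.exec coin s).bind (d.exec coin)
  | ite e c d, s =>
      let s' : MState := { mem := s.mem, time := s.time + e.cost s.mem + 1 }
      if e.eval s.mem ≠ 0 then c.exec coin s' else d.exec coin s'
  | loop arr e c, s =>
      iterate (fun t s' => c.exec coin (s'.write arr 0 0 t (1 + Nat.size t))) (e.eval s.mem)
        { mem := s.mem, time := s.time + e.cost s.mem + 1 }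
  | unif arr row col e, s =>
      let r := row.eval s.mem
      let q := col.eval s.mem
      let N := e.eval s.mem
      (uniformBelow N).map fun v =>
        s.write arr r q v (row.cost s.mem + col.cost s.mem + e.cost s.mem + 1 +
          Nat.size r + Nat.size q + Nat.size N)
  | flip arr row col, s =>
      let r := row.eval s.mem
      let q := col.eval s.mem
      coin.map fun b =>
        s.write arr r q (if b = 1 then 1 else 0) (row.cost s.mem + col.cost s.mem + 1 +
          Nat.size r + Nat.size q)

/-- The input. Array `0` holds `n`, array `1` holds `m` (both in cell `(0, 0)`); entry `(l, 0)` of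
array `2` is the arity of the `l`-th constraint, entry `(l, i)` of array `3` is the `i`-th variable
of its scope, and row `l` of array `4` is its truth table, where bit `i` of the column number is
set if and only if the `i`-th argument is `+1`. All other cells hold `0`. -/
def inputMemory {n k : ℕ} (Φ : Instance n k) : Memory := fun arr row col =>
  if arr = 0 then (if row = 0 ∧ col = 0 then n else 0)
  else if arr = 1 then (if row = 0 ∧ col = 0 then Φ.m else 0)
  else if h : row < Φ.m then
    let c := Φ.con ⟨row, h⟩
    if arr = 2 then (if col = 0 then c.arity else 0)
    else if arr = 3 then (if hc : col < c.arity then (c.scope ⟨col, hc⟩ : ℕ) else 0)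
    else if arr = 4 then
      (if col < 2 ^ c.arity ∧
          c.pred (fun i => if Nat.testBit col i then 1 else -1) = true then 1 else 0)
    else 0
  else 0

/-- The initial state: the input in memory, and no time used. -/
def startState {n k : ℕ} (Φ : Instance n k) : MState where
  mem := inputMemory Φ
  time := 0

/-- The assignment left in array `5`: `x_i = +1` if and only if cell `(i, 0)` holds `1`. -/
def outputOf (n : ℕ) (s : MState) : Assignment n := fun i => if s.mem 5 i 0 = 1 then 1 else -1

end MaxCSP

end

set_option linter.unusedSectionVars false

noncomputable section

namespace MaxCSP

/-! ### Independence of functions of disjoint sets of coordinates -/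

section Independence

variable {ι α κ R : Type*} [Fintype ι] [DecidableEq ι] [Fintype α]

/-! Privacy is randomized response. The partition and the values on `F` ignore the instance, and
given both, the coordinates are independent. A constraint enters `gain` only if it is active, and
then only at its one variable in `G`. So neighboring instances differ in the law of at most one
coordinate (`AddsOne.exists_gain_eq`), and the response sign makes any two laws of that coordinate
comparable up to a factor e^ε (`bind_response_le`).

For the gain, let X be `gain` at j, N the number of its summands that depend on j, θ its median and
Z the sign of X - θ. Tie-breaking makes E Z = 0. Hence x_j is uniform, and E[Z X] = E[Z (X - θ)] =
E|X - θ|, which is at least half of E|X - E X|. By triangle-freeness the summands of X read disjoint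
sets of variables, so they are independent; each that depends on j has variance at least 2^(-k)/8.
Comparing second and fourth moments yields E|X - E X| ≥ c 4^(-k) √N (`sqrt_le_avg_abs_gain`). The
response sign contributes the factor (e^ε - 1)/(e^ε + 1) ≥ ε/4.

For the advantage, an inactive constraint has expectation zero: by triangle-freeness its variables
are determined by disjoint sets of uniform bits and independent coins, hence are jointly uniform
(`avg_expect_piLaw`, `expect_centred_eq_zero`). An active constraint contributes E[x_j Q] at its one
variable in `G`. So the expected advantage is a sum of gains; √N ≥ N/√D, and a constraint is active
at a given variable on which it depends with probability at least 2^(-k). The bound with OPT follows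
from OPT ≤ m.

For the running time, the median refers to 2^n assignments and cannot be found by enumeration. The
sign is sampled through a rank instead: with A assignments of larger gain, E of equal gain and u
uniform below E, it is positive iff 2(A + u) < 2^n (`map_uniformBelow_eq_medianSign`). Both counts
are read off one number ∑_y B^level(y), where the level is an increasing affine function of the gain
and B = 2^(n+2) is too large for carries (`sum_pow_digit`, `sum_pow_upper_digits`). By independence
this number is, up to a power of 2, a product of sums over truth tables (`sum_pow_levelSum_mul`),
and it has polynomially many bits. Time is bounded compositionally by `timeBound`; reducing most
intermediate results modulo a number that they never reach makes the bit bound visible without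
knowing their values. -/

theorem sum_mul_sum_of_disjoint [CommSemiring R] {S T : Finset ι} (h : Disjoint S T)
    {f g : (ι → α) → R} (hf : DependsOn f (S : Set ι)) (hg : DependsOn g (T : Set ι)) :
    (∑ x, f x) * (∑ x, g x) = (Fintype.card (ι → α) : R) * ∑ x, f x * g x := by
  -- Two independent points exchange their coordinates outside `S`. The new first point agrees with
  -- the old first one on `S` and with the old second one on `T`, so f(x) g(x) becomes f(x) g(y).
  -- Without division, the identity serves both real averages and natural-number sums.
  have hinv : Function.Involutive (fun p : (ι → α) × (ι → α) =>
      (S.piecewise p.1 p.2, S.piecewise p.2 p.1)) := by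
    rintro ⟨x, y⟩
    ext i <;> by_cases hi : i ∈ S <;> simp [hi]
  have h1 := Equiv.sum_comp (Function.Involutive.toPerm _ hinv) (fun p : (ι → α) × (ι → α) => f p.1 * g p.1)
  have h2 : ∀ p : (ι → α) × (ι → α),
      f ((Function.Involutive.toPerm _ hinv p).1) * g ((Function.Involutive.toPerm _ hinv p).1) = f p.1 * g p.2 := by
    rintro ⟨x, y⟩
    simp only [Function.Involutive.coe_toPerm]
    congr 1
    · exact hf fun i hi => by simp [Finset.mem_coe.1 hi]
    · exact hg fun i hi => by
        simp [Finset.disjoint_right.1 h (Finset.mem_coe.1 hi)]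
  simp only [h2] at h1
  rw [Fintype.sum_mul_sum, ← Fintype.sum_prod_type', h1, Fintype.sum_prod_type]
  simp [Finset.mul_sum]

/-- A uniform point restricts to a uniform point: exchanging the coordinates of `x` along `e` with
an independent `b` is an involution on pairs. -/
theorem card_mul_sum_comp_embedding {β : Type*} [Fintype β] [DecidableEq β] [CommSemiring R]
    (e : β ↪ ι) (h : (β → α) → R) :
    (Fintype.card (β → α) : R) * ∑ x : ι → α, h (fun i => x (e i))
      = (Fintype.card (ι → α) : R) * ∑ b, h b := by
  have hinv : Function.Involutive (fun p : (ι → α) × (β → α) =>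
      (Function.extend e p.2 p.1, fun i => p.1 (e i))) := by
    rintro ⟨x, b⟩
    ext i
    · by_cases hi : ∃ k, e k = i
      · obtain ⟨k, rfl⟩ := hi
        simp [e.injective.extend_apply]
      · simp [Function.extend_apply' _ _ _ hi]
    · simp [e.injective.extend_apply]
  have h1 := Equiv.sum_comp (Function.Involutive.toPerm _ hinv) (fun p : (ι → α) × (β → α) => h p.2)
  simp only [Function.Involutive.coe_toPerm] at h1
  rw [Fintype.sum_prod_type, Fintype.sum_prod_type] at h1
  simpa [Finset.mul_sum] using h1

theorem avg_mul_of_disjoint [Nonempty α] {S T : Finset ι} (h : Disjoint S T)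
    {f g : (ι → α) → ℝ} (hf : DependsOn f (S : Set ι)) (hg : DependsOn g (T : Set ι)) :
    avg (fun x => f x * g x) = avg f * avg g := by
  have hc : (Fintype.card (ι → α) : ℝ) ≠ 0 := by exact_mod_cast Fintype.card_ne_zero
  have := sum_mul_sum_of_disjoint h hf hg
  unfold avg
  rw [div_mul_div_comm, this, mul_div_mul_left _ _ hc]

theorem avg_comp_embedding [Nonempty α] {β : Type*} [Fintype β] [DecidableEq β]
    (e : β ↪ ι) (h : (β → α) → ℝ) :
    avg (fun x : ι → α => h (fun i => x (e i))) = avg h := by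
  have hc : (Fintype.card (ι → α) : ℝ) ≠ 0 := by exact_mod_cast Fintype.card_ne_zero
  have hc' : (Fintype.card (β → α) : ℝ) ≠ 0 := by exact_mod_cast Fintype.card_ne_zero
  have := card_mul_sum_comp_embedding e h
  unfold avg
  rw [div_eq_div_iff hc hc']
  linarith

theorem dependsOn_of_finset_sum [AddCommMonoid R] {s : Finset κ}
    {D : κ → Finset ι} {f : κ → (ι → α) → R} (hf : ∀ i ∈ s, DependsOn (f i) (D i : Set ι)) :
    DependsOn (fun x => ∑ i ∈ s, f i x) (s.biUnion D : Set ι) := by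
  intro x y hxy
  refine Finset.sum_congr rfl fun i hi => hf i hi fun v hv => hxy v ?_
  simp only [Finset.coe_biUnion, Set.mem_iUnion]
  exact ⟨i, hi, hv⟩

theorem dependsOn_of_finset_prod [CommMonoid R] {s : Finset κ}
    {D : κ → Finset ι} {f : κ → (ι → α) → R} (hf : ∀ i ∈ s, DependsOn (f i) (D i : Set ι)) :
    DependsOn (fun x => ∏ i ∈ s, f i x) (s.biUnion D : Set ι) := by
  intro x y hxy
  refine Finset.prod_congr rfl fun i hi => hf i hi fun v hv => hxy v ?_
  simp only [Finset.coe_biUnion, Set.mem_iUnion]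
  exact ⟨i, hi, hv⟩

theorem avg_prod_of_disjoint [Nonempty α] (s : Finset κ) {D : κ → Finset ι}
    {f : κ → (ι → α) → ℝ} (hf : ∀ i ∈ s, DependsOn (f i) (D i : Set ι))
    (hD : (s : Set κ).PairwiseDisjoint D) :
    avg (fun x => ∏ i ∈ s, f i x) = ∏ i ∈ s, avg (f i) := by
  classical
  induction s using Finset.induction_on with
  | empty =>
    have hc : (Fintype.card (ι → α) : ℝ) ≠ 0 := by exact_mod_cast Fintype.card_ne_zero
    unfold avg
    simp only [Finset.prod_empty, Finset.sum_const, Finset.card_univ, nsmul_eq_mul, mul_one]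
    exact div_self hc
  | insert a s ha ih =>
    have h1 := ih (fun i hi => hf i (Finset.mem_insert_of_mem hi))
      (hD.subset (by simp))
    simp only [Finset.prod_insert ha]
    rw [← h1]
    refine avg_mul_of_disjoint ?_ (hf a (Finset.mem_insert_self _ _))
      (dependsOn_of_finset_prod fun i hi => hf i (Finset.mem_insert_of_mem hi))
    rw [Finset.disjoint_biUnion_right]
    intro i hi
    exact hD (by simp) (by simp [hi]) (by rintro rfl; exact ha hi)

end Independence

/-! ### Averages and expectations -/

section Averages

variable {Ω : Type*} [Fintype Ω]

theorem avg_add (f g : Ω → ℝ) : avg (fun x => f x + g x) = avg f + avg g := by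
  simp [avg, Finset.sum_add_distrib, add_div]

theorem avg_sub (f g : Ω → ℝ) : avg (fun x => f x - g x) = avg f - avg g := by
  simp [avg, Finset.sum_sub_distrib, sub_div]

theorem avg_const_mul (c : ℝ) (f : Ω → ℝ) : avg (fun x => c * f x) = c * avg f := by
  simp [avg, ← Finset.mul_sum, mul_div_assoc]

theorem avg_mul_const (c : ℝ) (f : Ω → ℝ) : avg (fun x => f x * c) = avg f * c := by
  simp only [mul_comm _ c, avg_const_mul]

theorem avg_const [Nonempty Ω] (c : ℝ) : avg (fun _ : Ω => c) = c := by
  have hc : (Fintype.card Ω : ℝ) ≠ 0 := by exact_mod_cast Fintype.card_ne_zero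
  simp [avg, hc]

theorem avg_sum {κ : Type*} (s : Finset κ) (f : κ → Ω → ℝ) :
    avg (fun x => ∑ i ∈ s, f i x) = ∑ i ∈ s, avg (f i) := by
  simp [avg, Finset.sum_comm (s := Finset.univ), Finset.sum_div]

theorem avg_le_avg {f g : Ω → ℝ} (h : ∀ x, f x ≤ g x) : avg f ≤ avg g :=
  div_le_div_of_nonneg_right (Finset.sum_le_sum fun x _ => h x) (Nat.cast_nonneg _)

theorem avg_nonneg {f : Ω → ℝ} (h : ∀ x, 0 ≤ f x) : 0 ≤ avg f :=
  div_nonneg (Finset.sum_nonneg fun x _ => h x) (Nat.cast_nonneg _)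

theorem abs_avg_le (f : Ω → ℝ) : |avg f| ≤ avg (fun x => |f x|) := by
  unfold avg
  rw [abs_div, Nat.abs_cast]
  exact div_le_div_of_nonneg_right (Finset.abs_sum_le_sum_abs _ _) (Nat.cast_nonneg _)

variable {α : Type*} [Fintype α]

theorem sum_toReal_eq_one (p : PMF α) : ∑ a, (p a).toReal = 1 := by
  rw [← ENNReal.toReal_sum fun a _ => p.apply_ne_top a, ← tsum_fintype (L := .unconditional _),
    p.tsum_coe, ENNReal.toReal_one]

theorem expect_const (p : PMF α) (c : ℝ) : expect p (fun _ => c) = c := by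
  simp [expect, ← Finset.sum_mul, sum_toReal_eq_one]

theorem expect_add (p : PMF α) (f g : α → ℝ) :
    expect p (fun x => f x + g x) = expect p f + expect p g := by
  simp [expect, mul_add, Finset.sum_add_distrib]

theorem expect_const_mul (p : PMF α) (c : ℝ) (f : α → ℝ) :
    expect p (fun x => c * f x) = c * expect p f := by
  simp only [expect, Finset.mul_sum]
  exact Finset.sum_congr rfl fun _ _ => by ring

theorem expect_sum {κ : Type*} (p : PMF α) (s : Finset κ) (f : κ → α → ℝ) :
    expect p (fun x => ∑ i ∈ s, f i x) = ∑ i ∈ s, expect p (f i) := by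
  simp only [expect, Finset.mul_sum]
  exact Finset.sum_comm

theorem expect_congr {p : PMF α} {f g : α → ℝ} (h : ∀ x ∈ p.support, f x = g x) :
    expect p f = expect p g := by
  refine Finset.sum_congr rfl fun x _ => ?_
  by_cases hx : x ∈ p.support
  · rw [h x hx]
  · rw [(PMF.apply_eq_zero_iff p x).2 hx]; simp

theorem expect_pure (a : α) (f : α → ℝ) : expect (PMF.pure a) f = f a := by
  classical
  unfold expect
  rw [Finset.sum_eq_single a]
  · simp
  · intro b _ hb; simp [hb]
  · simp

theorem expect_uniform [Nonempty α] (f : α → ℝ) :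
    expect (PMF.uniformOfFintype α) f = avg f := by
  simp [expect, avg, PMF.uniformOfFintype_apply, ← Finset.mul_sum, div_eq_inv_mul]

variable {β : Type*} [Fintype β]

theorem expect_bind (p : PMF α) (q : α → PMF β) (f : β → ℝ) :
    expect (p.bind q) f = expect p (fun a => expect (q a) f) := by
  have h : ∀ b, ((p.bind q) b).toReal = ∑ a, (p a).toReal * (q a b).toReal := by
    intro b
    rw [PMF.bind_apply, tsum_fintype, ENNReal.toReal_sum]
    · simp
    · intro a _
      exact ENNReal.mul_ne_top (p.apply_ne_top a) ((q a).apply_ne_top b)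
  simp only [expect, h, Finset.sum_mul, Finset.mul_sum]
  rw [Finset.sum_comm]
  exact Finset.sum_congr rfl fun _ _ => Finset.sum_congr rfl fun _ _ => by ring

theorem expect_map (p : PMF α) (g : α → β) (f : β → ℝ) :
    expect (p.map g) f = expect p (fun a => f (g a)) := by
  rw [← PMF.bind_pure_comp, expect_bind]
  simp [expect_pure]

end Averages

/-! ### Product laws -/

section PiLaw

variable {ι α : Type*} [Fintype ι] [DecidableEq ι] [Fintype α]

theorem piLaw_apply (p : ι → PMF α) (x : ι → α) : piLaw p x = ∏ i, p i (x i) := rfl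

/-- Resampling one coordinate is the elementary move on product laws. It yields the marginals, lets
coordinates outside the support of a function be changed one by one, and describes one round of a
loop that fills an array. -/
theorem piLaw_bind_update (p : ι → PMF α) (t : ι) (q : PMF α) :
    ((piLaw p).bind fun x => q.map (Function.update x t)) = piLaw (Function.update p t q) := by
  classical
  ext z
  rw [PMF.bind_apply, tsum_fintype, piLaw_apply]
  have h1 : ∀ x : ι → α, (q.map (Function.update x t)) z
      = if (∀ i, i ≠ t → x i = z i) then q (z t) else 0 := by
    intro x
    rw [PMF.map_apply, tsum_fintype]
    split_ifs with hx
    · rw [Finset.sum_eq_single (z t)]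
      · rw [if_pos]
        funext i
        by_cases hi : i = t
        · subst hi; simp
        · simp [hi, hx i hi]
      · intro b _ hb
        rw [if_neg]
        rintro rfl
        simp at hb
      · simp
    · refine Finset.sum_eq_zero fun b _ => if_neg ?_
      rintro rfl
      exact hx fun i hi => by simp [hi]
  simp only [h1, mul_ite, mul_zero]
  rw [← Finset.sum_filter]
  have h2 : (Finset.univ.filter fun x : ι → α => ∀ i, i ≠ t → x i = z i)
      = Finset.univ.image (Function.update z t) := by
    ext x
    simp only [Finset.mem_filter, Finset.mem_univ, true_and, Finset.mem_image]
    constructor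
    · intro h
      refine ⟨x t, ?_⟩
      funext i
      by_cases hi : i = t
      · subst hi; simp
      · simp [hi, h i hi]
    · rintro ⟨a, rfl⟩ i hi
      simp [hi]
  rw [h2, Finset.sum_image (fun a _ b _ h => Function.update_injective z t h)]
  have h3 : ∀ (r : ι → PMF α) (x : ι → α),
      ∏ i, r i (x i) = r t (x t) * ∏ i ∈ Finset.univ.erase t, r i (x i) := fun r x =>
    (Finset.mul_prod_erase _ _ (Finset.mem_univ t)).symm
  have h4 : ∀ a, (piLaw p) (Function.update z t a) * q (z t)
      = p t a * (q (z t) * ∏ i ∈ Finset.univ.erase t, p i (z i)) := by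
    intro a
    rw [piLaw_apply, h3, Function.update_self]
    rw [Finset.prod_congr rfl fun i hi => by
      rw [Function.update_of_ne (Finset.ne_of_mem_erase hi)]]
    ring
  rw [Finset.sum_congr rfl fun a _ => h4 a, ← Finset.sum_mul, ← tsum_fintype (L := .unconditional _),
    (p t).tsum_coe, one_mul, h3, Function.update_self]
  congr 1
  exact Finset.prod_congr rfl fun i hi => by
    rw [Function.update_of_ne (Finset.ne_of_mem_erase hi)]

theorem map_eval_piLaw (p : ι → PMF α) (j : ι) : (piLaw p).map (fun x => x j) = p j := by
  conv_lhs => rw [← Function.update_eq_self j p, ← piLaw_bind_update]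
  rw [PMF.map_bind]
  simp [PMF.map_comp, Function.comp_def]
  exact PMF.map_id _

theorem piLaw_uniform [Nonempty α] :
    piLaw (fun _ : ι => PMF.uniformOfFintype α) = PMF.uniformOfFintype (ι → α) := by
  ext x
  simp [piLaw_apply, PMF.uniformOfFintype_apply, ENNReal.inv_pow]

theorem support_piLaw {p : ι → PMF α} {x : ι → α} (hx : x ∈ (piLaw p).support) (i : ι) :
    x i ∈ (p i).support := by
  rw [PMF.mem_support_iff, piLaw_apply, Finset.prod_ne_zero_iff] at hx
  exact (PMF.mem_support_iff _ _).2 (hx i (Finset.mem_univ i))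

/-- The coordinates outside `S` are resampled from `q` one at a time, and `f` does not notice. -/
theorem expect_piLaw_congr {p q : ι → PMF α} {S : Finset ι} (hpq : ∀ i ∈ S, p i = q i)
    {f : (ι → α) → ℝ} (hf : DependsOn f (S : Set ι)) :
    expect (piLaw p) f = expect (piLaw q) f := by
  have key : ∀ T : Finset ι, Disjoint S T →
      expect (piLaw (fun i => if i ∈ T then q i else p i)) f = expect (piLaw p) f := by
    intro T
    induction T using Finset.induction_on with
    | empty => simp
    | insert a T ha ih =>
      intro hd
      rw [Finset.disjoint_insert_right] at hd
      rw [← ih hd.2]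
      have : (fun i => if i ∈ insert a T then q i else p i)
          = Function.update (fun i => if i ∈ T then q i else p i) a (q a) := by
        funext i
        by_cases hi : i = a
        · subst hi; simp
        · simp [hi]
      rw [this, ← piLaw_bind_update, expect_bind]
      refine expect_congr fun x _ => ?_
      rw [expect_map, ← expect_const (q a) (f x)]
      refine expect_congr fun b _ => ?_
      exact hf fun i hi => by
        rw [Function.update_of_ne]
        rintro rfl
        exact hd.1 hi
  rw [← key (Finset.univ \ S) Finset.disjoint_sdiff]
  congr 2
  funext i
  by_cases hi : i ∈ S
  · simp [hi, hpq i hi]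
  · simp [hi]

end PiLaw

/-! ### Laws of a random sign -/

section Signs

theorem expect_sign (p : PMF ℤˣ) (f : ℤˣ → ℝ) :
    expect p f = (p 1).toReal * f 1 + (p (-1)).toReal * f (-1) := by
  have hu : (Finset.univ : Finset ℤˣ) = {1, -1} := by decide
  rw [expect, hu, Finset.sum_pair (by decide)]

/-- The expectation of a random sign. -/
def bias (p : PMF ℤˣ) : ℝ := expect p (fun s => ((s : ℤ) : ℝ))

theorem bias_eq (p : PMF ℤˣ) : bias p = 2 * (p 1).toReal - 1 := by
  have h := sum_toReal_eq_one p
  have hu : (Finset.univ : Finset ℤˣ) = {1, -1} := by decide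
  rw [hu, Finset.sum_pair (by decide)] at h
  rw [bias, expect_sign]
  push_cast
  linarith

/-- A law on two points has a single parameter, so equality of sign laws reduces to equality of one
real number. -/
theorem ext_of_bias {p q : PMF ℤˣ} (h : bias p = bias q) : p = q := by
  have h1 := bias_eq p
  have h2 := bias_eq q
  have hp := sum_toReal_eq_one p
  have hq := sum_toReal_eq_one q
  have hu : (Finset.univ : Finset ℤˣ) = {1, -1} := by decide
  rw [hu, Finset.sum_pair (by decide)] at hp hq
  ext s
  rw [← ENNReal.toReal_eq_toReal_iff' (p.apply_ne_top s) (q.apply_ne_top s)]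
  rcases Int.units_eq_one_or s with rfl | rfl <;> linarith

theorem bias_uniform : bias (PMF.uniformOfFintype ℤˣ) = 0 := by
  rw [bias_eq, PMF.uniformOfFintype_apply]
  simp

theorem bias_pure (s : ℤˣ) : bias (PMF.pure s) = ((s : ℤ) : ℝ) := expect_pure _ _

theorem bias_bind {α : Type*} [Fintype α] (p : PMF α) (q : α → PMF ℤˣ) :
    bias (p.bind q) = expect p fun a => bias (q a) := expect_bind _ _ _

theorem bias_signLaw (p : ℝ) (h0 : 0 ≤ p) (h1 : p ≤ 1) : bias (signLaw p h0 h1) = 2 * p - 1 := by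
  rw [bias_eq, signLaw, PMF.ofFintype_apply, if_pos rfl, ENNReal.toReal_ofReal h0]

/-- A random sign multiplied with an independent one. -/
theorem bias_bind_mul (p q : PMF ℤˣ) :
    bias (p.bind fun Z => q.bind fun Y => PMF.pure (Y * Z)) = bias q * bias p := by
  rw [bias_bind, bias.eq_def p, ← expect_const_mul]
  congr 1
  funext Z
  rw [bias_bind, mul_comm, bias, ← expect_const_mul]
  congr 1
  funext Y
  rw [bias_pure]
  push_cast
  ring

theorem bias_responseLaw (ε : ℝ) :
    bias (responseLaw ε) = (Real.exp ε - 1) / (Real.exp ε + 1) := by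
  rw [responseLaw, bias_signLaw]
  have := Real.exp_pos ε
  field_simp
  ring

variable {Ω : Type*} [Fintype Ω] [Nonempty Ω] (f : Ω → ℝ)

theorem bias_medianSign (ω : Ω) : bias (medianSign f ω) =
    (if median f < f ω then 1 else 0) + (if median f < f ω then 1 else 0)
      + (if f ω = median f then 2 * tieProb f else 0) - 1 := by
  unfold medianSign
  rcases lt_trichotomy (f ω) (median f) with h | h | h
  · simp [h, h.not_gt, h.ne, bias_pure]
  · simp [h, bias_signLaw]
  · simp [h, h.ne', bias_pure]

theorem avg_indicator (E : Ω → Prop) [DecidablePred E] :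
    avg (fun ω => if E ω then (1 : ℝ) else 0) = prob E := by
  unfold avg prob
  rw [Finset.sum_boole]
  congr!

theorem prob_eq_median_pos : 0 < prob (fun ω => f ω = median f) := by
  classical
  obtain ⟨ω₀, hω₀⟩ := (median_mem f).1
  refine div_pos ?_ (by exact_mod_cast Fintype.card_pos)
  exact_mod_cast Finset.card_pos.2 ⟨ω₀, by simp [hω₀]⟩

/-- This is what `tieProb` is made for: P(f > θ) + `tieProb` · P(f = θ) = 1/2. -/
theorem avg_bias_medianSign : avg (fun ω => bias (medianSign f ω)) = 0 := by
  simp only [bias_medianSign]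
  have h : ∀ ω, (if f ω = median f then 2 * tieProb f else 0)
      = (2 * tieProb f) * (if f ω = median f then 1 else 0) := by
    intro ω; split_ifs <;> simp
  simp only [h]
  rw [avg_sub, avg_add, avg_add, avg_const_mul, avg_const, avg_indicator, avg_indicator,
    tieProb, mul_assoc, div_mul_cancel₀ _ (prob_eq_median_pos f).ne']
  ring

/-- On a tie both sides vanish, whatever the bias of the tie-breaking coin. -/
theorem bias_medianSign_mul (ω : Ω) :
    bias (medianSign f ω) * (f ω - median f) = |f ω - median f| := by
  unfold medianSign
  rcases lt_trichotomy (f ω) (median f) with h | h | h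
  · simp [h, h.not_gt, bias_pure, abs_of_neg (sub_neg.2 h)]
  · simp [h]
  · simp [h, bias_pure, abs_of_pos (sub_pos.2 h)]

end Signs

/-! ### Pointwise comparison of laws -/

section Privacy

theorem toOuterMeasure_le_of_forall_le {α : Type*} {p q : PMF α} {C : ℝ≥0∞}
    (h : ∀ a, p a ≤ C * q a) (S : Set α) : p.toOuterMeasure S ≤ C * q.toOuterMeasure S := by
  rw [PMF.toOuterMeasure_apply, PMF.toOuterMeasure_apply, ← ENNReal.tsum_mul_left]
  refine ENNReal.tsum_le_tsum fun a => ?_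
  by_cases ha : a ∈ S <;> simp [ha, h a]

theorem bind_le_of_forall_le {α β : Type*} {p : PMF α} {q q' : α → PMF β} {C : ℝ≥0∞}
    (h : ∀ a b, q a b ≤ C * q' a b) (b : β) : (p.bind q) b ≤ C * (p.bind q') b := by
  rw [PMF.bind_apply, PMF.bind_apply, ← ENNReal.tsum_mul_left]
  refine ENNReal.tsum_le_tsum fun a => ?_
  rw [mul_left_comm]
  gcongr
  exact h a b

/-- By `hpq` at most one factor of the product differs, so the constant is paid once. If none
differs, `1 ≤ C` is needed. -/
theorem piLaw_le_of_forall_le {ι α : Type*} [Fintype ι] [DecidableEq ι] [Fintype α]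
    {p q : ι → PMF α} {C : ℝ≥0∞} (hC : 1 ≤ C) (h : ∀ i a, p i a ≤ C * q i a)
    (hpq : ∀ i i', p i ≠ q i → p i' ≠ q i' → i = i') (x : ι → α) :
    piLaw p x ≤ C * piLaw q x := by
  by_cases hall : ∀ i, p i = q i
  · rw [funext hall]
    exact le_mul_of_one_le_left' hC
  · push Not at hall
    obtain ⟨j, hj⟩ := hall
    rw [piLaw_apply, piLaw_apply, ← Finset.mul_prod_erase _ _ (Finset.mem_univ j),
      ← Finset.mul_prod_erase _ (fun i => q i (x i)) (Finset.mem_univ j), ← mul_assoc]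
    refine mul_le_mul' (h j _) (Finset.prod_le_prod' fun i hi => ?_)
    have : p i = q i := by
      by_contra hi'
      exact Finset.ne_of_mem_erase hi (hpq i j hi' hj)
    rw [this]

/-- Each side is an average of values of `responseLaw`, and any two of these are within a factor
e^ε. Nothing about the two input laws is used. -/
theorem bind_response_le {ε : ℝ} (hε : 0 ≤ ε) (p q : PMF ℤˣ) (s : ℤˣ) :
    (p.bind fun Z => (responseLaw ε).bind fun Y => PMF.pure (Y * Z)) s
      ≤ ENNReal.ofReal (Real.exp ε) *
        (q.bind fun Z => (responseLaw ε).bind fun Y => PMF.pure (Y * Z)) s := by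
  have hb : ∀ Z, ((responseLaw ε).bind fun Y => PMF.pure (Y * Z)) s = responseLaw ε (s * Z) := by
    intro Z
    rw [PMF.bind_apply, tsum_fintype, Finset.sum_eq_single (s * Z)]
    · rw [PMF.pure_apply, if_pos, mul_one]
      rw [mul_assoc, Int.units_mul_self, mul_one]
    · intro b _ hne
      rw [PMF.pure_apply, if_neg, mul_zero]
      rintro rfl
      exact hne (by rw [mul_assoc, Int.units_mul_self, mul_one])
    · exact fun h => absurd (Finset.mem_univ _) h
  have hr : ∀ u v, responseLaw ε u ≤ ENNReal.ofReal (Real.exp ε) * responseLaw ε v := by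
    have he := Real.one_le_exp hε
    have hp : (0 : ℝ) < 1 + Real.exp ε := by positivity
    have hval : ∀ u, responseLaw ε u
        = ENNReal.ofReal ((if u = 1 then Real.exp ε else 1) / (1 + Real.exp ε)) := by
      intro u
      rw [responseLaw, signLaw, PMF.ofFintype_apply]
      split_ifs
      · rfl
      · congr 1
        field_simp
        ring
    intro u v
    rw [hval, hval, ← ENNReal.ofReal_mul (by positivity), ← mul_div_assoc]
    apply ENNReal.ofReal_le_ofReal
    gcongr
    split_ifs <;> nlinarith
  rw [PMF.bind_apply, PMF.bind_apply]
  simp only [hb]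
  -- Inserting the total mass 1 of `q` turns both sides into averages over `q`, to be compared term
  -- by term.
  have h1 : ∑' a, p a * responseLaw ε (s * a)
      = ∑' b, q b * ∑' a, p a * responseLaw ε (s * a) := by
    rw [ENNReal.tsum_mul_right, q.tsum_coe, one_mul]
  rw [h1, ← ENNReal.tsum_mul_left]
  refine ENNReal.tsum_le_tsum fun b => ?_
  rw [mul_left_comm]
  gcongr
  calc ∑' a, p a * responseLaw ε (s * a)
      ≤ ∑' a, p a * (ENNReal.ofReal (Real.exp ε) * responseLaw ε (s * b)) :=
        ENNReal.tsum_le_tsum fun a => by gcongr; exact hr _ _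
    _ = _ := by rw [ENNReal.tsum_mul_right, p.tsum_coe, one_mul]

end Privacy

/-! ### Structure of instances -/

section Structure

variable {n k : ℕ}

theorem Constraint.mem_vars {c : Constraint n k} {i : Fin n} :
    i ∈ c.vars ↔ ∃ a, c.scope a = i := by
  simp [Constraint.vars]

theorem Constraint.dependsOn_sat (c : Constraint n k) :
    _root_.DependsOn c.Sat (c.vars : Set (Fin n)) := by
  intro x y h
  have : (fun i => x (c.scope i)) = fun i => y (c.scope i) := by
    funext i
    exact h _ (Finset.mem_coe.2 (Constraint.mem_vars.2 ⟨i, rfl⟩))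
  simp [Constraint.Sat, this]

theorem Constraint.dependsOn_centred (c : Constraint n k) :
    _root_.DependsOn c.centred (c.vars : Set (Fin n)) := by
  intro x y h
  simp only [Constraint.centred, Constraint.value, c.dependsOn_sat h]

theorem Constraint.dependsOn_comp_update {β : Type*} {f : Assignment n → β} {S : Finset (Fin n)}
    (hf : _root_.DependsOn f (S : Set (Fin n))) (j : Fin n) (s : ℤˣ) :
    _root_.DependsOn (fun x => f (Function.update x j s)) ((S.erase j : Finset (Fin n)) : Set (Fin n)) := by
  intro x y h
  refine hf fun i hi => ?_
  by_cases hij : i = j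
  · subst hij; simp
  · simp only [Function.update_of_ne hij]
    exact h i (Finset.mem_coe.2 (Finset.mem_erase.2 ⟨hij, hi⟩))

theorem Constraint.dependsOn_deriv (c : Constraint n k) (j : Fin n) :
    _root_.DependsOn (c.deriv j) ((c.vars.erase j : Finset (Fin n)) : Set (Fin n)) := by
  intro x y h
  have h1 := Constraint.dependsOn_comp_update c.dependsOn_centred j 1 h
  have h2 := Constraint.dependsOn_comp_update c.dependsOn_centred j (-1) h
  simp only at h1 h2
  simp only [Constraint.deriv, h1, h2]

theorem mem_vars_of_dependsOn {c : Constraint n k} {j : Fin n} (h : c.DependsOn j) :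
    j ∈ c.vars := by
  obtain ⟨x, hx⟩ := h
  by_contra hj
  apply hx
  rw [c.dependsOn_sat (x := Function.update x j 1) (y := Function.update x j (-1))]
  intro i hi
  have : i ≠ j := by rintro rfl; exact hj hi
  simp [this]

theorem Instance.mem_activeAt {Φ : Instance n k} {G : Finset (Fin n)} {j : Fin n}
    {l : Fin Φ.m} : l ∈ Φ.activeAt G j ↔ ((Φ.con l).vars ∩ G).card = 1 ∧ j ∈ (Φ.con l).vars := by
  simp [Instance.activeAt]

theorem Instance.vars_inter_of_mem_activeAt {Φ : Instance n k} {G : Finset (Fin n)} {j : Fin n}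
    (hj : j ∈ G) {l : Fin Φ.m} (hl : l ∈ Φ.activeAt G j) : (Φ.con l).vars ∩ G = {j} := by
  obtain ⟨h1, h2⟩ := Instance.mem_activeAt.1 hl
  obtain ⟨a, ha⟩ := Finset.card_eq_one.1 h1
  have : j ∈ (Φ.con l).vars ∩ G := Finset.mem_inter.2 ⟨h2, hj⟩
  rw [ha, Finset.mem_singleton] at this
  rw [ha, this]

theorem Instance.erase_eq_sdiff {Φ : Instance n k} {G : Finset (Fin n)} {j : Fin n}
    (hj : j ∈ G) {l : Fin Φ.m} (hl : l ∈ Φ.activeAt G j) :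
    (Φ.con l).vars.erase j = (Φ.con l).vars \ G := by
  have h := Instance.vars_inter_of_mem_activeAt hj hl
  ext i
  have hi := Finset.ext_iff.1 h i
  simp only [Finset.mem_inter, Finset.mem_singleton] at hi
  simp only [Finset.mem_erase, Finset.mem_sdiff]
  tauto

theorem Instance.dependsOn_gain {Φ : Instance n k} {G : Finset (Fin n)} {j : Fin n} (hj : j ∈ G) :
    DependsOn (Φ.gain G j) (Φ.activeVars G j : Set (Fin n)) :=
  dependsOn_of_finset_sum (D := fun l => (Φ.con l).vars \ G) fun l hl => by
    rw [← Instance.erase_eq_sdiff hj hl]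
    exact (Φ.con l).dependsOn_deriv j

theorem Instance.activeVars_disjoint (Φ : Instance n k) (G : Finset (Fin n)) (j : Fin n) :
    Disjoint (Φ.activeVars G j) G := by
  rw [Instance.activeVars, Finset.disjoint_biUnion_left]
  exact fun l _ => Finset.sdiff_disjoint

end Structure

/-! ### Privacy and marginals -/

section PrivacyMarginals

variable {n k : ℕ}

/-- The witness is the added constraint: its index is the one point outside the range of the
embedding, and the other summands are only renumbered. -/
theorem Instance.AddsOne.exists_gain_eq {Φ Φ' : Instance n k} (h : Instance.AddsOne Φ Φ') :
    ∃ c : Constraint n k, ∀ (G : Finset (Fin n)) (j : Fin n),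
      ¬ ((c.vars ∩ G).card = 1 ∧ j ∈ c.vars) → Φ.gain G j = Φ'.gain G j := by
  obtain ⟨hm, f, hf⟩ := h
  have hcard : ((Finset.univ.map f)ᶜ : Finset (Fin Φ'.m)).card = 1 := by
    rw [Finset.card_compl]
    simp [hm]
  obtain ⟨l₀, hl₀⟩ := Finset.card_eq_one.1 hcard
  refine ⟨Φ'.con l₀, fun G j hj => ?_⟩
  funext x
  simp only [Instance.gain, Instance.activeAt, Finset.sum_filter]
  rw [← Finset.sum_compl_add_sum (Finset.univ.map f), hl₀, Finset.sum_singleton, if_neg hj,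
    zero_add, Finset.sum_map]
  simp only [hf]

/-- Two coordinates with different laws would both lie in `c.vars ∩ G`, which then has only one
element; so they coincide. -/
theorem algGivenF_le {ε : ℝ} (hε : 0 ≤ ε) {Φ Φ' : Instance n k}
    (h : Instance.Neighboring Φ Φ') (G : Finset (Fin n)) (y x : Assignment n) :
    algGivenF ε Φ G y x ≤ ENNReal.ofReal (Real.exp ε) * algGivenF ε Φ' G y x := by
  have hC : 1 ≤ ENNReal.ofReal (Real.exp ε) := by
    rw [← ENNReal.ofReal_one]
    exact ENNReal.ofReal_le_ofReal (Real.one_le_exp hε)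
  obtain ⟨c, hc⟩ : ∃ c : Constraint n k, ∀ (G : Finset (Fin n)) (j : Fin n),
      ¬ ((c.vars ∩ G).card = 1 ∧ j ∈ c.vars) → Φ.gain G j = Φ'.gain G j := by
    rcases h with h | h
    · exact h.exists_gain_eq
    · obtain ⟨c, hc⟩ := h.exists_gain_eq
      exact ⟨c, fun G j hj => (hc G j hj).symm⟩
  have key : ∀ i, (if i ∈ G then privateSign ε Φ G y i else PMF.pure (y i))
      ≠ (if i ∈ G then privateSign ε Φ' G y i else PMF.pure (y i)) →
      i ∈ G ∧ (c.vars ∩ G).card = 1 ∧ i ∈ c.vars := by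
    intro i hi
    by_cases hG : i ∈ G
    · refine ⟨hG, ?_⟩
      by_contra hcon
      apply hi
      simp only [hG, if_true, privateSign, hc G i hcon]
    · simp [hG] at hi
  refine piLaw_le_of_forall_le hC (fun i a => ?_) (fun i i' hi hi' => ?_) x
  · split_ifs
    · exact bind_response_le hε _ _ _
    · exact le_mul_of_one_le_left' hC
  · obtain ⟨h1, h2, h3⟩ := key i hi
    obtain ⟨h1', -, h3'⟩ := key i' hi'
    exact Finset.card_le_one.1 h2.le i (Finset.mem_inter.2 ⟨h3, h1⟩) i'
      (Finset.mem_inter.2 ⟨h3', h1'⟩)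

theorem isDP_algGivenF {ε : ℝ} (hε : 0 ≤ ε) (G : Finset (Fin n)) (y : Assignment n) :
    IsDP ε Instance.Neighboring (fun Φ : Instance n k => algGivenF ε Φ G y) :=
  fun _ _ h S => toOuterMeasure_le_of_forall_le (algGivenF_le hε h G y) S

theorem isDP_alg {ε : ℝ} (hε : 0 ≤ ε) :
    IsDP ε Instance.Neighboring (fun Φ : Instance n k => alg ε Φ) :=
  fun _ _ h S => toOuterMeasure_le_of_forall_le
    (bind_le_of_forall_le fun G => bind_le_of_forall_le (algGivenF_le hε h G)) S

theorem map_eval_algGivenF (ε : ℝ) (Φ : Instance n k) {G : Finset (Fin n)} (y : Assignment n)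
    {j : Fin n} (hj : j ∈ G) :
    (algGivenF ε Φ G y).map (fun x => x j) = privateSign ε Φ G y j := by
  rw [algGivenF, map_eval_piLaw, if_pos hj]

theorem bias_privateSign (ε : ℝ) (Φ : Instance n k) (G : Finset (Fin n)) (y : Assignment n)
    (j : Fin n) : bias (privateSign ε Φ G y j)
      = (Real.exp ε - 1) / (Real.exp ε + 1) * bias (medianSign (Φ.gain G j) y) := by
  rw [privateSign, bias_bind_mul, bias_responseLaw]

theorem avg_bias_privateSign (ε : ℝ) (Φ : Instance n k) (G : Finset (Fin n)) (j : Fin n) :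
    avg (fun y => bias (privateSign ε Φ G y j)) = 0 := by
  simp only [bias_privateSign]
  rw [avg_const_mul, avg_bias_medianSign, mul_zero]

theorem map_eval_algGiven (ε : ℝ) (Φ : Instance n k) {G : Finset (Fin n)}
    {j : Fin n} (hj : j ∈ G) :
    (algGiven ε Φ G).map (fun x => x j) = PMF.uniformOfFintype ℤˣ := by
  rw [algGiven, PMF.map_bind]
  simp only [map_eval_algGivenF ε Φ _ hj]
  apply ext_of_bias
  rw [bias_bind, expect_uniform, avg_bias_privateSign, bias_uniform]

theorem privateSign_congr (ε : ℝ) (Φ : Instance n k) {G : Finset (Fin n)}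
    {j : Fin n} (hj : j ∈ G) :
    DependsOn (fun y => privateSign ε Φ G y j) (Φ.activeVars G j : Set (Fin n)) := by
  intro y y' h
  simp only [privateSign, medianSign, Instance.dependsOn_gain hj h]

end PrivacyMarginals

/-! ### First absolute moment of a sum of independent variables -/

section Moments

variable {ι α κ : Type*} [Fintype ι] [DecidableEq ι] [Fintype α] [Nonempty α]

theorem DependsOn.comp_right {β γ : Type*} {f : (ι → α) → β} {S : Set ι}
    (hf : _root_.DependsOn f S) (g : β → γ) : _root_.DependsOn (fun x => g (f x)) S :=
  fun _ _ h => congrArg g (hf h)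

/-- Adding a summand W to an independent sum X kills every mixed term with a first power of X or W.
The fourth moment grows by at most 1 + 6N, which fits into 3(N + 1)² - 3N². -/
theorem avg_sum_moments (s : Finset κ) {D : κ → Finset ι} {W : κ → (ι → α) → ℝ}
    (hW : ∀ i ∈ s, _root_.DependsOn (W i) (D i : Set ι)) (hD : (s : Set κ).PairwiseDisjoint D)
    (h0 : ∀ i ∈ s, avg (W i) = 0) (h1 : ∀ i ∈ s, ∀ x, |W i x| ≤ 1) :
    avg (fun x => (∑ i ∈ s, W i x) ^ 2) = ∑ i ∈ s, avg (fun x => W i x ^ 2) ∧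
      avg (fun x => (∑ i ∈ s, W i x) ^ 4) ≤ 3 * (s.card : ℝ) ^ 2 := by
  classical
  induction s using Finset.induction_on with
  | empty => simp [avg_const]
  | insert a s ha ih =>
    obtain ⟨ih2, ih4⟩ := ih (fun i hi => hW i (Finset.mem_insert_of_mem hi))
      (hD.subset (by simp)) (fun i hi => h0 i (Finset.mem_insert_of_mem hi))
      (fun i hi => h1 i (Finset.mem_insert_of_mem hi))
    have hX : _root_.DependsOn (fun x => ∑ i ∈ s, W i x) (s.biUnion D : Set ι) :=
      dependsOn_of_finset_sum fun i hi => hW i (Finset.mem_insert_of_mem hi)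
    have hA := hW a (Finset.mem_insert_self _ _)
    have hdis : Disjoint (s.biUnion D) (D a) := by
      rw [Finset.disjoint_biUnion_left]
      intro i hi
      exact hD (by simp [hi]) (by simp) (by rintro rfl; exact ha hi)
    have hX0 : avg (fun x => ∑ i ∈ s, W i x) = 0 := by
      rw [avg_sum]
      exact Finset.sum_eq_zero fun i hi => h0 i (Finset.mem_insert_of_mem hi)
    have ha0 := h0 a (Finset.mem_insert_self _ _)
    have ha1 := h1 a (Finset.mem_insert_self _ _)
    have hind : ∀ p q : ℕ, avg (fun x => (∑ i ∈ s, W i x) ^ p * W a x ^ q)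
        = avg (fun x => (∑ i ∈ s, W i x) ^ p) * avg (fun x => W a x ^ q) := fun p q =>
      avg_mul_of_disjoint hdis (DependsOn.comp_right hX (· ^ p)) (DependsOn.comp_right hA (· ^ q))
    have h11 := hind 1 1
    have h31 := hind 3 1
    have h22 := hind 2 2
    have h13 := hind 1 3
    simp only [pow_one, hX0, ha0, mul_zero, zero_mul] at h11 h31 h13
    have hsq : avg (fun x => W a x ^ 2) ≤ 1 := by
      rw [← avg_const (Ω := ι → α) 1]
      exact avg_le_avg fun x => by rw [← sq_abs]; exact pow_le_one₀ (abs_nonneg _) (ha1 x)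
    have hfour : avg (fun x => W a x ^ 4) ≤ 1 := by
      rw [← avg_const (Ω := ι → α) 1]
      refine avg_le_avg fun x => ?_
      rw [← Even.pow_abs (by decide : Even 4)]
      exact pow_le_one₀ (abs_nonneg _) (ha1 x)
    simp only [Finset.sum_insert ha]
    constructor
    · have : ∀ x, (W a x + ∑ i ∈ s, W i x) ^ 2
          = (W a x ^ 2 + (∑ i ∈ s, W i x) ^ 2) + 2 * ((∑ i ∈ s, W i x) * W a x) := fun x => by ring
      simp only [this]
      rw [avg_add, avg_add, avg_const_mul, h11, ih2]
      ring
    · have : ∀ x, (W a x + ∑ i ∈ s, W i x) ^ 4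
          = (((∑ i ∈ s, W i x) ^ 4 + W a x ^ 4) + 4 * ((∑ i ∈ s, W i x) ^ 3 * W a x)
            + 4 * ((∑ i ∈ s, W i x) * W a x ^ 3)) + 6 * ((∑ i ∈ s, W i x) ^ 2 * W a x ^ 2) :=
        fun x => by ring
      simp only [this]
      rw [avg_add, avg_add, avg_add, avg_add, avg_const_mul, avg_const_mul, avg_const_mul,
        h31, h13, h22, ih2, Finset.card_insert_of_notMem ha]
      have hsum : ∑ i ∈ s, avg (fun x => W i x ^ 2) ≤ s.card := by
        rw [← nsmul_one, ← Finset.sum_const]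
        refine Finset.sum_le_sum fun i hi => ?_
        rw [← avg_const (Ω := ι → α) 1]
        exact avg_le_avg fun x => by
          rw [← sq_abs]
          exact pow_le_one₀ (abs_nonneg _) (h1 i (Finset.mem_insert_of_mem hi) x)
      have hsum0 : 0 ≤ ∑ i ∈ s, avg (fun x => W i x ^ 2) :=
        Finset.sum_nonneg fun i _ => avg_nonneg fun x => sq_nonneg _
      have hprod : (∑ i ∈ s, avg (fun x => W i x ^ 2)) * avg (fun x => W a x ^ 2) ≤ s.card :=
        (mul_le_of_le_one_right hsum0 hsq).trans hsum
      push_cast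
      nlinarith

/-- A lower bound for the first absolute moment from the second and the fourth one. -/
theorem sqrt_le_avg_abs {Ω : Type*} [Fintype Ω] {X : Ω → ℝ} {N v : ℝ} (hN : 0 ≤ N)
    (hv : 0 < v) (hv1 : v ≤ 1) (h2 : v * N ≤ avg (fun ω => X ω ^ 2))
    (h4 : avg (fun ω => X ω ^ 4) ≤ 3 * N ^ 2) :
    v ^ 2 / 5 * √N ≤ avg (fun ω => |X ω|) := by
  rcases hN.eq_or_lt with rfl | hN
  · simpa using avg_nonneg fun ω => abs_nonneg (X ω)
  set r := √N with hr
  have hr0 : 0 < r := Real.sqrt_pos.2 hN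
  have hrN : N = r ^ 2 := (Real.sq_sqrt hN.le).symm
  -- With w = a|X| this is |X|(w - w³) ≤ |X|. The choice a = v/(3√N) leaves v²√N/3 - v³√N/9, at
  -- least (2/9)v²√N, after averaging.
  have hpt : ∀ ω, v / (3 * r) * X ω ^ 2 - (v / (3 * r)) ^ 3 * X ω ^ 4 ≤ |X ω| := by
    intro ω
    set a := v / (3 * r)
    have ha : 0 < a := by positivity
    rw [← sq_abs, ← Even.pow_abs (by decide : Even 4)]
    set u := |X ω|
    have hu : 0 ≤ u := abs_nonneg _
    have : 0 ≤ u * (1 - a * u + (a * u) ^ 3) := by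
      refine mul_nonneg hu ?_
      have hau : 0 ≤ a * u := by positivity
      rcases le_total (a * u) 1 with h | h
      · have := pow_nonneg hau 3
        linarith
      · have : a * u ≤ (a * u) ^ 3 := le_self_pow₀ h (by norm_num)
        linarith
    nlinarith
  refine le_trans ?_ (avg_le_avg hpt)
  rw [avg_sub, avg_const_mul, avg_const_mul]
  have e1 : v / (3 * r) * (v * N) ≤ v / (3 * r) * avg (fun ω => X ω ^ 2) :=
    mul_le_mul_of_nonneg_left h2 (by positivity)
  have e2 : (v / (3 * r)) ^ 3 * avg (fun ω => X ω ^ 4) ≤ (v / (3 * r)) ^ 3 * (3 * N ^ 2) :=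
    mul_le_mul_of_nonneg_left h4 (by positivity)
  have e3 : v / (3 * r) * (v * N) = v ^ 2 * r / 3 := by rw [hrN]; field_simp
  have e4 : (v / (3 * r)) ^ 3 * (3 * N ^ 2) = v ^ 3 * r / 9 := by
    rw [hrN]; field_simp; ring
  have e5 : v ^ 3 * r ≤ v ^ 2 * r := by
    have : v ^ 3 ≤ v ^ 2 := pow_le_pow_of_le_one hv.le hv1 (by norm_num)
    exact mul_le_mul_of_nonneg_right this hr0.le
  have e6 : 0 ≤ v ^ 2 * r := by positivity
  linarith

/-- The mean is itself within E|f - θ| of θ. This passes from the median to the mean, around which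
moments are computable. -/
theorem avg_abs_sub_avg_le {Ω : Type*} [Fintype Ω] [Nonempty Ω] (f : Ω → ℝ) (θ : ℝ) :
    avg (fun ω => |f ω - avg f|) ≤ 2 * avg (fun ω => |f ω - θ|) := by
  have h1 : |avg f - θ| ≤ avg (fun ω => |f ω - θ|) := by
    have := abs_avg_le (fun ω => f ω - θ)
    rwa [avg_sub, avg_const] at this
  calc avg (fun ω => |f ω - avg f|) ≤ avg (fun ω => |f ω - θ| + |avg f - θ|) :=
        avg_le_avg fun ω => by
          have := abs_sub (f ω - θ) (avg f - θ)
          simpa using this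
    _ = avg (fun ω => |f ω - θ|) + |avg f - θ| := by rw [avg_add, avg_const]
    _ ≤ _ := by linarith

end Moments

/-! ### The gain of a variable -/

section Gain

variable {n k : ℕ}

theorem Constraint.value_eq_zero_or_one (c : Constraint n k) (x : Assignment n) :
    c.value x = 0 ∨ c.value x = 1 := by
  unfold Constraint.value
  split_ifs <;> simp

theorem Constraint.deriv_eq (c : Constraint n k) (j : Fin n) (x : Assignment n) :
    c.deriv j x = (c.value (Function.update x j 1) - c.value (Function.update x j (-1))) / 2 := by
  simp [Constraint.deriv, Constraint.centred]

theorem Constraint.abs_deriv_le (c : Constraint n k) (j : Fin n) (x : Assignment n) :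
    |c.deriv j x| ≤ 1 / 2 := by
  rw [c.deriv_eq, abs_le]
  rcases c.value_eq_zero_or_one (Function.update x j 1) with h | h <;>
    rcases c.value_eq_zero_or_one (Function.update x j (-1)) with h' | h' <;>
    rw [h, h'] <;> norm_num

theorem Constraint.deriv_eq_zero {c : Constraint n k} {j : Fin n} (h : ¬ c.DependsOn j)
    (x : Assignment n) : c.deriv j x = 0 := by
  simp only [Constraint.DependsOn, not_exists, not_not] at h
  simp [c.deriv_eq, Constraint.value, h x]

/-- The derivative takes values in {-1/2, 0, 1/2}. If all differences were below 1/2 it would be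
constant, equal to its nonzero value at `x₀`; the truth value would then be a function of `x j`
alone, and `c` would not depend on `i`. -/
theorem Constraint.exists_deriv_ne {c : Constraint n k} {i j : Fin n} (hij : i ≠ j)
    (hj : c.DependsOn j) (hi : c.DependsOn i) :
    ∃ x y, 1 / 4 ≤ (c.deriv j x - c.deriv j y) ^ 2 := by
  by_contra! hcon
  obtain ⟨x₀, hx₀⟩ := hj
  obtain ⟨x₁, hx₁⟩ := hi
  have hv : ∀ x, c.value x = if c.Sat x then 1 else 0 := fun _ => rfl
  -- A nonzero derivative determines both truth values from which it is formed.
  have gen : ∀ (p q p₀ q₀ : Prop) [Decidable p] [Decidable q] [Decidable p₀] [Decidable q₀],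
      ¬ (p₀ ↔ q₀) → (((if p then (1 : ℝ) else 0) - (if q then 1 else 0)) / 2
        - ((if p₀ then 1 else 0) - (if q₀ then 1 else 0)) / 2) ^ 2 < 1 / 4 →
      (p ↔ p₀) ∧ (q ↔ q₀) := by
    intro p q p₀ q₀ _ _ _ _ h h'
    by_cases hp : p <;> by_cases hq : q <;> by_cases hp₀ : p₀ <;> by_cases hq₀ : q₀ <;>
      simp only [hp, hq, hp₀, hq₀, if_true, if_false, not_true_eq_false,
        iff_self, and_self, and_true, true_and] at h h' ⊢ <;> norm_num at h'
  have key : ∀ x, (c.Sat (Function.update x j 1) ↔ c.Sat (Function.update x₀ j 1)) ∧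
      (c.Sat (Function.update x j (-1)) ↔ c.Sat (Function.update x₀ j (-1))) := by
    intro x
    have := hcon x x₀
    rw [c.deriv_eq, c.deriv_eq] at this
    exact gen _ _ _ _ hx₀ this
  have hup : ∀ s, Function.update (Function.update x₁ i s) j (x₁ j) = Function.update x₁ i s := by
    intro s
    have : x₁ j = Function.update x₁ i s j := by rw [Function.update_of_ne hij.symm]
    rw [this, Function.update_eq_self]
  apply hx₁
  rw [← hup 1, ← hup (-1)]
  rcases Int.units_eq_one_or (x₁ j) with h | h <;> rw [h]
  · rw [(key _).1, (key (Function.update x₁ i (-1))).1]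
  · rw [(key _).2, (key (Function.update x₁ i (-1))).2]

/-- The average may be taken over the at most 2^k arguments of the predicate. The function `g` only
certifies that `x` and `y` differ on the scope, so that both terms are counted. -/
theorem Constraint.add_le_avg {c : Constraint n k} {f g : Assignment n → ℝ}
    (hf0 : ∀ x, 0 ≤ f x) (hf : _root_.DependsOn f (c.vars : Set (Fin n)))
    (hg : _root_.DependsOn g (c.vars : Set (Fin n))) {x y : Assignment n} (hxy : g x ≠ g y) :
    (f x + f y) / 2 ^ k ≤ avg f := by
  have hext : ∀ z : Assignment n, ∀ i ∈ (c.vars : Set (Fin n)),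
      Function.extend c.scope (fun a => z (c.scope a)) x i = z i := by
    intro z i hi
    obtain ⟨a, rfl⟩ := Constraint.mem_vars.1 (Finset.mem_coe.1 hi)
    exact c.scope.injective.extend_apply _ _ _
  have h1 := avg_comp_embedding c.scope (fun b => f (Function.extend c.scope b x))
  have h2 : ∀ z, f (Function.extend c.scope (fun a => z (c.scope a)) x) = f z :=
    fun z => hf (hext z)
  simp only [h2] at h1
  rw [h1, avg]
  have hne : (fun a => x (c.scope a)) ≠ fun a => y (c.scope a) := by
    intro h
    apply hxy
    refine hg fun i hi => ?_
    obtain ⟨a, rfl⟩ := Constraint.mem_vars.1 (Finset.mem_coe.1 hi)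
    exact congrFun h a
  have h3 : f x + f y ≤ ∑ b, f (Function.extend c.scope b x) := by
    rw [← h2 x, ← h2 y, ← Finset.sum_pair (f := fun b => f (Function.extend c.scope b x)) hne]
    exact Finset.sum_le_sum_of_subset_of_nonneg (Finset.subset_univ _) fun _ _ _ => hf0 _
  have h4 : (Fintype.card (Fin c.arity → ℤˣ) : ℝ) ≤ 2 ^ k := by
    simp only [Fintype.card_fun, Fintype.card_fin, Fintype.card_units_int]
    push_cast
    exact pow_le_pow_right₀ (by norm_num) c.arity_le
  have h5 : (0 : ℝ) < Fintype.card (Fin c.arity → ℤˣ) := by exact_mod_cast Fintype.card_pos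
  exact div_le_div₀ (Finset.sum_nonneg fun _ _ => hf0 _) h3 h5 h4

theorem Constraint.variance_deriv {c : Constraint n k} {i j : Fin n} (hij : i ≠ j)
    (hj : c.DependsOn j) (hi : c.DependsOn i) :
    1 / (8 * 2 ^ k) ≤ avg (fun x => (c.deriv j x - avg (c.deriv j)) ^ 2) := by
  obtain ⟨x, y, hxy⟩ := Constraint.exists_deriv_ne hij hj hi
  have hd : _root_.DependsOn (c.deriv j) (c.vars : Set (Fin n)) :=
    (c.dependsOn_deriv j).mono (by simp)
  refine le_trans ?_ (Constraint.add_le_avg (g := c.deriv j) (x := x) (y := y)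
    (fun x => sq_nonneg _) (DependsOn.comp_right hd fun q => (q - avg (c.deriv j)) ^ 2) hd ?_)
  · rw [one_div, mul_inv, ← div_eq_mul_inv]
    gcongr
    -- For any m, (a - m)² + (b - m)² ≥ (a - b)²/2, here at least 1/8.
    nlinarith [sq_nonneg (c.deriv j x - avg (c.deriv j) + (c.deriv j y - avg (c.deriv j)))]
  · intro h
    rw [h] at hxy
    norm_num at hxy

open Classical in
/-- The active constraints at `j` that depend on `j`. -/
def Instance.relevantAt (Φ : Instance n k) (G : Finset (Fin n)) (j : Fin n) : Finset (Fin Φ.m) :=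
  (Φ.activeAt G j).filter fun l => (Φ.con l).DependsOn j

theorem Instance.gain_eq_sum_relevantAt (Φ : Instance n k) (G : Finset (Fin n)) (j : Fin n)
    (x : Assignment n) : Φ.gain G j x = ∑ l ∈ Φ.relevantAt G j, (Φ.con l).deriv j x := by
  classical
  rw [Instance.gain, Instance.relevantAt, Finset.sum_filter]
  refine Finset.sum_congr rfl fun l _ => ?_
  split_ifs with h
  · rfl
  · exact Constraint.deriv_eq_zero h x

theorem Instance.TriangleFree.disjoint_erase {Φ : Instance n k} (hΦ : Φ.TriangleFree)
    {a b : Fin Φ.m} (hab : a ≠ b) {j : Fin n} (ha : j ∈ (Φ.con a).vars) (hb : j ∈ (Φ.con b).vars) :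
    Disjoint ((Φ.con a).vars.erase j) ((Φ.con b).vars.erase j) := by
  rw [Finset.disjoint_left]
  intro i hi hi'
  rw [Finset.mem_erase] at hi hi'
  exact hi.1 (Finset.card_le_one.1 (hΦ.1 a b hab) i (Finset.mem_inter.2 ⟨hi.2, hi'.2⟩) j
    (Finset.mem_inter.2 ⟨ha, hb⟩))

/-- The centred derivatives are bounded by 1 and read disjoint sets of variables, since two
constraints through `j` share nothing else; each relevant one has variance at least 1/(8·2^k). Only
constraints that depend on `j` are counted, because the others contribute zero to the gain. -/
theorem Instance.TriangleFree.sqrt_le_avg_abs_gain {Φ : Instance n k} (hΦ : Φ.TriangleFree)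
    {G : Finset (Fin n)} {j : Fin n}
    (h : ∀ l ∈ Φ.activeAt G j, (Φ.con l).DependsOn j → ∃ i, i ≠ j ∧ (Φ.con l).DependsOn i) (θ : ℝ) :
    1 / (640 * 4 ^ k) * √((Φ.relevantAt G j).card : ℝ) ≤ avg (fun x => |Φ.gain G j x - θ|) := by
  classical
  have hrel : ∀ l ∈ Φ.relevantAt G j, l ∈ Φ.activeAt G j ∧ (Φ.con l).DependsOn j := fun l hl =>
    Finset.mem_filter.1 hl
  have hmom := avg_sum_moments (α := ℤˣ) (Φ.relevantAt G j)
    (D := fun l => (Φ.con l).vars.erase j)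
    (W := fun l x => (Φ.con l).deriv j x - avg ((Φ.con l).deriv j))
    (fun l _ => DependsOn.comp_right ((Φ.con l).dependsOn_deriv j) (· - avg ((Φ.con l).deriv j)))
    (fun a ha b hb hab => hΦ.disjoint_erase hab
      (mem_vars_of_dependsOn (hrel a ha).2) (mem_vars_of_dependsOn (hrel b hb).2))
    (fun l _ => by rw [avg_sub, avg_const, sub_self])
    (fun l _ x => by
      have h1 := (Φ.con l).abs_deriv_le j x
      have h2 : |avg ((Φ.con l).deriv j)| ≤ 1 / 2 := by
        refine (abs_avg_le _).trans ?_
        rw [← avg_const (Ω := Assignment n) (1 / 2)]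
        exact avg_le_avg fun x => (Φ.con l).abs_deriv_le j x
      rw [abs_le] at *
      constructor <;> linarith)
  have hsum : ∀ x, ∑ l ∈ Φ.relevantAt G j, ((Φ.con l).deriv j x - avg ((Φ.con l).deriv j))
      = Φ.gain G j x - avg (Φ.gain G j) := by
    intro x
    have : Φ.gain G j = fun x => ∑ l ∈ Φ.relevantAt G j, (Φ.con l).deriv j x :=
      funext fun x => Φ.gain_eq_sum_relevantAt G j x
    rw [this, avg_sum, Finset.sum_sub_distrib]
  simp only [hsum] at hmom
  have hk : (1 : ℝ) ≤ 2 ^ k := one_le_pow₀ (by norm_num)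
  have hlow : 1 / (8 * 2 ^ k) * ((Φ.relevantAt G j).card : ℝ)
      ≤ avg (fun x => (Φ.gain G j x - avg (Φ.gain G j)) ^ 2) := by
    rw [hmom.1, mul_comm, ← nsmul_eq_mul, ← Finset.sum_const]
    refine Finset.sum_le_sum fun l hl => ?_
    obtain ⟨hl1, hl2⟩ := hrel l hl
    obtain ⟨i, hij, hi⟩ := h l hl1 hl2
    exact Constraint.variance_deriv hij hl2 hi
  have h1 := sqrt_le_avg_abs (Nat.cast_nonneg _) (by positivity)
    (by rw [div_le_one (by positivity)]; linarith) hlow hmom.2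
  have h2 := avg_abs_sub_avg_le (Φ.gain G j) θ
  -- The factor 2 is the loss in passing from the mean to θ.
  have e : (1 / (8 * 2 ^ k : ℝ)) ^ 2 / 5 = 2 * (1 / (640 * 4 ^ k)) := by
    have : (4 : ℝ) ^ k = 2 ^ k * 2 ^ k := by rw [← mul_pow]; norm_num
    rw [this]
    field_simp
    norm_num
  rw [e] at h1
  linarith

theorem eq_of_mem_support_algGivenF {ε : ℝ} {Φ : Instance n k} {G : Finset (Fin n)}
    {x y : Assignment n} (hx : x ∈ (algGivenF ε Φ G y).support) {i : Fin n} (hi : i ∉ G) :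
    x i = y i := by
  have := support_piLaw hx i
  simpa [hi] using this

theorem expect_algGivenF_mul (ε : ℝ) (Φ : Instance n k) {G S : Finset (Fin n)} (hS : Disjoint S G)
    {f : Assignment n → ℝ} (hf : _root_.DependsOn f (S : Set (Fin n))) {j : Fin n} (hj : j ∈ G)
    (y : Assignment n) :
    expect (algGivenF ε Φ G y) (fun x => ((x j : ℤ) : ℝ) * f x)
      = (Real.exp ε - 1) / (Real.exp ε + 1) * (bias (medianSign (Φ.gain G j) y) * f y) := by
  have h1 : expect (algGivenF ε Φ G y) (fun x => ((x j : ℤ) : ℝ) * f x)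
      = expect (algGivenF ε Φ G y) (fun x => f y * ((x j : ℤ) : ℝ)) := by
    refine expect_congr fun x hx => ?_
    rw [hf (x := x) (y := y) fun i hi => eq_of_mem_support_algGivenF hx
      (Finset.disjoint_left.1 hS (Finset.mem_coe.1 hi)), mul_comm]
  have h2 := expect_map (algGivenF ε Φ G y) (fun x => x j) (fun s : ℤˣ => ((s : ℤ) : ℝ))
  rw [map_eval_algGivenF ε Φ y hj] at h2
  rw [h1, expect_const_mul, ← h2]
  change f y * bias _ = _
  rw [bias_privateSign]
  ring

theorem expect_algGiven (ε : ℝ) (Φ : Instance n k) (G : Finset (Fin n)) (f : Assignment n → ℝ) :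
    expect (algGiven ε Φ G) f = avg fun y => expect (algGivenF ε Φ G y) f := by
  rw [algGiven, expect_bind, expect_uniform]

/-- Since the median sign has mean zero, the median may be subtracted from the gain for free, and
sign times difference is an absolute value. -/
theorem expect_algGiven_gain (ε : ℝ) (Φ : Instance n k) {G : Finset (Fin n)} {j : Fin n}
    (hj : j ∈ G) :
    expect (algGiven ε Φ G) (fun x => ((x j : ℤ) : ℝ) * Φ.gain G j x)
      = (Real.exp ε - 1) / (Real.exp ε + 1) *
        avg (fun y => |Φ.gain G j y - median (Φ.gain G j)|) := by
  rw [expect_algGiven]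
  simp only [expect_algGivenF_mul ε Φ (Φ.activeVars_disjoint G j) (Instance.dependsOn_gain hj) hj]
  rw [avg_const_mul]
  congr 1
  have : ∀ y, bias (medianSign (Φ.gain G j) y) * Φ.gain G j y
      = |Φ.gain G j y - median (Φ.gain G j)|
        + bias (medianSign (Φ.gain G j) y) * median (Φ.gain G j) := by
    intro y
    rw [← bias_medianSign_mul]
    ring
  simp only [this]
  rw [avg_add, avg_mul_const, avg_bias_medianSign]
  ring

theorem div_four_le_bias {ε : ℝ} (h0 : 0 ≤ ε) (h1 : ε ≤ 1) :
    ε / 4 ≤ (Real.exp ε - 1) / (Real.exp ε + 1) := by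
  have hl := Real.add_one_le_exp ε
  have hu : Real.exp ε ≤ 3 := (Real.exp_le_exp.2 h1).trans (Real.exp_one_lt_d9.le.trans (by norm_num))
  exact div_le_div₀ (by linarith) (by linarith) (by linarith) (by linarith)

theorem Instance.TriangleFree.gain_lower_bound {Φ : Instance n k} (hΦ : Φ.TriangleFree)
    {ε : ℝ} (h0 : 0 ≤ ε) (h1 : ε ≤ 1) {G : Finset (Fin n)} {j : Fin n} (hj : j ∈ G)
    (h : ∀ l ∈ Φ.activeAt G j, (Φ.con l).DependsOn j → ∃ i, i ≠ j ∧ (Φ.con l).DependsOn i) :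
    1 / 2560 * ε / 4 ^ k * √((Φ.relevantAt G j).card : ℝ) ≤
      expect (algGiven ε Φ G) (fun x => ((x j : ℤ) : ℝ) * Φ.gain G j x) := by
  rw [expect_algGiven_gain ε Φ hj]
  have := mul_le_mul (div_four_le_bias h0 h1)
    (hΦ.sqrt_le_avg_abs_gain h (median (Φ.gain G j))) (by positivity)
    ((div_nonneg h0 (by norm_num)).trans (div_four_le_bias h0 h1))
  refine le_trans (le_of_eq ?_) this
  field_simp
  ring

/-- From e ≥ 2; this explains the constant 2 in the exponent of the gain bound. -/
theorem exp_neg_two_mul_le (k : ℕ) : Real.exp (-(2 * k)) ≤ 1 / 4 ^ k := by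
  have h : (2 : ℝ) ≤ Real.exp 1 := by
    have := Real.add_one_le_exp (1 : ℝ)
    linarith
  have h4 : (4 : ℝ) ^ k ≤ Real.exp (2 * k) := by
    have : Real.exp (2 * k) = ((Real.exp 1) ^ 2) ^ k := by
      rw [← Real.exp_nat_mul, ← Real.exp_nat_mul]
      congr 1
      push_cast
      ring
    rw [this]
    gcongr
    nlinarith
  rw [Real.exp_neg, one_div]
  exact inv_anti₀ (by positivity) h4

end Gain

/-! ### Laws that look uniform on a set of coordinates -/

section Uniformity

variable {n k : ℕ}

theorem avg_toReal_eq_half {Ω : Type*} [Fintype Ω] [Nonempty Ω] {p : Ω → PMF ℤˣ}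
    (h : avg (fun ω => bias (p ω)) = 0) (s : ℤˣ) : avg (fun ω => (p ω s).toReal) = 1 / 2 := by
  have h1 : ∀ ω, (p ω 1).toReal = (bias (p ω) + 1) * (1 / 2) := fun ω => by
    rw [bias_eq]; ring
  have h2 : ∀ ω, (p ω (-1)).toReal = 1 - (p ω 1).toReal := fun ω => by
    have h := sum_toReal_eq_one (p ω)
    have hu : (Finset.univ : Finset ℤˣ) = {1, -1} := by decide
    rw [hu, Finset.sum_pair (by decide)] at h
    linarith
  have h3 : avg (fun ω => (p ω 1).toReal) = 1 / 2 := by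
    simp only [h1]
    rw [avg_mul_const, avg_add, h, avg_const]
    norm_num
  rcases Int.units_eq_one_or s with rfl | rfl
  · exact h3
  · simp only [h2]
    rw [avg_sub, avg_const, h3]
    norm_num

/-- The laws of the coordinates in `S` are read from disjoint parts of the uniform point `y`, so the
average of the product of probabilities factors. Each factor averages to 1/2 because the biases
average to zero. Hence the coordinates in `S` are jointly uniform. -/
theorem avg_expect_piLaw {p : Assignment n → Fin n → PMF ℤˣ} {S : Finset (Fin n)}
    {D : Fin n → Finset (Fin n)}
    (hp : ∀ i ∈ S, _root_.DependsOn (fun y => p y i) (D i : Set (Fin n)))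
    (hD : (S : Set (Fin n)).PairwiseDisjoint D) (h0 : ∀ i ∈ S, avg (fun y => bias (p y i)) = 0)
    {f : Assignment n → ℝ} (hf : _root_.DependsOn f (S : Set (Fin n))) :
    avg (fun y => expect (piLaw (p y)) f) = avg f := by
  classical
  -- Coordinates outside `S` are made uniform, which `f` cannot see; then all `n` factors average to
  -- 1/2.
  let q : Assignment n → Fin n → PMF ℤˣ := fun y i =>
    if i ∈ S then p y i else PMF.uniformOfFintype ℤˣ
  have h1 : ∀ y, expect (piLaw (p y)) f = expect (piLaw (q y)) f := fun y =>
    expect_piLaw_congr (fun i hi => by simp [q, hi]) hf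
  have hq : ∀ i, avg (fun y => bias (q y i)) = 0 := by
    intro i
    by_cases hi : i ∈ S
    · simpa [q, hi] using h0 i hi
    · simp [q, hi, bias_uniform, avg_const]
  have h2 : ∀ x : Assignment n, avg (fun y => ∏ i, (q y i (x i)).toReal) = (1 / 2) ^ n := by
    intro x
    rw [avg_prod_of_disjoint (α := ℤˣ) Finset.univ (D := fun i => if i ∈ S then D i else ∅)
      (f := fun i y => (q y i (x i)).toReal)]
    · rw [Finset.prod_congr rfl fun i _ => avg_toReal_eq_half (hq i) (x i)]
      simp
    · intro i _
      by_cases hi : i ∈ S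
      · intro y y' h
        simp only [hi, if_true] at h
        have := hp i hi h
        simp only at this
        simp only [q, hi, if_true, this]
      · intro y y' _
        simp [q, hi]
    · intro i _ j _ hij
      by_cases hi : i ∈ S <;> by_cases hj : j ∈ S <;> simp [Function.onFun, hi, hj]
      exact hD hi hj hij
  simp only [h1]
  simp only [expect, piLaw_apply, ENNReal.toReal_prod]
  rw [avg_sum]
  simp only [avg_mul_const, h2]
  rw [← Finset.mul_sum, avg]
  simp only [Fintype.card_fun, Fintype.card_fin, Fintype.card_units_int]
  push_cast
  rw [div_pow, one_pow]
  ring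

theorem avg_update (f : Assignment n → ℝ) (j : Fin n) :
    avg (fun x => (f (Function.update x j 1) + f (Function.update x j (-1))) / 2) = avg f := by
  have h := piLaw_bind_update (fun _ : Fin n => PMF.uniformOfFintype ℤˣ) j
    (PMF.uniformOfFintype ℤˣ)
  rw [Function.update_eq_self_iff.2 rfl, piLaw_uniform] at h
  have h2 := congrArg (fun p => expect p f) h
  simp only [expect_bind, expect_uniform, expect_map] at h2
  rw [← h2]
  congr 1
  funext x
  rw [← expect_uniform, expect_sign]
  simp only [PMF.uniformOfFintype_apply, Fintype.card_units_int, Nat.cast_ofNat,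
    ENNReal.toReal_inv, ENNReal.toReal_ofNat]
  ring

theorem avg_coordinate (i : Fin n) : avg (fun y : Assignment n => ((y i : ℤ) : ℝ)) = 0 := by
  rw [← avg_update _ i]
  simp [avg_const]

end Uniformity

/-! ### The expected advantage -/

section Advantage

variable {n k : ℕ}

theorem Constraint.avg_centred (c : Constraint n k) : avg c.centred = 0 := by
  have : c.centred = fun x => c.value x - avg c.value := rfl
  rw [this, avg_sub, avg_const, sub_self]

/-- A common variable would lie in active constraints `a` at `i` and `b` at `j`, and with `l` these
intersect pairwise. A point common to all three equals `i`, since `a` and `l` share at most one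
variable, and likewise equals `j`. Inactivity of `l` keeps it distinct from `a` and `b`. -/
theorem Instance.TriangleFree.disjoint_activeVars {Φ : Instance n k} (hΦ : Φ.TriangleFree)
    {G : Finset (Fin n)} {l : Fin Φ.m} (hl : ((Φ.con l).vars ∩ G).card ≠ 1) {i j : Fin n}
    (hij : i ≠ j) (hi : i ∈ (Φ.con l).vars) (hj : j ∈ (Φ.con l).vars) (hiG : i ∈ G) (hjG : j ∈ G) :
    Disjoint (Φ.activeVars G i) (Φ.activeVars G j) := by
  rw [Finset.disjoint_left]
  intro v hv hv'
  obtain ⟨a, ha, hva⟩ := Finset.mem_biUnion.1 hv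
  obtain ⟨b, hb, hvb⟩ := Finset.mem_biUnion.1 hv'
  have ha' := Instance.mem_activeAt.1 ha
  have hb' := Instance.mem_activeAt.1 hb
  have hal : a ≠ l := by rintro rfl; exact hl ha'.1
  have hbl : b ≠ l := by rintro rfl; exact hl hb'.1
  have hab : a ≠ b := by
    rintro rfl
    exact hij (Finset.card_le_one.1 ha'.1.le i (Finset.mem_inter.2 ⟨ha'.2, hiG⟩) j
      (Finset.mem_inter.2 ⟨hb'.2, hjG⟩))
  obtain ⟨u, hu⟩ := hΦ.2 a b l hab hbl hal
    ⟨v, Finset.mem_inter.2 ⟨(Finset.mem_sdiff.1 hva).1, (Finset.mem_sdiff.1 hvb).1⟩⟩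
    ⟨j, Finset.mem_inter.2 ⟨hb'.2, hj⟩⟩ ⟨i, Finset.mem_inter.2 ⟨ha'.2, hi⟩⟩
  simp only [Finset.mem_inter] at hu
  have h1 := Finset.card_le_one.1 (hΦ.1 a l hal) u (Finset.mem_inter.2 ⟨hu.1.1, hu.2⟩) i
    (Finset.mem_inter.2 ⟨ha'.2, hi⟩)
  have h2 := Finset.card_le_one.1 (hΦ.1 b l hbl) u (Finset.mem_inter.2 ⟨hu.1.2, hu.2⟩) j
    (Finset.mem_inter.2 ⟨hb'.2, hj⟩)
  exact hij (h1.symm.trans h2)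

/-- Otherwise some active constraint would share both `i` and `j` with the inactive `l`. -/
theorem Instance.TriangleFree.notMem_activeVars {Φ : Instance n k} (hΦ : Φ.TriangleFree)
    {G : Finset (Fin n)} {l : Fin Φ.m} (hl : ((Φ.con l).vars ∩ G).card ≠ 1) {i j : Fin n}
    (hij : i ≠ j) (hi : i ∈ (Φ.con l).vars) (hj : j ∈ (Φ.con l).vars) :
    j ∉ Φ.activeVars G i := by
  intro hv
  obtain ⟨a, ha, hva⟩ := Finset.mem_biUnion.1 hv
  have ha' := Instance.mem_activeAt.1 ha
  have hal : a ≠ l := by rintro rfl; exact hl ha'.1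
  exact hij (Finset.card_le_one.1 (hΦ.1 a l hal) i (Finset.mem_inter.2 ⟨ha'.2, hi⟩) j
    (Finset.mem_inter.2 ⟨(Finset.mem_sdiff.1 hva).1, hj⟩))

/-- A variable in `G` reads `activeVars` and a variable outside reads only itself; for an inactive
constraint these sets are disjoint, so the constraint sees uniform arguments. -/
theorem Instance.TriangleFree.expect_centred_eq_zero {Φ : Instance n k} (hΦ : Φ.TriangleFree)
    (ε : ℝ) {G : Finset (Fin n)} {l : Fin Φ.m} (hl : ((Φ.con l).vars ∩ G).card ≠ 1) :
    expect (algGiven ε Φ G) (Φ.con l).centred = 0 := by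
  rw [expect_algGiven, ← (Φ.con l).avg_centred]
  refine avg_expect_piLaw (S := (Φ.con l).vars)
    (D := fun i => if i ∈ G then Φ.activeVars G i else {i}) ?_ ?_ ?_ (Φ.con l).dependsOn_centred
  · intro i _
    by_cases hi : i ∈ G
    · simpa [hi] using privateSign_congr ε Φ hi
    · intro y y' h
      simp only [hi, if_false] at h
      simp [hi, h i (by simp)]
  · intro i hi j hj hij
    simp only [Function.onFun]
    by_cases hiG : i ∈ G <;> by_cases hjG : j ∈ G <;> simp only [hiG, hjG, if_true, if_false]
    · exact hΦ.disjoint_activeVars hl hij hi hj hiG hjG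
    · exact Finset.disjoint_singleton_right.2 (hΦ.notMem_activeVars hl hij hi hj)
    · exact Finset.disjoint_singleton_left.2 (hΦ.notMem_activeVars hl hij.symm hj hi)
    · exact Finset.disjoint_singleton.2 hij
  · intro i _
    by_cases hi : i ∈ G
    · simpa [hi] using avg_bias_privateSign ε Φ G i
    · simpa [hi, bias_pure] using avg_coordinate i

/-- Split the constraint into `x j` times its derivative and its average over `x j`. The second part
reads only uniform variables outside `G`, and its mean is that of the centred constraint, zero. -/
theorem expect_centred_of_active (ε : ℝ) (Φ : Instance n k) {G : Finset (Fin n)} {j : Fin n}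
    (hj : j ∈ G) {l : Fin Φ.m} (hl : l ∈ Φ.activeAt G j) :
    expect (algGiven ε Φ G) (Φ.con l).centred
      = expect (algGiven ε Φ G) (fun x => ((x j : ℤ) : ℝ) * (Φ.con l).deriv j x) := by
  set c := Φ.con l
  have h1 : ∀ x, c.centred x = ((x j : ℤ) : ℝ) * c.deriv j x
      + (c.centred (Function.update x j 1) + c.centred (Function.update x j (-1))) / 2 := by
    intro x
    have hx : c.centred x = c.centred (Function.update x j (x j)) := by
      rw [Function.update_eq_self]
    rw [hx, Constraint.deriv]
    rcases Int.units_eq_one_or (x j) with h | h <;> rw [h] <;> push_cast <;> ring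
  have h2 : ∀ y, expect (algGivenF ε Φ G y)
      (fun x => (c.centred (Function.update x j 1) + c.centred (Function.update x j (-1))) / 2)
      = (c.centred (Function.update y j 1) + c.centred (Function.update y j (-1))) / 2 := by
    intro y
    rw [← expect_const (algGivenF ε Φ G y) ((c.centred (Function.update y j 1) +
      c.centred (Function.update y j (-1))) / 2)]
    refine expect_congr fun x hx => ?_
    have hxy : ∀ i ∈ ((c.vars.erase j : Finset (Fin n)) : Set (Fin n)), x i = y i := by
      intro i hi
      rw [Instance.erase_eq_sdiff hj hl] at hi
      exact eq_of_mem_support_algGivenF hx (Finset.mem_sdiff.1 (Finset.mem_coe.1 hi)).2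
    have e1 := Constraint.dependsOn_comp_update c.dependsOn_centred j 1 hxy
    have e2 := Constraint.dependsOn_comp_update c.dependsOn_centred j (-1) hxy
    simp only at e1 e2
    rw [e1, e2]
  have h3 : c.centred = fun x => ((x j : ℤ) : ℝ) * c.deriv j x
      + (c.centred (Function.update x j 1) + c.centred (Function.update x j (-1))) / 2 :=
    funext h1
  conv_lhs => rw [h3]
  rw [expect_add, expect_algGiven ε Φ G (fun x => (c.centred (Function.update x j 1) +
    c.centred (Function.update x j (-1))) / 2)]
  simp only [h2]
  rw [avg_update, Constraint.avg_centred, add_zero]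

/-- After exchanging the sums, an active constraint is met exactly once, at its variable in `G`, and
the others vanish on both sides. -/
theorem Instance.TriangleFree.expect_sum_centred {Φ : Instance n k} (hΦ : Φ.TriangleFree)
    (ε : ℝ) (G : Finset (Fin n)) :
    expect (algGiven ε Φ G) (fun x => ∑ l, (Φ.con l).centred x)
      = ∑ j ∈ G, expect (algGiven ε Φ G) (fun x => ((x j : ℤ) : ℝ) * Φ.gain G j x) := by
  have h1 : ∀ j, expect (algGiven ε Φ G) (fun x => ((x j : ℤ) : ℝ) * Φ.gain G j x)
      = ∑ l, if ((Φ.con l).vars ∩ G).card = 1 ∧ j ∈ (Φ.con l).vars then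
        expect (algGiven ε Φ G) (fun x => ((x j : ℤ) : ℝ) * (Φ.con l).deriv j x) else 0 := by
    intro j
    simp only [Instance.gain, Finset.mul_sum]
    rw [expect_sum, Instance.activeAt, Finset.sum_filter]
  simp only [h1]
  rw [expect_sum, Finset.sum_comm]
  refine Finset.sum_congr rfl fun l _ => ?_
  by_cases hl : ((Φ.con l).vars ∩ G).card = 1
  · obtain ⟨j, hj⟩ := Finset.card_eq_one.1 hl
    have hjm : j ∈ (Φ.con l).vars ∩ G := by rw [hj]; simp
    rw [Finset.mem_inter] at hjm
    rw [Finset.sum_eq_single_of_mem j hjm.2, if_pos ⟨hl, hjm.1⟩]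
    · exact expect_centred_of_active ε Φ hjm.2 (Instance.mem_activeAt.2 ⟨hl, hjm.1⟩)
    · intro i hi hij
      refine if_neg fun h => hij ?_
      have : i ∈ (Φ.con l).vars ∩ G := Finset.mem_inter.2 ⟨h.2, hi⟩
      rwa [hj, Finset.mem_singleton] at this
  · rw [hΦ.expect_centred_eq_zero ε hl]
    simp [hl]

/-- Each subset of the complement of `S`, with `j` inserted, is such a `G`; these are 2^(n - |S|) of
the 2^n sets. -/
theorem pow_le_avg_inter_eq {S : Finset (Fin n)} {j : Fin n} (hj : j ∈ S) (hS : S.card ≤ k) :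
    1 / 2 ^ k ≤ avg (fun G : Finset (Fin n) => if S ∩ G = {j} then (1 : ℝ) else 0) := by
  classical
  have hsub : (Finset.univ \ S).powerset.image (insert j)
      ⊆ Finset.univ.filter fun G : Finset (Fin n) => S ∩ G = {j} := by
    intro G hG
    obtain ⟨T, hT, rfl⟩ := Finset.mem_image.1 hG
    simp only [Finset.mem_filter, Finset.mem_univ, true_and]
    ext i
    simp only [Finset.mem_inter, Finset.mem_insert, Finset.mem_singleton]
    constructor
    · rintro ⟨hi, rfl | hT'⟩
      · rfl
      · exact absurd hi (Finset.mem_sdiff.1 (Finset.mem_powerset.1 hT hT')).2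
    · rintro rfl
      exact ⟨hj, Or.inl rfl⟩
  have hinj : Set.InjOn (insert j) ((Finset.univ \ S).powerset : Set (Finset (Fin n))) := by
    intro T hT T' hT' h
    have hnot : ∀ U ∈ (Finset.univ \ S).powerset, j ∉ U := fun U hU hjU =>
      (Finset.mem_sdiff.1 (Finset.mem_powerset.1 hU hjU)).2 hj
    rw [← Finset.erase_insert (hnot T hT), ← Finset.erase_insert (hnot T' hT'), h]
  have hcard := Finset.card_le_card hsub
  rw [Finset.card_image_of_injOn hinj, Finset.card_powerset, Finset.card_sdiff_of_subset
    (Finset.subset_univ S), Finset.card_univ, Fintype.card_fin] at hcard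
  have hSn : S.card ≤ n := by simpa using Finset.card_le_univ S
  have h2 : 2 ^ n ≤ 2 ^ (n - S.card) * 2 ^ k := by
    rw [← pow_add]
    exact Nat.pow_le_pow_right (by norm_num) (by omega)
  rw [avg, Finset.sum_boole, Fintype.card_finset, Fintype.card_fin,
    div_le_div_iff₀ (by positivity) (by positivity), one_mul]
  calc ((2 ^ n : ℕ) : ℝ) ≤ ((2 ^ (n - S.card) * 2 ^ k : ℕ) : ℝ) := by exact_mod_cast h2
    _ = ((2 ^ (n - S.card) : ℕ) : ℝ) * 2 ^ k := by push_cast; ring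
    _ ≤ _ := by gcongr

theorem Instance.div_le_avg_sum_card_relevantAt (Φ : Instance n k)
    (h : ∀ l, (Φ.con l).Nondegenerate) :
    (Φ.m : ℝ) / 2 ^ k ≤ avg (fun G : Finset (Fin n) => ∑ j ∈ G, ((Φ.relevantAt G j).card : ℝ)) := by
  classical
  -- It suffices to count each constraint at one variable `v l` on which it depends.
  choose v w _ hv _ using h
  have h1 : ∀ G : Finset (Fin n), ∑ l, (if (Φ.con l).vars ∩ G = {v l} then (1 : ℝ) else 0)
      ≤ ∑ j ∈ G, ((Φ.relevantAt G j).card : ℝ) := by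
    intro G
    have h2 : ∀ j, ((Φ.relevantAt G j).card : ℝ)
        = ∑ l, if l ∈ Φ.relevantAt G j then (1 : ℝ) else 0 := by
      intro j
      rw [Finset.sum_boole]
      simp
    simp only [h2]
    rw [Finset.sum_comm]
    refine Finset.sum_le_sum fun l _ => ?_
    split_ifs with hl
    · have hm : v l ∈ (Φ.con l).vars ∩ G := by rw [hl]; simp
      rw [Finset.mem_inter] at hm
      have hr : l ∈ Φ.relevantAt G (v l) := Finset.mem_filter.2
        ⟨Instance.mem_activeAt.2 ⟨by rw [hl]; simp, hm.1⟩, hv l⟩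
      have := Finset.single_le_sum (f := fun j => if l ∈ Φ.relevantAt G j then (1 : ℝ) else 0)
        (fun j _ => by positivity) hm.2
      simpa [hr] using this
    · exact Finset.sum_nonneg fun j _ => by positivity
  refine le_trans ?_ (avg_le_avg h1)
  rw [avg_sum]
  have h3 : ∀ l, (1 : ℝ) / 2 ^ k
      ≤ avg (fun G : Finset (Fin n) => if (Φ.con l).vars ∩ G = {v l} then (1 : ℝ) else 0) :=
    fun l => pow_le_avg_inter_eq (mem_vars_of_dependsOn (hv l))
      (by simpa [Constraint.vars] using (Φ.con l).arity_le)
  refine le_trans (le_of_eq ?_) (Finset.sum_le_sum fun l _ => h3 l)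
  simp [div_eq_mul_inv]

theorem div_sqrt_le_sqrt {a D : ℕ} (h : a ≤ D) : (a : ℝ) / √(D : ℝ) ≤ √(a : ℝ) := by
  -- For `D = 0` the quotient is 0 by the convention on division.
  rcases Nat.eq_zero_or_pos D with rfl | hD
  · simp
  have hD' : 0 < √(D : ℝ) := Real.sqrt_pos.2 (by exact_mod_cast hD)
  rw [div_le_iff₀ hD']
  calc (a : ℝ) = √(a : ℝ) * √(a : ℝ) := (Real.mul_self_sqrt (Nat.cast_nonneg _)).symm
    _ ≤ _ := by gcongr

theorem Instance.TriangleFree.advantage_lower_bound {Φ : Instance n k} (hΦ : Φ.TriangleFree)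
    {ε : ℝ} (h0 : 0 ≤ ε) (h1 : ε ≤ 1) {D : ℕ} (hD : ∀ i, Φ.degree i ≤ D) (hm : 0 < Φ.m)
    (h : ∀ l, (Φ.con l).Nondegenerate) :
    1 / (2560 * 4 ^ k * 2 ^ k) * ε / √(D : ℝ) ≤ expect (alg ε Φ) Φ.advantage := by
  have hm' : (0 : ℝ) < Φ.m := by exact_mod_cast hm
  classical
  have hdep : ∀ (G : Finset (Fin n)) (j : Fin n), ∀ l ∈ Φ.activeAt G j,
      (Φ.con l).DependsOn j → ∃ i, i ≠ j ∧ (Φ.con l).DependsOn i := by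
    intro G j l _ _
    obtain ⟨a, b, hab, ha, hb⟩ := h l
    by_cases haj : a = j
    · exact ⟨b, by rintro rfl; exact hab haj, hb⟩
    · exact ⟨a, haj, ha⟩
  have hG : ∀ G : Finset (Fin n), 1 / 2560 * ε / 4 ^ k / √(D : ℝ) *
      ∑ j ∈ G, ((Φ.relevantAt G j).card : ℝ)
      ≤ expect (algGiven ε Φ G) (fun x => ∑ l, (Φ.con l).centred x) := by
    intro G
    rw [hΦ.expect_sum_centred, Finset.mul_sum]
    refine Finset.sum_le_sum fun j hj => le_trans ?_ (hΦ.gain_lower_bound h0 h1 hj (hdep G j))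
    have hc : (Φ.relevantAt G j).card ≤ D := by
      refine le_trans (Finset.card_le_card ?_) (hD j)
      intro l hl
      rw [Instance.relevantAt, Finset.mem_filter] at hl
      exact Finset.mem_filter.2 ⟨Finset.mem_univ _, (Instance.mem_activeAt.1 hl.1).2⟩
    rw [div_mul_eq_mul_div, mul_div_assoc]
    exact mul_le_mul_of_nonneg_left (div_sqrt_le_sqrt hc) (by positivity)
  have hadv : Φ.advantage = fun x => 1 / (Φ.m : ℝ) * ∑ l, (Φ.con l).centred x := rfl
  rw [alg, expect_bind, expect_uniform, hadv]
  simp only [expect_const_mul]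
  rw [avg_const_mul]
  calc 1 / (2560 * 4 ^ k * 2 ^ k) * ε / √(D : ℝ)
      = 1 / (Φ.m : ℝ) * (1 / 2560 * ε / 4 ^ k / √(D : ℝ) * (Φ.m / 2 ^ k)) := by
        field_simp
    _ ≤ 1 / (Φ.m : ℝ) * avg (fun G : Finset (Fin n) => 1 / 2560 * ε / 4 ^ k / √(D : ℝ) *
        ∑ j ∈ G, ((Φ.relevantAt G j).card : ℝ)) := by
        rw [avg_const_mul]
        gcongr
        exact Φ.div_le_avg_sum_card_relevantAt h
    _ ≤ _ := by
        gcongr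
        exact avg_le_avg hG

theorem Instance.val_eq (Φ : Instance n k) (x : Assignment n) :
    (Φ.val x : ℝ) = ∑ l, (Φ.con l).value x := by
  simp [Instance.val, Constraint.value, Finset.sum_boole]

theorem Instance.val_eq_add_advantage (Φ : Instance n k) (hm : 0 < Φ.m) (x : Assignment n) :
    (Φ.val x : ℝ) = Φ.m * Φ.mu + Φ.m * Φ.advantage x := by
  have hm' : (Φ.m : ℝ) ≠ 0 := by exact_mod_cast hm.ne'
  have h1 : (Φ.m : ℝ) * Φ.mu = ∑ l, avg (Φ.con l).value := by
    rw [Instance.mu, mul_div_cancel₀ _ hm']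
    simp only [Instance.val_eq]
    rw [avg_sum]
  rw [h1, Instance.advantage, ← mul_assoc, mul_one_div_cancel hm', one_mul,
    ← Finset.sum_add_distrib, Instance.val_eq]
  exact Finset.sum_congr rfl fun l _ => by rw [Constraint.centred]; ring

theorem Instance.opt_le (Φ : Instance n k) : Φ.opt ≤ Φ.m :=
  Finset.sup_le fun x _ => by
    simpa [Instance.val] using Finset.card_le_univ
      (Finset.univ.filter fun l : Fin Φ.m => (Φ.con l).Sat x)

/-- The value is m(μ + advantage), and OPT ≤ m. -/
theorem Instance.mul_opt_le_expect_val (Φ : Instance n k) (hm : 0 < Φ.m) {p : PMF (Assignment n)}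
    {a : ℝ} (ha : 0 ≤ a) (h : a ≤ expect p Φ.advantage) :
    (Φ.mu + a) * (Φ.opt : ℝ) ≤ expect p (fun x => (Φ.val x : ℝ)) := by
  simp only [Φ.val_eq_add_advantage hm]
  rw [expect_add, expect_const, expect_const_mul]
  have hmu : 0 ≤ Φ.mu := div_nonneg (avg_nonneg fun _ => Nat.cast_nonneg _) (Nat.cast_nonneg _)
  have ho : (Φ.opt : ℝ) ≤ Φ.m := by exact_mod_cast Φ.opt_le
  calc (Φ.mu + a) * (Φ.opt : ℝ) ≤ (Φ.mu + a) * Φ.m := by gcongr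
    _ = Φ.m * Φ.mu + Φ.m * a := by ring
    _ ≤ _ := by gcongr

end Advantage

/-! ### The memory of a machine without its clock -/

section MemorySemantics

/-- Overwrite one memory cell. -/
def Memory.upd (σ : Memory) (arr row col v : ℕ) : Memory :=
  fun a r c => if a = arr ∧ r = row ∧ c = col then v else σ a r c

/-- Run `body 0`, ..., `body (N - 1)` one after the other. -/
def iterateLaw {α : Type*} (body : ℕ → α → PMF α) : ℕ → α → PMF α
  | 0, s => PMF.pure s
  | N + 1, s => (iterateLaw body N s).bind (body N)

/-- Run deterministic steps `body 0`, ..., `body (N - 1)` one after the other. -/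
def iterateFun {α : Type*} (body : ℕ → α → α) : ℕ → α → α
  | 0, s => s
  | N + 1, s => body N (iterateFun body N s)

/-- The law of the memory after the execution of a program. -/
def RCmd.law (coin : PMF ℤˣ) : RCmd → Memory → PMF Memory
  | skip, σ => PMF.pure σ
  | set arr row col e, σ => PMF.pure (σ.upd arr (row.eval σ) (col.eval σ) (e.eval σ))
  | seq c d, σ => (c.law coin σ).bind (d.law coin)
  | ite e c d, σ => if e.eval σ ≠ 0 then c.law coin σ else d.law coin σ
  | loop arr e c, σ => iterateLaw (fun t τ => c.law coin (τ.upd arr 0 0 t)) (e.eval σ) σ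
  | unif arr row col e, σ =>
      (uniformBelow (e.eval σ)).map fun v => σ.upd arr (row.eval σ) (col.eval σ) v
  | flip arr row col, σ =>
      coin.map fun b => σ.upd arr (row.eval σ) (col.eval σ) (if b = 1 then 1 else 0)

theorem map_mem_iterate {body : ℕ → MState → PMF MState} {body' : ℕ → Memory → PMF Memory}
    (h : ∀ t s, (body t s).map MState.mem = body' t s.mem) (N : ℕ) (s : MState) :
    (iterate body N s).map MState.mem = iterateLaw body' N s.mem := by
  induction N with
  | zero => simp [iterate, iterateLaw, PMF.pure_map]
  | succ N ih =>
    rw [iterate, iterateLaw, PMF.map_bind, ← ih, PMF.bind_map]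
    simp only [h, Function.comp_def]

/-- The clock never influences the computation, so correctness can be proved on memories and time
treated separately. -/
theorem RCmd.map_mem_exec (coin : PMF ℤˣ) (c : RCmd) (s : MState) :
    (c.exec coin s).map MState.mem = c.law coin s.mem := by
  induction c generalizing s with
  | skip => simp [RCmd.exec, RCmd.law, PMF.pure_map]
  | set arr row col e => simp only [RCmd.exec, RCmd.law, PMF.pure_map]; rfl
  | seq c d hc hd =>
    rw [RCmd.exec, RCmd.law, PMF.map_bind, ← hc, PMF.bind_map]
    simp only [hd, Function.comp_def]
  | ite e c d hc hd =>
    simp only [RCmd.exec, RCmd.law]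
    split_ifs
    · exact hc _
    · exact hd _
  | loop arr e c hc =>
    simp only [RCmd.exec, RCmd.law]
    exact map_mem_iterate (body := fun t s' => c.exec coin (s'.write arr 0 0 t (1 + Nat.size t)))
      (body' := fun t τ => c.law coin (τ.upd arr 0 0 t)) (fun t s => hc _) _ _
  | unif arr row col e =>
    simp only [RCmd.exec, RCmd.law, PMF.map_comp]
    rfl
  | flip arr row col =>
    simp only [RCmd.exec, RCmd.law, PMF.map_comp]
    rfl

/-- The program makes no random choices. -/
def RCmd.Det : RCmd → Prop
  | skip => True
  | set _ _ _ _ => True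
  | seq c d => c.Det ∧ d.Det
  | ite _ c d => c.Det ∧ d.Det
  | loop _ _ c => c.Det
  | unif _ _ _ _ => False
  | flip _ _ _ => False

/-- The memory after the execution of a deterministic program. -/
def RCmd.run : RCmd → Memory → Memory
  | skip, σ => σ
  | set arr row col e, σ => σ.upd arr (row.eval σ) (col.eval σ) (e.eval σ)
  | seq c d, σ => d.run (c.run σ)
  | ite e c d, σ => if e.eval σ ≠ 0 then c.run σ else d.run σ
  | loop arr e c, σ => iterateFun (fun t τ => c.run (τ.upd arr 0 0 t)) (e.eval σ) σ
  | unif _ _ _ _, σ => σ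
  | flip _ _ _, σ => σ

theorem iterateLaw_pure {α : Type*} (body : ℕ → α → α) (N : ℕ) (s : α) :
    iterateLaw (fun t s => PMF.pure (body t s)) N s = PMF.pure (iterateFun body N s) := by
  induction N with
  | zero => rfl
  | succ N ih => rw [iterateLaw, iterateFun, ih, PMF.pure_bind]

theorem RCmd.law_eq_pure (coin : PMF ℤˣ) {c : RCmd} (hc : c.Det) (σ : Memory) :
    c.law coin σ = PMF.pure (c.run σ) := by
  induction c generalizing σ with
  | skip => rfl
  | set arr row col e => rfl
  | seq c d ihc ihd =>
    rw [RCmd.law, ihc hc.1, PMF.pure_bind, ihd hc.2, RCmd.run]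
  | ite e c d ihc ihd =>
    simp only [RCmd.law, RCmd.run, ihc hc.1, ihd hc.2]
    split_ifs <;> rfl
  | loop arr e c ih =>
    simp only [RCmd.law, RCmd.run, ih hc]
    exact iterateLaw_pure _ _ _
  | unif => exact hc.elim
  | flip => exact hc.elim

/-- The arrays into which a program may write. -/
def RCmd.writes : RCmd → Finset ℕ
  | skip => ∅
  | set arr _ _ _ => {arr}
  | seq c d => c.writes ∪ d.writes
  | ite _ c d => c.writes ∪ d.writes
  | loop arr _ c => {arr} ∪ c.writes
  | unif arr _ _ _ => {arr}
  | flip arr _ _ => {arr}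

theorem Memory.upd_of_ne {σ : Memory} {arr a : ℕ} (h : a ≠ arr) (row col v : ℕ) :
    σ.upd arr row col v a = σ a := by
  funext r c
  simp [Memory.upd, h]

theorem Memory.upd_self (σ : Memory) (arr row col v : ℕ) :
    σ.upd arr row col v arr row col = v := by
  simp [Memory.upd]

theorem Memory.upd_le {σ : Memory} {arr row col v a r c N : ℕ} (hv : v ≤ N)
    (hσ : σ a r c ≤ N) : σ.upd arr row col v a r c ≤ N := by
  unfold Memory.upd
  split_ifs <;> assumption

theorem iterateFun_induction {α : Type*} {body : ℕ → α → α} {s : α} (Q : ℕ → α → Prop)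
    (h0 : Q 0 s) {N : ℕ} (h : ∀ t < N, ∀ τ, Q t τ → Q (t + 1) (body t τ)) :
    Q N (iterateFun body N s) := by
  induction N with
  | zero => exact h0
  | succ N ih =>
    exact h N N.lt_succ_self _ (ih fun t ht => h t (ht.trans N.lt_succ_self))

/-- The frame rule: arrays that do not occur as targets are untouched. -/
theorem RCmd.run_of_notMem (c : RCmd) {a : ℕ} (ha : a ∉ c.writes) (σ : Memory) :
    c.run σ a = σ a := by
  induction c generalizing σ with
  | skip => rfl
  | set arr row col e =>
    exact Memory.upd_of_ne (by simpa [RCmd.writes] using ha) _ _ _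
  | seq c d ihc ihd =>
    simp only [RCmd.writes, Finset.mem_union, not_or] at ha
    rw [RCmd.run, ihd ha.2, ihc ha.1]
  | ite e c d ihc ihd =>
    simp only [RCmd.writes, Finset.mem_union, not_or] at ha
    rw [RCmd.run]
    split_ifs
    · exact ihc ha.1 _
    · exact ihd ha.2 _
  | loop arr e c ih =>
    simp only [RCmd.writes, Finset.mem_union, Finset.mem_singleton, not_or] at ha
    rw [RCmd.run]
    refine iterateFun_induction (fun _ (τ : Memory) => τ a = σ a) rfl fun t _ τ hτ => ?_
    rw [ih ha.2, Memory.upd_of_ne ha.1, hτ]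
  | unif => rfl
  | flip => rfl

end MemorySemantics

/-! ### Laws of loops -/

section LoopLaws

theorem bind_congr_of_support {α β : Type*} {p : PMF α} {f g : α → PMF β}
    (h : ∀ a ∈ p.support, f a = g a) : p.bind f = p.bind g := by
  ext b
  rw [PMF.bind_apply, PMF.bind_apply]
  refine tsum_congr fun a => ?_
  by_cases ha : a ∈ p.support
  · simp [h a ha]
  · simp [(PMF.apply_eq_zero_iff p a).2 ha]

/-- A law on `α`, all of whose outcomes satisfy `P`, such that the law of `f` is `q`. -/
def HasLaw {α β : Type*} (p : PMF α) (P : α → Prop) (f : α → β) (q : PMF β) : Prop :=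
  (∀ a ∈ p.support, P a) ∧ p.map f = q

/-- The next law of the observable may depend on the state only through the observable, as long as
the invariant `P` holds. Scratch memory can then be forgotten between steps. -/
theorem HasLaw.bind {α β γ δ : Type*} {p : PMF α} {P : α → Prop} {f : α → β} {q : PMF β}
    (h : HasLaw p P f q) {r : α → PMF γ} {Q : γ → Prop} {g : γ → δ} {q' : β → PMF δ}
    (hr : ∀ a, P a → HasLaw (r a) Q g (q' (f a))) : HasLaw (p.bind r) Q g (q.bind q') := by
  refine ⟨fun c hc => ?_, ?_⟩
  · obtain ⟨a, ha, hca⟩ := (PMF.mem_support_bind_iff _ _ _).1 hc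
    exact (hr a (h.1 a ha)).1 c hca
  · rw [← h.2, PMF.map_bind, PMF.bind_map]
    exact bind_congr_of_support fun a ha => (hr a (h.1 a ha)).2

/-- Round t overwrites coordinate t by an independent draw. After n rounds nothing of the initial
values is left, so the law is the full product. -/
theorem HasLaw.iterate {α β : Type*} [Fintype β] {n : ℕ} {body : ℕ → α → PMF α}
    {P : α → Prop} {f : α → Fin n → β} {q : Fin n → PMF β}
    (h : ∀ t : Fin n, ∀ a, P a → HasLaw (body t a) P f ((q t).map (Function.update (f a) t)))
    {a : α} (ha : P a) : HasLaw (iterateLaw body n a) P f (piLaw q) := by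
  have key : ∀ N ≤ n, HasLaw (iterateLaw body N a) P f
      (piLaw fun i => if (i : ℕ) < N then q i else PMF.pure (f a i)) := by
    intro N
    induction N with
    | zero =>
      intro _
      refine ⟨by simpa [iterateLaw] using ha, ?_⟩
      rw [iterateLaw, PMF.pure_map]
      ext x
      simp only [not_lt_zero, if_false, piLaw_apply, PMF.pure_apply]
      split_ifs with hx
      · simp [hx]
      · obtain ⟨i, hi⟩ := Function.ne_iff.1 hx
        exact (Finset.prod_eq_zero (Finset.mem_univ i) (by simp [hi])).symm
    | succ N ih =>
      intro hN
      have h1 := (ih (by omega)).bind (r := body N) (Q := P) (g := f)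
        (q' := fun x => (q ⟨N, hN⟩).map (Function.update x ⟨N, hN⟩))
        (fun a ha => h ⟨N, hN⟩ a ha)
      rw [iterateLaw]
      convert h1 using 1
      rw [piLaw_bind_update]
      congr 1
      funext i
      by_cases hi : i = ⟨N, hN⟩
      · subst hi; simp
      · rw [Function.update_of_ne hi]
        have : (i : ℕ) ≠ N := fun h => hi (Fin.ext h)
        have : (i : ℕ) < N + 1 ↔ (i : ℕ) < N := by omega
        simp [this]
  simpa using key n le_rfl

end LoopLaws

/-! ### Bounds on the running time -/

section Time

/-- A factor that bounds the bit length of the value of an expression relative to the bit lengths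
in memory. -/
def RExp.width : RExp → ℕ
  | lit v => Nat.size v
  | get _ _ _ => 1
  | op _ s t => s.width + t.width + 1

/-- A factor that bounds the cost of an expression relative to the bit lengths in memory. -/
def RExp.weight : RExp → ℕ
  | lit v => 1 + Nat.size v
  | get _ row col => row.weight + col.weight + row.width + col.width + 2
  | op _ s t => s.weight + t.weight + s.width + t.width + 1

/-- All cells hold numbers of at most `L` bits. -/
def Memory.Short (L : ℕ) (σ : Memory) : Prop := ∀ a r c, Nat.size (σ a r c) ≤ L

theorem AOp.size_apply_le (o : AOp) (a b : ℕ) :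
    Nat.size (o.apply a b) ≤ Nat.size a + Nat.size b + 1 := by
  have ha : a < 2 ^ Nat.size a := Nat.lt_size_self a
  have hb : b < 2 ^ Nat.size b := Nat.lt_size_self b
  cases o with
  | add =>
    rw [AOp.apply, Nat.size_le]
    have h1 : 2 ^ Nat.size a ≤ 2 ^ (Nat.size a + Nat.size b) :=
      Nat.pow_le_pow_right (by norm_num) (by omega)
    have h2 : 2 ^ Nat.size b ≤ 2 ^ (Nat.size a + Nat.size b) :=
      Nat.pow_le_pow_right (by norm_num) (by omega)
    rw [pow_succ]
    omega
  | sub =>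
    have : Nat.size (a - b) ≤ Nat.size a := Nat.size_le_size (Nat.sub_le _ _)
    rw [AOp.apply]; omega
  | mul =>
    rw [AOp.apply, Nat.size_le]
    calc a * b < 2 ^ Nat.size a * 2 ^ Nat.size b := Nat.mul_lt_mul'' ha hb
      _ ≤ _ := by
        rw [← pow_add]
        exact Nat.pow_le_pow_right (by norm_num) (by omega)
  | div =>
    have : Nat.size (a / b) ≤ Nat.size a := Nat.size_le_size (Nat.div_le_self _ _)
    rw [AOp.apply]; omega
  | mod =>
    have : Nat.size (a % b) ≤ Nat.size a := Nat.size_le_size (Nat.mod_le _ _)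
    rw [AOp.apply]; omega
  | le =>
    rw [AOp.apply]
    split_ifs <;> simp
  | eq =>
    rw [AOp.apply]
    split_ifs <;> simp

theorem RExp.size_eval_le {L : ℕ} {σ : Memory} (hσ : σ.Short L) (e : RExp) :
    Nat.size (e.eval σ) ≤ e.width * (L + 1) := by
  induction e with
  | lit v => exact Nat.le_mul_of_pos_right _ (by omega)
  | get arr row col =>
    have := hσ arr (row.eval σ) (col.eval σ)
    simp only [RExp.eval, RExp.width]
    omega
  | op o s t hs ht =>
    have := o.size_apply_le (s.eval σ) (t.eval σ)
    simp only [RExp.eval, RExp.width]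
    nlinarith

theorem RExp.cost_le {L : ℕ} {σ : Memory} (hσ : σ.Short L) (e : RExp) :
    e.cost σ ≤ e.weight * (L + 1) := by
  induction e with
  | lit v => exact Nat.le_mul_of_pos_right _ (by omega)
  | get arr row col hr hc =>
    have := hσ arr (row.eval σ) (col.eval σ)
    have := row.size_eval_le hσ
    have := col.size_eval_le hσ
    simp only [RExp.cost, RExp.weight]
    nlinarith
  | op o s t hs ht =>
    have := s.size_eval_le hσ
    have := t.size_eval_le hσ
    simp only [RExp.cost, RExp.weight]
    nlinarith

/-- Started in a memory with `P`, the program ends in a memory with `Q` after time at most `T`. -/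
def RCmd.Triple (P : Memory → Prop) (c : RCmd) (Q : Memory → Prop) (T : ℕ) : Prop :=
  ∀ (coin : PMF ℤˣ) (s : MState), P s.mem → ∀ s' ∈ (c.exec coin s).support,
    Q s'.mem ∧ s'.time ≤ s.time + T

variable {P Q R : Memory → Prop} {L : ℕ}

theorem RCmd.triple_skip (h : ∀ σ, P σ → Q σ) : RCmd.Triple P .skip Q 0 := by
  intro coin s hs s' hs'
  simp only [RCmd.exec, PMF.support_pure, Set.mem_singleton_iff] at hs'
  subst hs'
  exact ⟨h _ hs, le_rfl⟩

theorem RCmd.triple_set (hP : ∀ σ, P σ → σ.Short L) {arr : ℕ} {row col e : RExp}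
    (h : ∀ σ, P σ → Q (σ.upd arr (row.eval σ) (col.eval σ) (e.eval σ))) :
    RCmd.Triple P (.set arr row col e) Q
      ((row.weight + col.weight + e.weight + row.width + col.width + e.width + 1) * (L + 1)) := by
  intro coin s hs s' hs'
  simp only [RCmd.exec, PMF.support_pure, Set.mem_singleton_iff] at hs'
  subst hs'
  refine ⟨h _ hs, ?_⟩
  have hσ := hP _ hs
  have := row.cost_le hσ
  have := col.cost_le hσ
  have := e.cost_le hσ
  have := row.size_eval_le hσ
  have := col.size_eval_le hσ
  have := e.size_eval_le hσ
  simp only [MState.write]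
  nlinarith

theorem RCmd.Triple.seq {c d : RCmd} {T T' : ℕ} (hc : RCmd.Triple P c Q T)
    (hd : RCmd.Triple Q d R T') : RCmd.Triple P (.seq c d) R (T + T') := by
  intro coin s hs s' hs'
  obtain ⟨s₁, h₁, h₂⟩ := (PMF.mem_support_bind_iff _ _ _).1 hs'
  obtain ⟨hq, ht⟩ := hc coin s hs s₁ h₁
  obtain ⟨hr, ht'⟩ := hd coin s₁ hq s' h₂
  exact ⟨hr, by omega⟩

/-- Adding the times of both branches instead of taking their maximum keeps the bound inside a
semiring expression. -/
theorem RCmd.triple_ite (hP : ∀ σ, P σ → σ.Short L) {e : RExp} {c d : RCmd} {T T' : ℕ}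
    (hc : RCmd.Triple P c Q T) (hd : RCmd.Triple P d Q T') :
    RCmd.Triple P (.ite e c d) Q (e.weight * (L + 1) + 1 + T + T') := by
  intro coin s hs s' hs'
  have := e.cost_le (hP _ hs)
  simp only [RCmd.exec] at hs'
  split_ifs at hs'
  · obtain ⟨hq, ht⟩ := hc coin { mem := s.mem, time := s.time + e.cost s.mem + 1 } hs s' hs'
    exact ⟨hq, by simp only at ht; omega⟩
  · obtain ⟨hq, ht⟩ := hd coin { mem := s.mem, time := s.time + e.cost s.mem + 1 } hs s' hs'
    exact ⟨hq, by simp only at ht; omega⟩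

/-- The body starts after the round number has been stored. `N` only bounds the rounds for the time,
while the conclusion uses the exact number `e.eval σ`. -/
theorem RCmd.triple_loop (hP : ∀ σ, P σ → σ.Short L) {arr N T : ℕ} {e : RExp} {c : RCmd}
    (Inv : ℕ → Memory → Prop) (he : ∀ σ, P σ → e.eval σ ≤ N) (h0 : ∀ σ, P σ → Inv 0 σ)
    (hsize : ∀ t < N, Nat.size t ≤ L)
    (hc : ∀ t < N, RCmd.Triple (fun τ => ∃ σ, Inv t σ ∧ τ = σ.upd arr 0 0 t) c (Inv (t + 1)) T)
    (hQ : ∀ σ τ, P σ → Inv (e.eval σ) τ → Q τ) :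
    RCmd.Triple P (.loop arr e c) Q (e.weight * (L + 1) + 1 + N * (T + L + 1)) := by
  intro coin s hs s' hs'
  have hcost := e.cost_le (hP _ hs)
  simp only [RCmd.exec] at hs'
  have key : ∀ K ≤ N, ∀ s₀ : MState, Inv 0 s₀.mem → ∀ s₁ ∈ (iterate (fun t s' => c.exec coin
      (s'.write arr 0 0 t (1 + Nat.size t))) K s₀).support,
      Inv K s₁.mem ∧ s₁.time ≤ s₀.time + K * (T + L + 1) := by
    intro K
    induction K with
    | zero =>
      intro _ s₀ h s₁ hs₁
      simp only [iterate, PMF.support_pure, Set.mem_singleton_iff] at hs₁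
      subst hs₁
      exact ⟨h, by omega⟩
    | succ K ih =>
      intro hK s₀ h s₁ hs₁
      obtain ⟨s₂, h₂, h₁⟩ := (PMF.mem_support_bind_iff _ _ _).1 hs₁
      obtain ⟨hi, ht⟩ := ih (by omega) s₀ h s₂ h₂
      obtain ⟨hi', ht'⟩ := hc K (by omega) coin _ ⟨s₂.mem, hi, rfl⟩ s₁ h₁
      refine ⟨hi', ?_⟩
      have := hsize K (by omega)
      simp only [MState.write] at ht'
      rw [Nat.succ_mul]
      omega
  obtain ⟨hi, ht⟩ := key _ (he _ hs)
    { mem := s.mem, time := s.time + e.cost s.mem + 1 } (h0 _ hs) s' hs'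
  refine ⟨hQ _ _ hs hi, ?_⟩
  simp only at ht
  have := Nat.mul_le_mul_right (T + L + 1) (he _ hs)
  omega

/-- The weak inequality also covers `N = 0`, where the outcome is 0. -/
theorem mem_support_uniformBelow {N v : ℕ} (h : v ∈ (uniformBelow N).support) : v ≤ N := by
  cases N with
  | zero => simpa [uniformBelow] using h
  | succ N =>
    simp only [uniformBelow, PMF.support_map, PMF.support_uniformOfFintype, Set.top_eq_univ,
      Set.image_univ, Set.mem_range] at h
    obtain ⟨a, rfl⟩ := h
    omega

theorem RCmd.triple_unif (hP : ∀ σ, P σ → σ.Short L) {arr : ℕ} {row col e : RExp}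
    (h : ∀ σ, P σ → ∀ v ≤ e.eval σ, Q (σ.upd arr (row.eval σ) (col.eval σ) v)) :
    RCmd.Triple P (.unif arr row col e) Q
      ((row.weight + col.weight + e.weight + row.width + col.width + e.width + 1) * (L + 1)) := by
  intro coin s hs s' hs'
  simp only [RCmd.exec, PMF.support_map, Set.mem_image] at hs'
  obtain ⟨v, hv, rfl⟩ := hs'
  refine ⟨h _ hs v (mem_support_uniformBelow hv), ?_⟩
  have hσ := hP _ hs
  have := row.cost_le hσ
  have := col.cost_le hσ
  have := e.cost_le hσ
  have := row.size_eval_le hσ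
  have := col.size_eval_le hσ
  have := e.size_eval_le hσ
  simp only [MState.write]
  nlinarith

theorem RCmd.triple_flip (hP : ∀ σ, P σ → σ.Short L) {arr : ℕ} {row col : RExp}
    (h : ∀ σ, P σ → ∀ v ≤ 1, Q (σ.upd arr (row.eval σ) (col.eval σ) v)) :
    RCmd.Triple P (.flip arr row col) Q
      ((row.weight + col.weight + row.width + col.width + 1) * (L + 1)) := by
  intro coin s hs s' hs'
  simp only [RCmd.exec, PMF.support_map, Set.mem_image] at hs'
  obtain ⟨b, hb, rfl⟩ := hs'
  refine ⟨h _ hs _ (by split_ifs <;> simp), ?_⟩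
  have hσ := hP _ hs
  have := row.cost_le hσ
  have := col.cost_le hσ
  have := row.size_eval_le hσ
  have := col.size_eval_le hσ
  simp only [MState.write]
  nlinarith

/-- Every single step of the program preserves the invariant, and loops have at most `R` rounds. -/
def RCmd.Preserves (Inv : Memory → Prop) (R : ℕ) : RCmd → Prop
  | skip => True
  | set arr row col e =>
      ∀ σ, Inv σ → Inv (σ.upd arr (row.eval σ) (col.eval σ) (e.eval σ))
  | seq c d => c.Preserves Inv R ∧ d.Preserves Inv R
  | ite _ c d => c.Preserves Inv R ∧ d.Preserves Inv R
  | loop arr e c => (∀ σ, Inv σ → e.eval σ ≤ R) ∧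
      (∀ σ, Inv σ → ∀ t < R, Inv (σ.upd arr 0 0 t)) ∧ c.Preserves Inv R
  | unif arr row col e =>
      ∀ σ, Inv σ → ∀ v ≤ e.eval σ, Inv (σ.upd arr (row.eval σ) (col.eval σ) v)
  | flip arr row col => ∀ σ, Inv σ → ∀ v ≤ 1, Inv (σ.upd arr (row.eval σ) (col.eval σ) v)

/-- A bound on the running time if all numbers have at most `L` bits and all loops have at most
`R` rounds. -/
def RCmd.timeBound {A : Type*} [CommSemiring A] (L R : A) : RCmd → A
  | skip => 0
  | set _ row col e => ((row.weight + col.weight + e.weight + row.width + col.width + e.width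
      + 1 : ℕ) : A) * (L + 1)
  | seq c d => c.timeBound L R + d.timeBound L R
  | ite e c d => (e.weight : A) * (L + 1) + 1 + c.timeBound L R + d.timeBound L R
  | loop _ e c => (e.weight : A) * (L + 1) + 1 + R * (c.timeBound L R + L + 1)
  | unif _ row col e => ((row.weight + col.weight + e.weight + row.width + col.width + e.width
      + 1 : ℕ) : A) * (L + 1)
  | flip _ row col => ((row.weight + col.weight + row.width + col.width + 1 : ℕ) : A) * (L + 1)

/-- This is why the bound lives in an arbitrary semiring: computed over polynomials, it is a
polynomial whose values are the numerical bounds. -/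
theorem RCmd.eval_timeBound (L R : Polynomial ℕ) (c : RCmd) (x : ℕ) :
    (c.timeBound L R).eval x = c.timeBound (L.eval x) (R.eval x) := by
  induction c with
  | skip => simp [RCmd.timeBound]
  | set => simp only [RCmd.timeBound, Polynomial.eval_mul, Polynomial.eval_natCast,
      Polynomial.eval_add, Polynomial.eval_one]
  | seq c d hc hd => simp only [RCmd.timeBound, Polynomial.eval_add, hc, hd]
  | ite e c d hc hd => simp only [RCmd.timeBound, Polynomial.eval_add, Polynomial.eval_mul,
      Polynomial.eval_natCast, Polynomial.eval_one, hc, hd]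
  | loop arr e c hc => simp only [RCmd.timeBound, Polynomial.eval_add, Polynomial.eval_mul,
      Polynomial.eval_natCast, Polynomial.eval_one, hc]
  | unif => simp only [RCmd.timeBound, Polynomial.eval_mul, Polynomial.eval_natCast,
      Polynomial.eval_add, Polynomial.eval_one]
  | flip => simp only [RCmd.timeBound, Polynomial.eval_mul, Polynomial.eval_natCast,
      Polynomial.eval_add, Polynomial.eval_one]

/-- For a single invariant throughout, the time bound follows from the syntax alone. -/
theorem RCmd.Preserves.triple {Inv : Memory → Prop} {R : ℕ} (hInv : ∀ σ, Inv σ → σ.Short L)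
    (hR : ∀ t < R, Nat.size t ≤ L) {c : RCmd} (h : c.Preserves Inv R) :
    RCmd.Triple Inv c Inv (c.timeBound L R) := by
  induction c with
  | skip => exact RCmd.triple_skip fun _ h => h
  | set => exact RCmd.triple_set hInv h
  | seq c d hc hd => exact (hc h.1).seq (hd h.2)
  | ite e c d hc hd => exact RCmd.triple_ite hInv (hc h.1) (hd h.2)
  | loop arr e c hc =>
    refine RCmd.triple_loop hInv (fun _ => Inv) h.1 (fun _ h => h) hR (fun t ht => ?_)
      (fun _ _ _ h => h)
    rintro coin s ⟨σ, hσ, hs⟩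
    exact hc h.2.2 coin s (hs ▸ h.2.1 σ hσ t ht)
  | unif => exact RCmd.triple_unif hInv h
  | flip => exact RCmd.triple_flip hInv h

end Time

/-! ### Columns of truth tables -/

section Columns

variable {a : ℕ}

/-- The column of a truth table in which the value at the argument `b` is stored. -/
def colOf (b : Fin a → ℤˣ) : ℕ := Nat.ofBits fun i => decide (b i = 1)

theorem ofBits_eq_sum (f : Fin a → Bool) :
    Nat.ofBits f = ∑ i : Fin a, (if f i = true then 2 ^ (i : ℕ) else 0) := by
  induction a with
  | zero => simp
  | succ a ih =>
    rw [Nat.ofBits_succ, ih, Fin.sum_univ_succ, Finset.mul_sum, add_comm]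
    congr 1
    · cases f 0 <;> simp
    · refine Finset.sum_congr rfl fun i _ => ?_
      simp only [Function.comp_apply, Fin.val_succ, pow_succ]
      split_ifs <;> ring

theorem colOf_eq_sum (b : Fin a → ℤˣ) :
    colOf b = ∑ i : Fin a, (if b i = 1 then 1 else 0) * 2 ^ (i : ℕ) := by
  simp [colOf, ofBits_eq_sum]

theorem colOf_lt (b : Fin a → ℤˣ) : colOf b < 2 ^ a := Nat.ofBits_lt_two_pow _

theorem testBit_colOf (b : Fin a → ℤˣ) (i : Fin a) : (colOf b).testBit i = decide (b i = 1) := by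
  rw [colOf, Nat.testBit_ofBits_lt _ _ i.2]

theorem colOf_div_mod (b : Fin a → ℤˣ) (p : Fin a) :
    colOf b / 2 ^ (p : ℕ) % 2 = if b p = 1 then 1 else 0 := by
  have h := testBit_colOf b p
  rw [Nat.testBit_eq_decide_div_mod_eq, decide_eq_decide] at h
  split_ifs with hb
  · exact h.2 hb
  · have := mt h.1 hb
    omega

theorem colOf_update_one (b : Fin a → ℤˣ) (p : Fin a) :
    colOf (Function.update b p 1) = colOf (Function.update b p (-1)) + 2 ^ (p : ℕ) := by
  rw [colOf_eq_sum, colOf_eq_sum, ← Finset.add_sum_erase _ _ (Finset.mem_univ p),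
    ← Finset.add_sum_erase (a := p) _ _ (Finset.mem_univ p), Function.update_self,
    Function.update_self, if_pos rfl, if_neg (by decide), one_mul, zero_mul, zero_add, add_comm]
  congr 1
  refine Finset.sum_congr rfl fun i hi => ?_
  rw [Function.update_of_ne (Finset.ne_of_mem_erase hi),
    Function.update_of_ne (Finset.ne_of_mem_erase hi)]

/-- This is the computation done by `Sampler.cleared`: subtracting the bit at `p` times its weight
sets the argument to -1. -/
theorem colOf_sub (b : Fin a → ℤˣ) (p : Fin a) :
    colOf b - colOf b / 2 ^ (p : ℕ) % 2 * 2 ^ (p : ℕ) = colOf (Function.update b p (-1)) := by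
  rw [colOf_div_mod]
  have h := colOf_update_one b p
  have hb : b = Function.update b p (b p) := (Function.update_eq_self p b).symm
  split_ifs with h1
  · rw [h1] at hb
    rw [← hb] at h
    omega
  · rw [(Int.units_eq_one_or (b p)).resolve_left h1] at hb
    rw [← hb]
    omega

theorem colOf_injective : Function.Injective (colOf (a := a)) := by
  intro b b' h
  funext i
  have h1 := testBit_colOf b i
  rw [h, testBit_colOf, decide_eq_decide] at h1
  rcases Int.units_eq_one_or (b i) with h2 | h2 <;>
    rcases Int.units_eq_one_or (b' i) with h3 | h3 <;> simp_all

theorem sum_colOf {R : Type*} [AddCommMonoid R] (h : ℕ → R) :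
    ∑ b : Fin a → ℤˣ, h (colOf b) = ∑ col ∈ Finset.range (2 ^ a), h col := by
  have himg : (Finset.univ : Finset (Fin a → ℤˣ)).image colOf = Finset.range (2 ^ a) := by
    apply Finset.eq_of_subset_of_card_le
    · intro c hc
      obtain ⟨b, -, rfl⟩ := Finset.mem_image.1 hc
      exact Finset.mem_range.2 (colOf_lt b)
    · rw [Finset.card_image_of_injective _ colOf_injective]
      simp
  rw [← himg, Finset.sum_image fun _ _ _ _ h => colOf_injective h]

theorem inputMemory_table {n k : ℕ} (Φ : Instance n k) (l : Fin Φ.m)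
    (b : Fin (Φ.con l).arity → ℤˣ) :
    inputMemory Φ 4 l (colOf b) = if (Φ.con l).pred b = true then 1 else 0 := by
  have hb : (fun i : Fin (Φ.con l).arity => if (colOf b).testBit i = true then (1 : ℤˣ) else -1)
      = b := by
    funext i
    rw [testBit_colOf]
    rcases Int.units_eq_one_or (b i) with h | h <;> simp [h]
  have := colOf_lt b
  simp [inputMemory, hb, this]

end Columns

/-! ### Counting by the digits of one large number -/

section Digits

variable {Ω : Type*} [Fintype Ω] {B : ℕ}

/-- The terms with exponent below `s` are fewer than `B`, each at most B^(s-1), so together they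
stay below B^s and vanish in the quotient. -/
theorem sum_pow_div_pow (hB : Fintype.card Ω < B) (f : Ω → ℕ) (s : ℕ) :
    (∑ ω, B ^ f ω) / B ^ s = ∑ ω with s ≤ f ω, B ^ (f ω - s) := by
  have hB0 : 0 < B := by omega
  rw [← Finset.sum_filter_add_sum_filter_not Finset.univ (fun ω => s ≤ f ω)]
  have h1 : ∑ ω with s ≤ f ω, B ^ f ω = B ^ s * ∑ ω with s ≤ f ω, B ^ (f ω - s) := by
    rw [Finset.mul_sum]
    refine Finset.sum_congr rfl fun ω hω => ?_
    rw [← pow_add, Nat.add_sub_cancel' (Finset.mem_filter.1 hω).2]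
  have h2 : ∑ ω with ¬ s ≤ f ω, B ^ f ω < B ^ s := by
    cases s with
    | zero => simp
    | succ s =>
      calc ∑ ω with ¬ s + 1 ≤ f ω, B ^ f ω ≤ ∑ ω with ¬ s + 1 ≤ f ω, B ^ s := by
            refine Finset.sum_le_sum fun ω hω => Nat.pow_le_pow_right hB0 ?_
            have := (Finset.mem_filter.1 hω).2
            omega
        _ ≤ Fintype.card Ω * B ^ s := by
            rw [Finset.sum_const, smul_eq_mul]
            exact Nat.mul_le_mul_right _ (Finset.card_le_univ _)
        _ < B ^ (s + 1) := by
            rw [pow_succ, mul_comm]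
            exact Nat.mul_lt_mul_of_pos_left hB (by positivity)
  rw [h1, Nat.mul_add_div (by positivity), Nat.div_eq_of_lt h2, add_zero]

/-- There are fewer than `B` terms, hence no carries. -/
theorem sum_pow_digit (hB : Fintype.card Ω < B) (f : Ω → ℕ) (s : ℕ) :
    (∑ ω, B ^ f ω) / B ^ s % B = (Finset.univ.filter fun ω => f ω = s).card := by
  rw [sum_pow_div_pow hB]
  have h1 : ∑ ω with s ≤ f ω, B ^ (f ω - s)
      = (Finset.univ.filter fun ω => f ω = s).card
        + B * ∑ ω with s < f ω, B ^ (f ω - s - 1) := by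
    rw [Finset.mul_sum, Finset.card_eq_sum_ones, Finset.sum_filter, Finset.sum_filter,
      Finset.sum_filter, ← Finset.sum_add_distrib]
    refine Finset.sum_congr rfl fun ω _ => ?_
    rcases lt_trichotomy (f ω) s with h | h | h
    · simp [h.not_ge, h.ne, h.le.not_gt]
    · simp [h]
    · rw [if_pos h.le, if_neg h.ne', if_pos h, ← pow_succ', zero_add]
      congr 1
      omega
  rw [h1, Nat.add_mul_mod_self_left, Nat.mod_eq_of_lt]
  exact lt_of_le_of_lt (Finset.card_le_univ _) hB

/-- Casting out B - 1: since B ≡ 1, the quotient is congruent to its number of terms, and that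
number is below B - 1. -/
theorem sum_pow_upper_digits (hB : Fintype.card Ω + 1 < B) (f : Ω → ℕ) (s : ℕ) :
    (∑ ω, B ^ f ω) / (B ^ s * B) % (B - 1) = (Finset.univ.filter fun ω => s < f ω).card := by
  rw [← pow_succ, sum_pow_div_pow (by omega)]
  have h1 : ∑ ω with s + 1 ≤ f ω, B ^ (f ω - (s + 1))
      ≡ ∑ ω with s + 1 ≤ f ω, 1 [MOD (B - 1)] := by
    have hB1 : B ≡ 1 [MOD (B - 1)] := by
      have : B = 1 + (B - 1) := by omega
      conv_lhs => rw [this]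
      simp [Nat.ModEq]
    refine Nat.ModEq.sum fun ω _ => ?_
    simpa using hB1.pow (f ω - (s + 1))
  rw [← Finset.card_eq_sum_ones] at h1
  rw [h1, Nat.mod_eq_of_lt]
  · rfl
  · have := Finset.card_le_univ (Finset.univ.filter fun ω => s + 1 ≤ f ω)
    omega

end Digits

/-! ### The sign of the difference to the median by a random rank -/

section Rank

variable {Ω : Type*} [Fintype Ω] [Nonempty Ω]

theorem prob_eq_card_div (E : Ω → Prop) [DecidablePred E] :
    prob E = ((Finset.univ.filter E).card : ℝ) / (Fintype.card Ω : ℝ) := by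
  unfold prob
  congr!

theorem card_filter_lt_add (g : Ω → ℝ) (v : ℝ) :
    (Finset.univ.filter fun ω => v < g ω).card + (Finset.univ.filter fun ω => g ω ≤ v).card
      = Fintype.card Ω := by
  have := Finset.card_filter_add_card_filter_not (s := (Finset.univ : Finset Ω)) (fun ω => v < g ω)
  simpa [not_lt] using this

theorem card_le_two_mul_card_filter_le_median (g : Ω → ℝ) :
    Fintype.card Ω ≤ 2 * (Finset.univ.filter fun ω => g ω ≤ median g).card := by
  have h := (median_mem g).2
  have hc : (0 : ℝ) < Fintype.card Ω := by exact_mod_cast Fintype.card_pos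
  rw [prob_eq_card_div, le_div_iff₀ hc] at h
  have : (Fintype.card Ω : ℝ) ≤ 2 * ((Finset.univ.filter fun ω => g ω ≤ median g).card : ℝ) := by
    linarith
  exact_mod_cast this

theorem card_filter_lt_add_card_filter_eq (g : Ω → ℝ) (v : ℝ) :
    (Finset.univ.filter fun ω => v < g ω).card + (Finset.univ.filter fun ω => g ω = v).card
      = (Finset.univ.filter fun ω => v ≤ g ω).card := by
  classical
  rw [← Finset.card_union_of_disjoint]
  · congr 1
    ext ω
    simp [le_iff_lt_or_eq, eq_comm]
  · rw [Finset.disjoint_filter]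
    intro ω _ h
    exact h.ne'

theorem card_le_two_mul_card_filter_median_le (g : Ω → ℝ) :
    Fintype.card Ω ≤ 2 * (Finset.univ.filter fun ω => median g ≤ g ω).card := by
  have h := tieProb_le_one g
  have hc : (0 : ℝ) < Fintype.card Ω := by exact_mod_cast Fintype.card_pos
  rw [tieProb, div_le_one (prob_eq_median_pos g), sub_le_iff_le_add, prob_eq_card_div,
    prob_eq_card_div, ← add_div, le_div_iff₀ hc] at h
  have h2 := card_filter_lt_add_card_filter_eq g (median g)
  have : (Fintype.card Ω : ℝ) ≤ 2 * ((Finset.univ.filter fun ω => median g ≤ g ω).card : ℝ) := by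
    rw [← h2]
    push_cast
    linarith
  exact_mod_cast this

theorem bias_map_uniformBelow {E : ℕ} (hE : 0 < E) (T : ℕ) :
    bias ((uniformBelow E).map fun u => if u < T then (1 : ℤˣ) else -1)
      = 2 * ((min T E : ℕ) : ℝ) / E - 1 := by
  obtain ⟨E, rfl⟩ := Nat.exists_eq_succ_of_ne_zero hE.ne'
  rw [uniformBelow, PMF.map_comp, bias, expect_map, expect_uniform]
  have h1 : ∀ u : Fin (E + 1), (((((fun u : ℕ => if u < T then (1 : ℤˣ) else -1) ∘ Fin.val) u : ℤˣ)
      : ℤ) : ℝ) = 2 * (if (u : ℕ) < T then 1 else 0) - 1 := by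
    intro u
    simp only [Function.comp_apply]
    split_ifs <;> norm_num
  simp only [h1]
  rw [avg_sub, avg_const_mul, avg_const, avg, Finset.sum_boole, Fintype.card_fin]
  have h2 : (Finset.univ.filter fun u : Fin (E + 1) => (u : ℕ) < T).card = min T (E + 1) := by
    rw [Fin.card_filter_val_lt, min_comm]
  rw [h2, mul_div_assoc]

/-- List the points by decreasing value, ties in random order; the sign is positive in the first
half. Above the median all tied ranks lie in this half, below it none. An even cardinality makes the
half exact. -/
theorem map_uniformBelow_eq_medianSign (hΩ : Even (Fintype.card Ω)) (g : Ω → ℝ) (ω : Ω) :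
    ((uniformBelow (Finset.univ.filter fun ω' => g ω' = g ω).card).map fun u =>
      if 2 * ((Finset.univ.filter fun ω' => g ω < g ω').card + u) < Fintype.card Ω
        then (1 : ℤˣ) else -1) = medianSign g ω := by
  obtain ⟨h, hh⟩ := hΩ
  set A := (Finset.univ.filter fun ω' => g ω < g ω').card with hA
  set E := (Finset.univ.filter fun ω' => g ω' = g ω).card with hE
  have hE0 : 0 < E := Finset.card_pos.2 ⟨ω, by simp⟩
  have hcond : (fun u => if 2 * (A + u) < Fintype.card Ω then (1 : ℤˣ) else -1)
      = fun u => if u < h - A then (1 : ℤˣ) else -1 := by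
    funext u
    have : 2 * (A + u) < Fintype.card Ω ↔ u < h - A := by omega
    simp [this]
  have hAE : A + E = (Finset.univ.filter fun ω' => g ω ≤ g ω').card :=
    card_filter_lt_add_card_filter_eq g (g ω)
  have hE' : (E : ℝ) ≠ 0 := by exact_mod_cast hE0.ne'
  have hc : (0 : ℝ) < Fintype.card Ω := by exact_mod_cast Fintype.card_pos
  have h1 := card_le_two_mul_card_filter_le_median g
  have h2 := card_le_two_mul_card_filter_median_le g
  have h3 := card_filter_lt_add g (median g)
  rw [hcond]
  apply ext_of_bias
  rw [bias_map_uniformBelow hE0, medianSign]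
  split_ifs with hlt hgt
  · have h4 : (Finset.univ.filter fun ω' => g ω ≤ g ω').card
        ≤ (Finset.univ.filter fun ω' => median g < g ω').card :=
      Finset.card_le_card (Finset.monotone_filter_right _ fun ω' _ h => lt_of_lt_of_le hlt h)
    have h5 : min (h - A) E = E := by omega
    rw [h5, bias_pure, mul_div_assoc, div_self hE']
    norm_num
  · have h4 : (Finset.univ.filter fun ω' => median g ≤ g ω').card ≤ A :=
      Finset.card_le_card (Finset.monotone_filter_right _ fun ω' _ h => lt_of_lt_of_le hgt h)
    have h5 : min (h - A) E = 0 := by omega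
    rw [h5, bias_pure]
    norm_num
  -- At the median, the first half of size `h` takes `h - A` of the `E` ties, and (h - A)/E is
  -- `tieProb`.
  · have heq : g ω = median g := le_antisymm (not_lt.1 hlt) (not_lt.1 hgt)
    have h5 : min (h - A) E = h - A := by
      rw [heq] at hAE
      omega
    have h6 : A ≤ h := by
      rw [heq] at hA
      omega
    rw [h5, bias_signLaw, tieProb, prob_eq_card_div, prob_eq_card_div, ← heq, ← hA, ← hE,
      div_sub_div _ _ two_ne_zero hc.ne', div_div_div_eq, Nat.cast_sub h6]
    have : (Fintype.card Ω : ℝ) = h + h := by exact_mod_cast hh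
    rw [this] at hc ⊢
    have hh0 : (h : ℝ) ≠ 0 := by linarith
    field_simp
    ring

end Rank

/-! ### The program -/

namespace Sampler

/-- The scalar variable with number `a`. -/
def cell (a : ℕ) : RExp := .get a (.lit 0) (.lit 0)

/-- Assignment to a scalar variable. -/
def setCell (a : ℕ) (e : RExp) : RCmd := .set a (.lit 0) (.lit 0) e

/-- Assignment to a scalar variable, reduced by the modulus in cell `9`, which bounds the numbers
that can occur. -/
def setMod (a : ℕ) (e : RExp) : RCmd := setCell a (.op .mod e (cell 9))

/-- The variable at position `13` of constraint number `12`. -/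
def scopeVar : RExp := .get 3 (cell 12) (cell 13)

/-- One step of `scan`. -/
def scanStep : RCmd :=
  .seq (setMod 18 (.op .add (cell 18) (.get 6 scopeVar (.lit 0))))
    (.seq (setMod 16 (.op .add (cell 16) (.op .mul (.op .eq scopeVar (cell 11)) (cell 15))))
      (.seq (setMod 17 (.op .add (cell 17) (.op .mul (.get 7 scopeVar (.lit 0)) (cell 15))))
        (setMod 15 (.op .mul (.lit 2) (cell 15)))))

/-- Read the scope of constraint number `12`: cell `15` becomes the size of its truth table, cell
`16` the weight of the variable `11` in a column number (or `0`), cell `17` the column that belongs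
to the assignment in array `7`, and cell `18` the number of its variables in `G`. -/
def scan : RCmd :=
  .seq (setCell 15 (.lit 1)) (.seq (setCell 16 (.lit 0)) (.seq (setCell 17 (.lit 0))
    (.seq (setCell 18 (.lit 0)) (.loop 13 (.get 2 (cell 12) (.lit 0)) scanStep))))

/-- The column number with the bit of variable `11` cleared. -/
def cleared (col : RExp) : RExp :=
  .op .sub col (.op .mul (.op .mod (.op .div col (cell 16)) (.lit 2)) (cell 16))

/-- `B` to the power `1 + 2 Q`, where `Q` is the derivative of constraint `12` at column `col`. -/
def factor (col : RExp) : RExp :=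
  .op .mul
    (.op .add (.lit 1) (.op .mul (.get 4 (cell 12) (.op .add (cleared col) (cell 16)))
      (.op .sub (cell 8) (.lit 1))))
    (.op .add (.lit 1) (.op .mul (.op .sub (.lit 1) (.get 4 (cell 12) (cleared col)))
      (.op .sub (cell 8) (.lit 1))))

/-- Sum of the factors of all columns, in cell `19`. -/
def total (k : ℕ) : RCmd :=
  .seq (setCell 19 (.lit 0)) (.loop 14 (.lit (2 ^ k)) (setMod 19 (.op .add (cell 19)
    (.op .mul (.op .le (.op .add (cell 14) (.lit 1)) (cell 15)) (factor (cell 14))))))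

/-- Is constraint number `12` an active constraint of variable `11`? -/
def active : RExp := .op .mul (.op .eq (cell 18) (.lit 1)) (.op .le (.lit 1) (cell 16))

/-- Take an active constraint into account. -/
def updateLevels (k : ℕ) : RCmd :=
  .seq (total k) (.seq (setMod 20 (.op .div (.op .mul (cell 20) (cell 19)) (cell 15)))
    (setMod 21 (.op .mul (cell 21) (factor (cell 17)))))

/-- Take a constraint into account. -/
def constraintStep (k : ℕ) : RCmd := .seq scan (.ite active (updateLevels k) .skip)

/-- Compute in cell `20` the number whose `s`-th digit in base `B` counts the assignments at
level `s`, and in cell `21` the power `B ^ s` for the level `s` of the assignment in array `7`. -/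
def prepare (k : ℕ) : RCmd :=
  .seq (setMod 20 (.op .div (cell 8) (.lit 4))) (.seq (setCell 21 (.lit 1))
    (.loop 12 (cell 1) (constraintStep k)))

/-- The number of assignments at higher levels. -/
def upper : RExp :=
  .op .mod (.op .div (cell 20) (.op .mul (cell 21) (cell 8))) (.op .sub (cell 8) (.lit 1))

/-- Write the value of variable `11`. -/
def conclude : RCmd :=
  .set 5 (cell 11) (.lit 0) (.op .eq (.op .le (.op .add (.op .mul (.lit 8)
    (.op .add upper (cell 22))) (.lit 1)) (cell 8)) (cell 23))

/-- Draw the value of a variable of `G`. -/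
def draw (k : ℕ) : RCmd :=
  .seq (prepare k) (.seq (.unif 22 (.lit 0) (.lit 0) (.op .mod (.op .div (cell 20) (cell 21))
    (cell 8))) (.seq (.flip 23 (.lit 0) (.lit 0)) conclude))

/-- Fix the value of variable `11`. -/
def variableStep (k : ℕ) : RCmd :=
  .ite (.get 6 (cell 11) (.lit 0)) (draw k)
    (.set 5 (cell 11) (.lit 0) (.get 7 (cell 11) (.lit 0)))

/-- Compute the base `B` in cell `8` and the modulus in cell `9`. -/
def constants (k : ℕ) : RCmd :=
  .seq (setCell 8 (.lit 4)) (.seq (.loop 10 (cell 0) (setCell 8 (.op .mul (cell 8) (.lit 2))))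
    (.seq (setCell 9 (.op .mul (.lit (2 ^ (k + 1))) (.op .mul (cell 8) (cell 8))))
      (.loop 10 (cell 1) (setCell 9 (.op .mul (cell 9) (.op .mul (cell 8) (cell 8)))))))

/-- Fill an array with random bits. -/
def sampleBits (arr : ℕ) : RCmd := .loop 10 (cell 0) (.unif arr (cell 10) (.lit 0) (.lit 2))

/-- The steps that follow the computation of the constants: array `6` is the partition and array
`7` the assignment of `F`. -/
def sample (k : ℕ) : RCmd :=
  .seq (sampleBits 6) (.seq (sampleBits 7) (.loop 11 (cell 0) (variableStep k)))

/-- The program. -/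
def program (k : ℕ) : RCmd := .seq (constants k) (sample k)

end Sampler

/-! ### Correctness of the deterministic parts -/

namespace Sampler

variable {n k : ℕ}

/-- The base of the number system. -/
def base (n : ℕ) : ℕ := 2 ^ (n + 2)

/-- The modulus. -/
def modulus (n k m : ℕ) : ℕ := 2 ^ (k + 1) * base n ^ (2 * m + 2)

theorem base_pos : 0 < base n := by unfold base; positivity

theorem four_le_base : 4 ≤ base n := by
  rw [base, pow_add]
  have := Nat.one_le_two_pow (n := n)
  omega

theorem lt_modulus {x m : ℕ} (h : x < 2 ^ (k + 1)) : x < modulus n k m :=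
  lt_of_lt_of_le h (Nat.le_mul_of_pos_right _ (pow_pos base_pos _))

/-- The memory holds the instance, the constants, the partition and the assignment. -/
structure Ctx (Φ : Instance n k) (G : Finset (Fin n)) (y : Assignment n) (σ : Memory) : Prop where
  input : ∀ a < 5, σ a = inputMemory Φ a
  base_eq : σ 8 0 0 = base n
  modulus_eq : σ 9 0 0 = modulus n k Φ.m
  part : ∀ i : Fin n, σ 6 i 0 = if i ∈ G then 1 else 0
  assign : ∀ i : Fin n, σ 7 i 0 = if y i = 1 then 1 else 0

variable {Φ : Instance n k} {G : Finset (Fin n)} {y : Assignment n}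

/-- Array 5 is excepted because it receives the output; arrays from 10 on are scratch. -/
theorem Ctx.congr {σ τ : Memory} (h : Ctx Φ G y σ) (hτ : ∀ a < 10, a ≠ 5 → τ a = σ a) :
    Ctx Φ G y τ where
  input a ha := by rw [hτ a (by omega) (by omega), h.input a ha]
  base_eq := by rw [hτ 8 (by omega) (by omega), h.base_eq]
  modulus_eq := by rw [hτ 9 (by omega) (by omega), h.modulus_eq]
  part i := by rw [hτ 6 (by omega) (by omega), h.part]
  assign i := by rw [hτ 7 (by omega) (by omega), h.assign]

theorem Ctx.run {σ : Memory} (h : Ctx Φ G y σ) (c : RCmd) (hc : ∀ a < 10, a ≠ 5 → a ∉ c.writes) :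
    Ctx Φ G y (c.run σ) :=
  h.congr fun a ha h5 => c.run_of_notMem (hc a ha h5) σ

theorem Ctx.upd {σ : Memory} (h : Ctx Φ G y σ) {a : ℕ} (ha : a = 5 ∨ 10 ≤ a) (r c v : ℕ) :
    Ctx Φ G y (σ.upd a r c v) :=
  h.congr fun b hb h5 => Memory.upd_of_ne (by omega) _ _ _

theorem Ctx.scope {σ : Memory} (h : Ctx Φ G y σ) (l : Fin Φ.m) (i : Fin (Φ.con l).arity) :
    σ 3 l i = (Φ.con l).scope i := by
  rw [h.input 3 (by omega)]
  simp [inputMemory]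

theorem Ctx.arity {σ : Memory} (h : Ctx Φ G y σ) (l : Fin Φ.m) :
    σ 2 l 0 = (Φ.con l).arity := by
  rw [h.input 2 (by omega)]
  simp [inputMemory]

theorem Ctx.table {σ : Memory} (h : Ctx Φ G y σ) (l : Fin Φ.m)
    (b : Fin (Φ.con l).arity → ℤˣ) :
    σ 4 l (colOf b) = if (Φ.con l).pred b = true then 1 else 0 := by
  rw [h.input 4 (by omega), inputMemory_table]

theorem sum_bits_lt {t : ℕ} {b : ℕ → ℕ} (hb : ∀ i, b i ≤ 1) :
    ∑ i ∈ Finset.range t, b i * 2 ^ i < 2 ^ t := by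
  induction t with
  | zero => simp
  | succ t ih =>
    rw [Finset.sum_range_succ, pow_succ]
    have := Nat.mul_le_mul_right (2 ^ t) (hb t)
    omega

/-- After t rounds the cells hold partial binary sums over the first t positions. These stay below
2^(k+1), so the modular reductions do nothing. -/
theorem run_scan {σ : Memory} (h : Ctx Φ G y σ) {j : Fin n} {l : Fin Φ.m} (hj : σ 11 0 0 = j)
    (hl : σ 12 0 0 = l) :
    scan.run σ 15 0 0 = 2 ^ (Φ.con l).arity ∧
    scan.run σ 16 0 0 = ∑ i, (if (Φ.con l).scope i = j then 1 else 0) * 2 ^ (i : ℕ) ∧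
    scan.run σ 17 0 0 = colOf (fun i => y ((Φ.con l).scope i)) ∧
    scan.run σ 18 0 0 = ((Φ.con l).vars ∩ G).card := by
  set c := Φ.con l with hc
  -- The three accumulated sums are treated together: `p P i` is the bit telling whether the
  -- variable at position `i` satisfies `P`.
  let p : (Fin n → Prop) → ℕ → ℕ := fun P i =>
    open Classical in if h : i < c.arity then (if P (c.scope ⟨i, h⟩) then 1 else 0) else 0
  have hp1 : ∀ P i, p P i ≤ 1 := by
    intro P i
    simp only [p]
    split_ifs <;> simp
  have hpsum : ∀ (P : Fin n → Prop) [DecidablePred P], ∀ f : ℕ → ℕ,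
      ∑ i ∈ Finset.range c.arity, p P i * f i
        = ∑ i : Fin c.arity, (if P (c.scope i) then 1 else 0) * f i := by
    intro P _ f
    rw [Finset.sum_range]
    refine Finset.sum_congr rfl fun i _ => ?_
    simp only [p, i.2, dif_pos, Fin.eta]
    congr
  have key : ∀ τ : Memory, Ctx Φ G y τ → τ 11 0 0 = j → τ 12 0 0 = l → τ 15 0 0 = 1 →
      τ 16 0 0 = 0 → τ 17 0 0 = 0 → τ 18 0 0 = 0 →
      let ρ := iterateFun (fun t τ => scanStep.run (τ.upd 13 0 0 t)) c.arity τ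
      ρ 15 0 0 = 2 ^ c.arity ∧
      ρ 16 0 0 = ∑ i ∈ Finset.range c.arity, p (· = j) i * 2 ^ i ∧
      ρ 17 0 0 = ∑ i ∈ Finset.range c.arity, p (y · = 1) i * 2 ^ i ∧
      ρ 18 0 0 = ∑ i ∈ Finset.range c.arity, p (· ∈ G) i := by
    intro τ hτ h11 h12 h15 h16 h17 h18
    have := iterateFun_induction (body := fun t τ => scanStep.run (τ.upd 13 0 0 t)) (s := τ)
      (N := c.arity) (fun t ρ => Ctx Φ G y ρ ∧ ρ 11 0 0 = j ∧ ρ 12 0 0 = l ∧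
        ρ 15 0 0 = 2 ^ t ∧
        ρ 16 0 0 = ∑ i ∈ Finset.range t, p (· = j) i * 2 ^ i ∧
        ρ 17 0 0 = ∑ i ∈ Finset.range t, p (y · = 1) i * 2 ^ i ∧
        ρ 18 0 0 = ∑ i ∈ Finset.range t, p (· ∈ G) i)
      ⟨hτ, h11, h12, by simpa using h15, by simpa using h16, by simpa using h17,
        by simpa using h18⟩ ?_
    · exact this.2.2.2
    · rintro t ht ρ ⟨hρ, e11, e12, e15, e16, e17, e18⟩
      have htk : t + 1 ≤ k := ht.trans_le c.arity_le
      have hpow : 2 ^ (t + 1) < 2 ^ (k + 1) := Nat.pow_lt_pow_right (by norm_num) (by omega)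
      have b15 : 2 * 2 ^ t < modulus n k Φ.m := lt_modulus (by rw [← pow_succ']; exact hpow)
      have b16 : ∀ P, ∑ i ∈ Finset.range t, p P i * 2 ^ i + p P t * 2 ^ t
          < modulus n k Φ.m := by
        intro P
        rw [← Finset.sum_range_succ (fun i => p P i * 2 ^ i)]
        exact lt_modulus ((sum_bits_lt (hp1 P)).trans hpow)
      have b18 : ∑ i ∈ Finset.range t, p (· ∈ G) i + p (· ∈ G) t < modulus n k Φ.m := by
        rw [← Finset.sum_range_succ (fun i => p (· ∈ G) i)]
        refine lt_modulus (lt_of_le_of_lt (Finset.sum_le_card_nsmul _ _ 1 fun i _ => hp1 _ i) ?_)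
        have := Nat.lt_two_pow_self (n := k + 1)
        simp only [Finset.card_range, smul_eq_mul, mul_one]
        omega
      have hs : ρ 3 l t = c.scope ⟨t, ht⟩ := hρ.scope l ⟨t, ht⟩
      have hg : ρ 6 (c.scope ⟨t, ht⟩) 0 = p (· ∈ G) t := by
        rw [hρ.part]
        simp [p, ht]
      have hy : ρ 7 (c.scope ⟨t, ht⟩) 0 = p (y · = 1) t := by
        rw [hρ.assign]
        simp [p, ht]
      have he : (if (c.scope ⟨t, ht⟩ : ℕ) = j then 1 else 0) = p (· = j) t := by
        simp [p, ht, Fin.ext_iff]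
      refine ⟨(hρ.upd (Or.inr (by norm_num)) _ _ _).run _ (by decide), ?_, ?_, ?_, ?_, ?_, ?_⟩
      · rw [RCmd.run_of_notMem _ (by decide), Memory.upd_of_ne (by decide), e11]
      · rw [RCmd.run_of_notMem _ (by decide), Memory.upd_of_ne (by decide), e12]
      all_goals
        simp [scanStep, setMod, setCell, scopeVar, cell, RCmd.run, RExp.eval, AOp.apply,
          Memory.upd, e11, e12, e15, e16, e17, e18, hρ.modulus_eq, hs, hg, hy, he,
          Nat.mod_eq_of_lt b15, Nat.mod_eq_of_lt (b16 _), Nat.mod_eq_of_lt b18,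
          Finset.sum_range_succ, pow_succ']
  let σ₀ := (setCell 18 (.lit 0)).run ((setCell 17 (.lit 0)).run ((setCell 16 (.lit 0)).run
    ((setCell 15 (.lit 1)).run σ)))
  have hrun : scan.run σ = iterateFun (fun t τ => scanStep.run (τ.upd 13 0 0 t)) (σ₀ 2 l 0) σ₀ := by
    have : σ₀ 12 0 0 = l := by simp [σ₀, setCell, RCmd.run, RExp.eval, Memory.upd, hl]
    rw [← this]
    rfl
  have hσ₀ : Ctx Φ G y σ₀ := (((h.run _ (by decide)).run _ (by decide)).run _ (by decide)).run _
    (by decide)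
  have h1 := key σ₀ hσ₀
    (by simp [σ₀, setCell, RCmd.run, RExp.eval, Memory.upd, hj])
    (by simp [σ₀, setCell, RCmd.run, RExp.eval, Memory.upd, hl])
    (by simp [σ₀, setCell, RCmd.run, RExp.eval, Memory.upd])
    (by simp [σ₀, setCell, RCmd.run, RExp.eval, Memory.upd])
    (by simp [σ₀, setCell, RCmd.run, RExp.eval, Memory.upd])
    (by simp [σ₀, setCell, RCmd.run, RExp.eval, Memory.upd])
  rw [hrun, hσ₀.arity l]
  refine ⟨h1.1, ?_, ?_, ?_⟩
  · rw [h1.2.1]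
    exact hpsum (· = j) fun i => 2 ^ i
  · rw [h1.2.2.1, colOf_eq_sum]
    exact hpsum (y · = 1) fun i => 2 ^ i
  · rw [h1.2.2.2]
    have := hpsum (· ∈ G) (fun _ => 1)
    simp only [mul_one] at this
    rw [this, Finset.sum_boole, Nat.cast_id, Constraint.vars, ← Finset.filter_mem_eq_inter,
      Finset.filter_map, Finset.card_map]
    rfl

/-- One more than twice the derivative, in terms of the arguments of the predicate. -/
def localLevel (c : Constraint n k) (p : Fin c.arity) (b : Fin c.arity → ℤˣ) : ℕ :=
  (if c.pred (Function.update b p 1) = true then 1 else 0)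
    + (if c.pred (Function.update b p (-1)) = true then 0 else 1)

theorem localLevel_le (c : Constraint n k) (p : Fin c.arity) (b : Fin c.arity → ℤˣ) :
    localLevel c p b ≤ 2 := by
  unfold localLevel
  split_ifs <;> simp

/-- Each of the two factors has the form 1 + bit · (B - 1), which is B or 1. -/
theorem eval_factor {σ : Memory} (h : Ctx Φ G y σ) {l : Fin Φ.m} (hl : σ 12 0 0 = l)
    {p : Fin (Φ.con l).arity} (hp : σ 16 0 0 = 2 ^ (p : ℕ)) {e : RExp}
    {b : Fin (Φ.con l).arity → ℤˣ} (he : e.eval σ = colOf b) :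
    (factor e).eval σ = base n ^ localLevel (Φ.con l) p b := by
  have h1 : 1 + (base n - 1) = base n := by
    have := base_pos (n := n)
    omega
  simp only [factor, cleared, cell, RExp.eval, AOp.apply, hl, hp, he, colOf_sub,
    ← colOf_update_one, h.table, h.base_eq]
  rw [localLevel, pow_add]
  congr 1 <;> split_ifs <;> simp [h1]

/-- The loop always runs through 2^k columns, a literal, and masks those beyond the truth table.
Partial sums never exceed the full sum, which is below the modulus. -/
theorem run_total {σ : Memory} (h : Ctx Φ G y σ) {l : Fin Φ.m} (hl : σ 12 0 0 = l)
    {p : Fin (Φ.con l).arity} (hp : σ 16 0 0 = 2 ^ (p : ℕ))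
    (ha : σ 15 0 0 = 2 ^ (Φ.con l).arity) :
    (total k).run σ 19 0 0 = ∑ b, base n ^ localLevel (Φ.con l) p b := by
  have hak : 2 ^ (Φ.con l).arity ≤ 2 ^ k := Nat.pow_le_pow_right (by norm_num) (Φ.con l).arity_le
  set F : ℕ → ℕ := fun col => (factor (.lit col)).eval σ with hF
  have hFsum : ∑ b, base n ^ localLevel (Φ.con l) p b = ∑ col ∈ Finset.range (2 ^ (Φ.con l).arity), F col := by
    rw [← sum_colOf]
    exact Finset.sum_congr rfl fun b _ => (eval_factor h hl hp (e := .lit (colOf b)) rfl).symm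
  have hbound : ∑ b, base n ^ localLevel (Φ.con l) p b < modulus n k Φ.m := by
    calc ∑ b, base n ^ localLevel (Φ.con l) p b ≤ ∑ _b : Fin (Φ.con l).arity → ℤˣ, base n ^ 2 :=
          Finset.sum_le_sum fun b _ => Nat.pow_le_pow_right base_pos (localLevel_le _ _ _)
      _ = 2 ^ (Φ.con l).arity * base n ^ 2 := by simp
      _ < 2 ^ (k + 1) * base n ^ 2 := by
          refine Nat.mul_lt_mul_of_pos_right ?_ (pow_pos base_pos _)
          rw [pow_succ]
          have := Nat.one_le_two_pow (n := k)
          omega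
      _ ≤ _ := Nat.mul_le_mul_left _ (Nat.pow_le_pow_right base_pos (by omega))
  have hpart : ∀ t, ∑ col ∈ Finset.range t, (if col < 2 ^ (Φ.con l).arity then F col else 0)
      ≤ ∑ col ∈ Finset.range (2 ^ (Φ.con l).arity), F col := by
    intro t
    rw [← Finset.sum_filter]
    exact Finset.sum_le_sum_of_subset fun col hcol =>
      Finset.mem_range.2 (Finset.mem_filter.1 hcol).2
  let σ₀ := (setCell 19 (.lit 0)).run σ
  have hfr : ∀ τ : Memory, (∀ a, a ≠ 14 → a ≠ 19 → τ a = σ a) → ∀ col, τ 14 0 0 = col →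
      (factor (cell 14)).eval τ = F col := by
    intro τ hτ col hcol
    simp only [hF, factor, cleared, cell, RExp.eval, AOp.apply, hcol, hτ 12 (by decide) (by decide),
      hτ 16 (by decide) (by decide), hτ 8 (by decide) (by decide), hτ 4 (by decide) (by decide)]
  have key := iterateFun_induction (N := 2 ^ k)
    (body := fun t τ => (setMod 19 (.op .add (cell 19) (.op .mul (.op .le (.op .add (cell 14)
      (.lit 1)) (cell 15)) (factor (cell 14))))).run (τ.upd 14 0 0 t)) (s := σ₀)
    (fun t τ => (∀ a, a ≠ 14 → a ≠ 19 → τ a = σ a) ∧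
      τ 19 0 0 = ∑ col ∈ Finset.range t, (if col < 2 ^ (Φ.con l).arity then F col else 0)) ?_ ?_
  · change iterateFun _ (2 ^ k) σ₀ 19 0 0 = _
    rw [key.2, hFsum, ← Finset.sum_filter]
    refine Finset.sum_congr ?_ fun _ _ => rfl
    ext col
    simp only [Finset.mem_filter, Finset.mem_range]
    omega
  · exact ⟨fun a _ ha => Memory.upd_of_ne ha _ _ _, by
      simp [σ₀, setCell, RCmd.run, RExp.eval, Memory.upd]⟩
  · rintro t ht τ ⟨hτ, h19⟩
    have hτ' : ∀ a, a ≠ 14 → a ≠ 19 → (τ.upd 14 0 0 t) a = σ a := fun a h1 h2 => by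
      rw [Memory.upd_of_ne h1, hτ a h1 h2]
    refine ⟨fun a h1 h2 => ?_, ?_⟩
    · rw [RCmd.run_of_notMem _ (by simpa [setMod, setCell, RCmd.writes] using h2), hτ' a h1 h2]
    · have e14 : (τ.upd 14 0 0 t) 14 0 0 = t := Memory.upd_self _ _ _ _ _
      have e15 : (τ.upd 14 0 0 t) 15 0 0 = 2 ^ (Φ.con l).arity := by rw [hτ' 15 (by decide) (by decide), ha]
      have e9 : (τ.upd 14 0 0 t) 9 0 0 = modulus n k Φ.m := by
        rw [hτ' 9 (by decide) (by decide), h.modulus_eq]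
      have e19 : (τ.upd 14 0 0 t) 19 0 0
          = ∑ col ∈ Finset.range t, (if col < 2 ^ (Φ.con l).arity then F col else 0) := by
        rw [Memory.upd_of_ne (by decide), h19]
      have hf := hfr _ hτ' t e14
      generalize τ.upd 14 0 0 t = ρ at *
      have hval : ((setMod 19 (.op .add (cell 19) (.op .mul (.op .le (.op .add (cell 14)
          (.lit 1)) (cell 15)) (factor (cell 14))))).run ρ) 19 0 0
          = (ρ 19 0 0 + (if ρ 14 0 0 + 1 ≤ ρ 15 0 0 then 1 else 0) * (factor (cell 14)).eval ρ)
            % ρ 9 0 0 := Memory.upd_self _ _ _ _ _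
      rw [hval, e9, e14, e15, e19, hf, Finset.sum_range_succ, ite_mul, one_mul, zero_mul]
      refine Nat.mod_eq_of_lt (lt_of_le_of_lt ?_ hbound)
      rw [hFsum]
      have := hpart (t + 1)
      rwa [Finset.sum_range_succ] at this

end Sampler

/-! ### Levels of assignments -/

section Levels

variable {n k : ℕ}

/-- One more than twice the derivative of the constraint. -/
def Constraint.level (c : Constraint n k) (j : Fin n) (y : Assignment n) : ℕ :=
  (if c.Sat (Function.update y j 1) then 1 else 0)
    + (if c.Sat (Function.update y j (-1)) then 0 else 1)

theorem Constraint.level_le (c : Constraint n k) (j : Fin n) (y : Assignment n) :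
    c.level j y ≤ 2 := by
  unfold Constraint.level
  split_ifs <;> simp

/-- The affine change makes the derivative a natural number in {0, 1, 2}, fit to be an exponent. -/
theorem Constraint.cast_level (c : Constraint n k) (j : Fin n) (y : Assignment n) :
    (c.level j y : ℝ) = 2 * c.deriv j y + 1 := by
  rw [c.deriv_eq, Constraint.level, Constraint.value, Constraint.value]
  split_ifs <;> norm_num

theorem Constraint.dependsOn_level (c : Constraint n k) (j : Fin n) :
    _root_.DependsOn (c.level j) ((c.vars.erase j : Finset (Fin n)) : Set (Fin n)) := by
  intro x y h
  have h1 := Constraint.dependsOn_comp_update c.dependsOn_sat j 1 h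
  have h2 := Constraint.dependsOn_comp_update c.dependsOn_sat j (-1) h
  simp only at h1 h2
  simp only [Constraint.level, h1, h2]

theorem Constraint.localLevel_comp (c : Constraint n k) (p : Fin c.arity) (y : Assignment n) :
    Sampler.localLevel c p (fun i => y (c.scope i)) = c.level (c.scope p) y := by
  have h : ∀ s, Function.update (fun i => y (c.scope i)) p s
      = fun i => Function.update y (c.scope p) s (c.scope i) := fun s =>
    (Function.update_comp_eq_of_injective y c.scope.injective p s).symm
  simp only [Sampler.localLevel, Constraint.level, Constraint.Sat, h]
  congr!

/-- Sum of the levels of the active constraints of `j` among the first `t` ones. -/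
def Instance.levelSum (Φ : Instance n k) (G : Finset (Fin n)) (j : Fin n) (t : ℕ)
    (y : Assignment n) : ℕ :=
  ∑ l ∈ (Φ.activeAt G j).filter (fun l : Fin Φ.m => (l : ℕ) < t), (Φ.con l).level j y

variable {Φ : Instance n k} {G : Finset (Fin n)} {j : Fin n}

theorem Instance.levelSum_zero (y : Assignment n) : Φ.levelSum G j 0 y = 0 := by
  simp [Instance.levelSum]

theorem Instance.levelSum_succ (l : Fin Φ.m) (y : Assignment n) :
    Φ.levelSum G j (l + 1) y
      = Φ.levelSum G j l y + if l ∈ Φ.activeAt G j then (Φ.con l).level j y else 0 := by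
  unfold Instance.levelSum
  split_ifs with hl
  · have : (Φ.activeAt G j).filter (fun l' : Fin Φ.m => (l' : ℕ) < l + 1)
        = insert l ((Φ.activeAt G j).filter (fun l' : Fin Φ.m => (l' : ℕ) < l)) := by
      ext l'
      simp only [Finset.mem_filter, Finset.mem_insert, Fin.ext_iff, Nat.lt_succ_iff_lt_or_eq]
      constructor
      · tauto
      · rintro (h | h)
        · exact ⟨by rwa [Fin.ext h], Or.inr h⟩
        · tauto
    rw [this, Finset.sum_insert (by simp), add_comm]
  · rw [add_zero]
    refine Finset.sum_congr ?_ fun _ _ => rfl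
    ext l'
    simp only [Finset.mem_filter, Nat.lt_succ_iff_lt_or_eq]
    constructor
    · rintro ⟨h, h' | h'⟩
      · exact ⟨h, h'⟩
      · exact absurd (by rwa [← Fin.ext h']) hl
    · tauto

theorem Instance.levelSum_le (t : ℕ) (y : Assignment n) : Φ.levelSum G j t y ≤ 2 * Φ.m := by
  have h1 : Φ.levelSum G j t y ≤ _ :=
    Finset.sum_le_card_nsmul _ _ 2 fun l _ => (Φ.con l).level_le j y
  have h2 := Finset.card_le_univ ((Φ.activeAt G j).filter (fun l : Fin Φ.m => (l : ℕ) < t))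
  rw [Fintype.card_fin] at h2
  rw [smul_eq_mul] at h1
  omega

/-- An increasing affine function of the gain, so levels and gains order the assignments alike. -/
theorem Instance.cast_levelSum (y : Assignment n) :
    (Φ.levelSum G j Φ.m y : ℝ) = 2 * Φ.gain G j y + (Φ.activeAt G j).card := by
  have : (Φ.activeAt G j).filter (fun l : Fin Φ.m => (l : ℕ) < Φ.m) = Φ.activeAt G j :=
    Finset.filter_true_of_mem fun l _ => l.2
  rw [Instance.levelSum, this, Instance.gain]
  push_cast
  simp only [Constraint.cast_level]
  rw [Finset.sum_add_distrib, Finset.mul_sum]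
  simp

/-- The new constraint reads variables disjoint from those of the earlier active ones, so the
generating sums multiply. Summing over the truth table instead of all assignments leaves the factor
2^arity, and the division in the program is exact. -/
theorem Instance.TriangleFree.sum_pow_levelSum_mul (hΦ : Φ.TriangleFree) {l : Fin Φ.m}
    (hl : l ∈ Φ.activeAt G j) {p : Fin (Φ.con l).arity} (hp : (Φ.con l).scope p = j) (B : ℕ) :
    (∑ y, B ^ Φ.levelSum G j l y) * (∑ b, B ^ Sampler.localLevel (Φ.con l) p b)
      = 2 ^ (Φ.con l).arity * ∑ y, B ^ Φ.levelSum G j (l + 1) y := by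
  have hdis : Disjoint (((Φ.activeAt G j).filter (fun l' : Fin Φ.m => (l' : ℕ) < l)).biUnion
      fun l' => (Φ.con l').vars.erase j) ((Φ.con l).vars.erase j) := by
    rw [Finset.disjoint_biUnion_left]
    intro l' hl'
    rw [Finset.mem_filter] at hl'
    refine hΦ.disjoint_erase ?_ (Instance.mem_activeAt.1 hl'.1).2 (Instance.mem_activeAt.1 hl).2
    rintro rfl
    exact lt_irrefl _ hl'.2
  have h1 := sum_mul_sum_of_disjoint (α := ℤˣ) hdis
    (f := fun y => B ^ Φ.levelSum G j l y) (g := fun y => B ^ (Φ.con l).level j y)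
    (DependsOn.comp_right (dependsOn_of_finset_sum fun l' _ => (Φ.con l').dependsOn_level j)
      (B ^ ·)) (DependsOn.comp_right ((Φ.con l).dependsOn_level j) (B ^ ·))
  have h2 := card_mul_sum_comp_embedding (Φ.con l).scope
    (fun b => B ^ Sampler.localLevel (Φ.con l) p b)
  simp only [Constraint.localLevel_comp, hp, Fintype.card_fun, Fintype.card_units_int,
    Fintype.card_fin, Nat.cast_id] at h1 h2
  have h3 : ∀ y, B ^ Φ.levelSum G j l y * B ^ (Φ.con l).level j y
      = B ^ Φ.levelSum G j (l + 1) y := fun y => by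
    rw [Instance.levelSum_succ, if_pos hl, pow_add]
  simp only [h3] at h1
  have h0 : 0 < 2 ^ n := by positivity
  apply Nat.eq_of_mul_eq_mul_left h0
  calc 2 ^ n * ((∑ y, B ^ Φ.levelSum G j l y) * (∑ b, B ^ Sampler.localLevel (Φ.con l) p b))
      = (∑ y, B ^ Φ.levelSum G j l y) *
        (2 ^ n * ∑ b, B ^ Sampler.localLevel (Φ.con l) p b) := by ring
    _ = 2 ^ (Φ.con l).arity * ((∑ y, B ^ Φ.levelSum G j l y) *
        ∑ y, B ^ (Φ.con l).level j y) := by rw [← h2]; ring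
    _ = _ := by rw [h1]; ring

end Levels

/-! ### Correctness of the loop over the constraints -/

namespace Sampler

variable {n k : ℕ} {Φ : Instance n k} {G : Finset (Fin n)} {y : Assignment n}

/-- There are 2^n < B terms, each at most B^(2m). Hence the reductions of cells `20` and `21` change
nothing. -/
theorem sum_pow_levelSum_lt (j : Fin n) (t : ℕ) :
    ∑ y, base n ^ Φ.levelSum G j t y < modulus n k Φ.m := by
  calc ∑ y, base n ^ Φ.levelSum G j t y ≤ ∑ _y : Assignment n, base n ^ (2 * Φ.m) :=
        Finset.sum_le_sum fun y _ => Nat.pow_le_pow_right base_pos (Instance.levelSum_le t y)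
    _ = 2 ^ n * base n ^ (2 * Φ.m) := by simp
    _ < base n * base n ^ (2 * Φ.m) := by
        refine Nat.mul_lt_mul_of_pos_right ?_ (pow_pos base_pos _)
        rw [base, pow_add]
        have := Nat.one_le_two_pow (n := n)
        omega
    _ = base n ^ (2 * Φ.m + 1) := by rw [pow_succ, mul_comm]
    _ ≤ base n ^ (2 * Φ.m + 2) := Nat.pow_le_pow_right base_pos (by omega)
    _ ≤ _ := Nat.le_mul_of_pos_left _ (by positivity)

theorem run_constraintStep (hΦ : Φ.TriangleFree) {σ : Memory} (h : Ctx Φ G y σ) {j : Fin n}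
    {l : Fin Φ.m} (hj : σ 11 0 0 = j) (hl : σ 12 0 0 = l)
    (h20 : σ 20 0 0 = ∑ y', base n ^ Φ.levelSum G j l y')
    (h21 : σ 21 0 0 = base n ^ Φ.levelSum G j l y) :
    (constraintStep k).run σ 20 0 0 = ∑ y', base n ^ Φ.levelSum G j (l + 1) y' ∧
    (constraintStep k).run σ 21 0 0 = base n ^ Φ.levelSum G j (l + 1) y := by
  obtain ⟨e15, e16, e17, e18⟩ := run_scan h hj hl
  have hτ : Ctx Φ G y (scan.run σ) := h.run _ (by decide)
  have f12 : scan.run σ 12 0 0 = l := by rw [RCmd.run_of_notMem _ (by decide), hl]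
  have f20 : scan.run σ 20 0 0 = ∑ y', base n ^ Φ.levelSum G j l y' := by
    rw [RCmd.run_of_notMem _ (by decide), h20]
  have f21 : scan.run σ 21 0 0 = base n ^ Φ.levelSum G j l y := by
    rw [RCmd.run_of_notMem _ (by decide), h21]
  have hrun : (constraintStep k).run σ = if active.eval (scan.run σ) ≠ 0
      then (updateLevels k).run (scan.run σ) else scan.run σ := rfl
  have hact : active.eval (scan.run σ) ≠ 0 ↔ l ∈ Φ.activeAt G j := by
    have hact' : active.eval (scan.run σ) ≠ 0 ↔
        scan.run σ 18 0 0 = 1 ∧ 1 ≤ scan.run σ 16 0 0 := by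
      by_cases h1 : scan.run σ 18 0 0 = 1 <;> by_cases h2 : 1 ≤ scan.run σ 16 0 0 <;>
        simp [active, cell, RExp.eval, AOp.apply, h1, h2]
    rw [hact', e18, Instance.mem_activeAt]
    refine and_congr_right fun _ => ?_
    rw [Nat.one_le_iff_ne_zero, e16, Constraint.mem_vars, Ne, Finset.sum_eq_zero_iff]
    simp
  rw [hrun]
  by_cases hla : l ∈ Φ.activeAt G j
  · rw [if_pos (hact.2 hla)]
    obtain ⟨p, hp⟩ := Constraint.mem_vars.1 (Instance.mem_activeAt.1 hla).2
    have e16' : scan.run σ 16 0 0 = 2 ^ (p : ℕ) := by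
      rw [e16, Finset.sum_eq_single p]
      · simp [hp]
      · intro q _ hq
        rw [if_neg, zero_mul]
        rw [← hp]
        exact fun h => hq ((Φ.con l).scope.injective h)
      · exact fun h => absurd (Finset.mem_univ _) h
    generalize scan.run σ = τ at *
    have t19 := run_total hτ f12 e16' e15
    have hρ : Ctx Φ G y ((total k).run τ) := hτ.run _ (by simp [total, setMod, setCell, RCmd.writes]; omega)
    have tfr : ∀ a, a ≠ 14 → a ≠ 19 → (total k).run τ a = τ a := fun a h1 h2 =>
      RCmd.run_of_notMem _ (by simp [total, setMod, setCell, RCmd.writes, h1, h2]) _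
    rw [← tfr 12 (by decide) (by decide)] at f12
    rw [← tfr 15 (by decide) (by decide)] at e15
    rw [← tfr 16 (by decide) (by decide)] at e16'
    rw [← tfr 17 (by decide) (by decide)] at e17
    rw [← tfr 20 (by decide) (by decide)] at f20
    rw [← tfr 21 (by decide) (by decide)] at f21
    have hrun2 : (updateLevels k).run τ = (setMod 21 (.op .mul (cell 21) (factor (cell 17)))).run
        ((setMod 20 (.op .div (.op .mul (cell 20) (cell 19)) (cell 15))).run
          ((total k).run τ)) := rfl
    rw [hrun2]
    generalize (total k).run τ = ρ at *
    set ρ' := (setMod 20 (.op .div (.op .mul (cell 20) (cell 19)) (cell 15))).run ρ with hρ'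
    have g20 : ρ' 20 0 0 = ∑ y', base n ^ Φ.levelSum G j (l + 1) y' := by
      have : ρ' 20 0 0 = (ρ 20 0 0 * ρ 19 0 0 / ρ 15 0 0) % ρ 9 0 0 := Memory.upd_self _ _ _ _ _
      rw [this, f20, t19, e15, hΦ.sum_pow_levelSum_mul hla hp, Nat.mul_div_cancel_left _
        (by positivity), hρ.modulus_eq, Nat.mod_eq_of_lt (sum_pow_levelSum_lt j _)]
    have hc : Ctx Φ G y ρ' := hρ.run _ (by decide)
    have gfr : ∀ a, a ≠ 20 → ρ' a = ρ a := fun a ha =>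
      RCmd.run_of_notMem _ (by simpa [setMod, setCell, RCmd.writes] using ha) _
    rw [← gfr 12 (by decide)] at f12
    rw [← gfr 16 (by decide)] at e16'
    rw [← gfr 17 (by decide)] at e17
    rw [← gfr 21 (by decide)] at f21
    refine ⟨by rw [RCmd.run_of_notMem _ (by decide), g20], ?_⟩
    have hval : (setMod 21 (.op .mul (cell 21) (factor (cell 17)))).run ρ' 21 0 0
        = (ρ' 21 0 0 * (factor (cell 17)).eval ρ') % ρ' 9 0 0 := Memory.upd_self _ _ _ _ _
    rw [hval, eval_factor hc f12 e16' (e := cell 17)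
      (b := fun i => y ((Φ.con l).scope i)) e17,
      Constraint.localLevel_comp, hp, f21, hc.modulus_eq, ← pow_add]
    have hs : Φ.levelSum G j l y + (Φ.con l).level j y = Φ.levelSum G j (l + 1) y := by
      rw [Instance.levelSum_succ, if_pos hla]
    rw [hs]
    refine Nat.mod_eq_of_lt (lt_of_le_of_lt ?_ (sum_pow_levelSum_lt (G := G) (Φ := Φ) j (l + 1)))
    exact Finset.single_le_sum (f := fun y' => base n ^ Φ.levelSum G j (l + 1) y')
      (fun _ _ => Nat.zero_le _) (Finset.mem_univ y)
  · rw [if_neg (fun h => hla (hact.1 h)), f20, f21]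
    simp only [Instance.levelSum_succ, if_neg hla, add_zero, and_self]

theorem writes_constraintStep {a : ℕ} (ha : a < 12 ∨ 21 < a) :
    a ∉ (constraintStep k).writes := by
  simp [constraintStep, scan, scanStep, updateLevels, total, setMod, setCell, RCmd.writes]
  omega

theorem writes_prepare {a : ℕ} (ha : a < 12 ∨ 21 < a) : a ∉ (prepare k).writes := by
  have := writes_constraintStep (k := k) ha
  simp only [prepare, setMod, setCell, RCmd.writes, Finset.mem_union, Finset.mem_singleton]
  rintro (h | h | h | h)
  · omega
  · omega
  · omega
  · exact this h

theorem run_prepare (hΦ : Φ.TriangleFree) {σ : Memory} (h : Ctx Φ G y σ) {j : Fin n}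
    (hj : σ 11 0 0 = j) :
    (prepare k).run σ 20 0 0 = ∑ y', base n ^ Φ.levelSum G j Φ.m y' ∧
    (prepare k).run σ 21 0 0 = base n ^ Φ.levelSum G j Φ.m y := by
  set σ₀ := (setCell 21 (.lit 1)).run ((setMod 20 (.op .div (cell 8) (.lit 4))).run σ) with hσ₀
  have hc : Ctx Φ G y σ₀ := (h.run _ (by decide)).run _ (by decide)
  have hm : σ₀ 1 0 0 = Φ.m := by
    rw [hc.input 1 (by norm_num)]
    simp [inputMemory]
  have hrun : (prepare k).run σ
      = iterateFun (fun t τ => (constraintStep k).run (τ.upd 12 0 0 t)) (σ₀ 1 0 0) σ₀ := rfl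
  have key := iterateFun_induction (N := Φ.m)
    (body := fun t τ => (constraintStep k).run (τ.upd 12 0 0 t)) (s := σ₀)
    (fun t τ => Ctx Φ G y τ ∧ τ 11 0 0 = j ∧
      τ 20 0 0 = ∑ y', base n ^ Φ.levelSum G j t y' ∧
      τ 21 0 0 = base n ^ Φ.levelSum G j t y) ?_ ?_
  · rw [hrun, hm]
    exact key.2.2
  · refine ⟨hc, ?_, ?_, ?_⟩
    · simp [σ₀, setMod, setCell, RCmd.run, RExp.eval, Memory.upd, hj]
    -- Before any constraint is read, all 2^n assignments are at level 0; the program obtains 2^n as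
    -- B/4.
    · have hlt : 2 ^ n < modulus n k Φ.m := by
        have := sum_pow_levelSum_lt (Φ := Φ) (G := G) j 0
        simpa [Instance.levelSum_zero] using this
      have hdiv : base n / 4 = 2 ^ n := by
        rw [base, pow_add]
        simp
      simp [σ₀, setMod, setCell, cell, RCmd.run, RExp.eval, AOp.apply, Memory.upd, h.base_eq,
        h.modulus_eq, hdiv, Nat.mod_eq_of_lt hlt, Instance.levelSum_zero]
    · simp [σ₀, setMod, setCell, RCmd.run, RExp.eval, Memory.upd, Instance.levelSum_zero]
  · rintro t ht τ ⟨hτ, h11, h20, h21⟩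
    have hτ' := hτ.upd (a := 12) (Or.inr (by norm_num)) 0 0 t
    refine ⟨hτ'.run _ fun a ha _ => writes_constraintStep (by omega), ?_,
      run_constraintStep hΦ hτ' (l := ⟨t, ht⟩) ?_ (Memory.upd_self _ _ _ _ _) ?_ ?_⟩
    · rw [RCmd.run_of_notMem _ (writes_constraintStep (by omega)), Memory.upd_of_ne (by decide), h11]
    · rw [Memory.upd_of_ne (by decide), h11]
    · rw [Memory.upd_of_ne (by decide), h20]
    · rw [Memory.upd_of_ne (by decide), h21]

end Sampler

theorem map_uniformOfFintype_of_bijective {α β : Type*} [Fintype α] [Fintype β] [Nonempty α]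
    [Nonempty β] {f : α → β} (hf : Function.Bijective f) :
    (PMF.uniformOfFintype α).map f = PMF.uniformOfFintype β := by
  classical
  ext b
  obtain ⟨a, rfl⟩ := hf.2 b
  rw [PMF.map_apply, tsum_fintype, Finset.sum_eq_single a]
  · simp [Fintype.card_of_bijective hf]
  · intro a' _ h
    exact if_neg fun h' => h (hf.1 h'.symm)
  · exact fun h => absurd (Finset.mem_univ _) h

namespace Sampler

variable {n k : ℕ} {Φ : Instance n k} {G : Finset (Fin n)} {y : Assignment n}

/-! ### The law of the output of the program -/

/-- The signs stored in an array. -/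
def readSigns (arr n : ℕ) (σ : Memory) : Assignment n := fun i => if σ arr i 0 = 1 then 1 else -1

theorem readSigns_congr {arr : ℕ} {σ τ : Memory} (h : τ arr = σ arr) :
    readSigns arr n τ = readSigns arr n σ := by
  unfold readSigns
  rw [h]

theorem readSigns_upd (arr : ℕ) (σ : Memory) (t : Fin n) (v : ℕ) :
    readSigns arr n (σ.upd arr t 0 v)
      = Function.update (readSigns arr n σ) t (if v = 1 then 1 else -1) := by
  funext i
  by_cases hi : i = t
  · subst hi
    simp [readSigns, Memory.upd]
  · have : (i : ℕ) ≠ t := fun h => hi (Fin.ext h)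
    simp [readSigns, Memory.upd, hi, this]

theorem card_assignment : Fintype.card (Assignment n) = 2 ^ n := by simp

theorem base_eq : base n = 4 * 2 ^ n := by rw [base, pow_add]; ring

theorem levelSum_lt_iff (j : Fin n) (y' : Assignment n) :
    Φ.levelSum G j Φ.m y < Φ.levelSum G j Φ.m y' ↔ Φ.gain G j y < Φ.gain G j y' := by
  rw [← Nat.cast_lt (α := ℝ), Instance.cast_levelSum, Instance.cast_levelSum]
  constructor <;> intro h <;> linarith

theorem levelSum_eq_iff (j : Fin n) (y' : Assignment n) :
    Φ.levelSum G j Φ.m y' = Φ.levelSum G j Φ.m y ↔ Φ.gain G j y' = Φ.gain G j y := by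
  rw [← Nat.cast_inj (R := ℝ), Instance.cast_levelSum, Instance.cast_levelSum]
  constructor <;> intro h <;> linarith

/-- The base-B digit at the level of `y` is the number of ties, and the higher digits count the
assignments with larger gain. One uniform rank among the ties then gives the median sign, and one
coin the response. -/
theorem hasLaw_draw (hΦ : Φ.TriangleFree) (ε : ℝ) {σ : Memory} (h : Ctx Φ G y σ) {j : Fin n}
    (hj : σ 11 0 0 = j) :
    HasLaw ((draw k).law (responseLaw ε) σ) (Ctx Φ G y) (readSigns 5 n)
      ((privateSign ε Φ G y j).map (Function.update (readSigns 5 n σ) j)) := by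
  classical
  obtain ⟨e20, e21⟩ := run_prepare hΦ h hj
  have hτ : Ctx Φ G y ((prepare k).run σ) := h.run _ fun a ha _ => writes_prepare (by omega)
  have e5 : (prepare k).run σ 5 = σ 5 := RCmd.run_of_notMem _ (writes_prepare (by omega)) _
  have e11 : (prepare k).run σ 11 0 0 = j := by
    rw [RCmd.run_of_notMem _ (writes_prepare (by omega)), hj]
  have hlaw₀ : (draw k).law (responseLaw ε) σ = (uniformBelow (((prepare k).run σ 20 0 0
      / (prepare k).run σ 21 0 0) % (prepare k).run σ 8 0 0)).bind fun u =>
      (responseLaw ε).bind fun b => PMF.pure (conclude.run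
        ((((prepare k).run σ).upd 22 0 0 u).upd 23 0 0 (if b = 1 then 1 else 0))) := by
    rw [draw, RCmd.law, RCmd.law_eq_pure _ (by simp [prepare, constraintStep, scan, scanStep,
      updateLevels, total, setMod, setCell, RCmd.Det]), PMF.pure_bind]
    simp only [RCmd.law, PMF.bind_map]
    rfl
  generalize (prepare k).run σ = τ at *
  have hB : Fintype.card (Assignment n) + 1 < base n := by
    rw [card_assignment, base_eq]
    have := Nat.one_le_two_pow (n := n)
    omega
  have hE : τ 20 0 0 / τ 21 0 0 % τ 8 0 0
      = (Finset.univ.filter fun y' => Φ.gain G j y' = Φ.gain G j y).card := by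
    rw [e20, e21, hτ.base_eq, sum_pow_digit (by omega)]
    simp only [levelSum_eq_iff]
  have hA : τ 20 0 0 / (τ 21 0 0 * τ 8 0 0) % (τ 8 0 0 - 1)
      = (Finset.univ.filter fun y' => Φ.gain G j y < Φ.gain G j y').card := by
    rw [e20, e21, hτ.base_eq, sum_pow_upper_digits hB]
    simp only [levelSum_lt_iff]
  have heven : Even (Fintype.card (Assignment n)) := by
    rw [card_assignment]
    exact (Nat.even_pow' (Fin.pos j).ne').2 even_two
  have hrank := map_uniformBelow_eq_medianSign heven (Φ.gain G j) y
  rw [hE] at hlaw₀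
  set E := (Finset.univ.filter fun y' => Φ.gain G j y' = Φ.gain G j y).card
  set A := (Finset.univ.filter fun y' => Φ.gain G j y < Φ.gain G j y').card
  have hres : ∀ u b, readSigns 5 n (conclude.run ((τ.upd 22 0 0 u).upd 23 0 0
      (if b = (1 : ℤˣ) then 1 else 0))) = Function.update (readSigns 5 n σ) j
        (b * if 2 * (A + u) < Fintype.card (Assignment n) then 1 else -1) := by
    intro u b
    have hrun : conclude.run ((τ.upd 22 0 0 u).upd 23 0 0 (if b = 1 then 1 else 0))
        = ((τ.upd 22 0 0 u).upd 23 0 0 (if b = 1 then 1 else 0)).upd 5 (τ 11 0 0) 0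
          (if (if 8 * (τ 20 0 0 / (τ 21 0 0 * τ 8 0 0) % (τ 8 0 0 - 1) + u) + 1 ≤ τ 8 0 0
            then 1 else 0) = (if b = 1 then 1 else 0) then 1 else 0) := rfl
    -- The comparison uses the stored base 4 · 2^n in place of 2^n.
    have hcond : 8 * (A + u) + 1 ≤ base n ↔ 2 * (A + u) < Fintype.card (Assignment n) := by
      rw [card_assignment, base_eq]
      omega
    rw [hrun, hA, e11, hτ.base_eq, readSigns_upd]
    congr 1
    · refine readSigns_congr ?_
      rw [Memory.upd_of_ne (by decide), Memory.upd_of_ne (by decide), e5]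
    -- A product of two signs is +1 exactly when their bits agree, hence the equality test in
    -- `conclude`.
    · simp only [hcond]
      rcases Int.units_eq_one_or b with rfl | rfl <;>
        by_cases hc : 2 * (A + u) < Fintype.card (Assignment n) <;>
        simp only [hc, if_true, if_false] <;> simp
  rw [hlaw₀]
  constructor
  · intro ρ hρ
    obtain ⟨u, -, hu⟩ := (PMF.mem_support_bind_iff _ _ _).1 hρ
    obtain ⟨b, -, hb⟩ := (PMF.mem_support_bind_iff _ _ _).1 hu
    rw [PMF.mem_support_pure_iff] at hb
    rw [hb]
    exact ((hτ.upd (Or.inr (by norm_num)) _ _ _).upd (Or.inr (by norm_num)) _ _ _).upd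
      (Or.inl rfl) _ _ _
  · simp only [PMF.map_bind, PMF.pure_map, hres]
    rw [privateSign, ← hrank]
    simp only [PMF.bind_map, PMF.map_bind, PMF.pure_map, Function.comp_def]

theorem hasLaw_variableStep (hΦ : Φ.TriangleFree) (ε : ℝ) {σ : Memory} (h : Ctx Φ G y σ)
    (j : Fin n) :
    HasLaw ((variableStep k).law (responseLaw ε) (σ.upd 11 0 0 j)) (Ctx Φ G y) (readSigns 5 n)
      ((if j ∈ G then privateSign ε Φ G y j else PMF.pure (y j)).map
        (Function.update (readSigns 5 n σ) j)) := by
  have h' : Ctx Φ G y (σ.upd 11 0 0 j) := h.upd (Or.inr (by norm_num)) _ _ _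
  have h11 : (σ.upd 11 0 0 j) 11 0 0 = j := Memory.upd_self _ _ _ _ _
  have h5 : readSigns 5 n (σ.upd 11 0 0 j) = readSigns 5 n σ :=
    readSigns_congr (Memory.upd_of_ne (by decide) _ _ _)
  have hlaw : (variableStep k).law (responseLaw ε) (σ.upd 11 0 0 j)
      = if (σ.upd 11 0 0 j) 6 ((σ.upd 11 0 0 j) 11 0 0) 0 ≠ 0
        then (draw k).law (responseLaw ε) (σ.upd 11 0 0 j)
        else PMF.pure ((σ.upd 11 0 0 j).upd 5 ((σ.upd 11 0 0 j) 11 0 0) 0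
          ((σ.upd 11 0 0 j) 7 ((σ.upd 11 0 0 j) 11 0 0) 0)) := rfl
  rw [hlaw, h11, h'.part, h'.assign, ← h5]
  by_cases hjG : j ∈ G
  · simp only [hjG, if_true, ne_eq, one_ne_zero, not_false_eq_true]
    exact hasLaw_draw hΦ ε h' h11
  · simp only [hjG, if_false, ne_eq, not_true_eq_false]
    constructor
    · intro ρ hρ
      rw [PMF.mem_support_pure_iff] at hρ
      rw [hρ]
      exact h'.upd (Or.inl rfl) _ _ _
    · rw [PMF.pure_map, PMF.pure_map, readSigns_upd]
      congr 2
      rcases Int.units_eq_one_or (y j) with hy | hy <;> simp [hy]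

theorem hasLaw_variables (hΦ : Φ.TriangleFree) (ε : ℝ) {σ : Memory} (h : Ctx Φ G y σ) :
    HasLaw ((RCmd.loop 11 (cell 0) (variableStep k)).law (responseLaw ε) σ) (Ctx Φ G y)
      (readSigns 5 n) (algGivenF ε Φ G y) := by
  have hn : (cell 0).eval σ = n := by
    change σ 0 0 0 = n
    rw [h.input 0 (by norm_num)]
    simp [inputMemory]
  rw [RCmd.law, hn, algGivenF]
  exact HasLaw.iterate (fun t a ha => hasLaw_variableStep hΦ ε ha t) h

theorem map_uniformBelow_two :
    ((uniformBelow 2).map fun v => if v = 1 then (1 : ℤˣ) else -1)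
      = PMF.uniformOfFintype ℤˣ := by
  apply ext_of_bias
  rw [bias_uniform, uniformBelow, PMF.map_comp, bias, expect_map, expect_uniform, avg,
    Fin.sum_univ_two]
  simp

/-- The counter lives in array 10, so `arr` must be another one. That the entries are bits is
required of all rows from the start, so that it can serve as an invariant before every row is
written. -/
theorem hasLaw_sampleBits (coin : PMF ℤˣ) {arr : ℕ} (harr : arr ≠ 10)
    {σ : Memory} (hn : σ 0 0 0 = n) (h0 : ∀ r, σ arr r 0 ≤ 1) :
    HasLaw ((sampleBits arr).law coin σ)
      (fun τ => (∀ a, a ≠ arr → a ≠ 10 → τ a = σ a) ∧ ∀ r, τ arr r 0 ≤ 1)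
      (readSigns arr n) (PMF.uniformOfFintype (Assignment n)) := by
  have hlaw : (sampleBits arr).law coin σ = iterateLaw (fun t τ => (uniformBelow 2).map fun v =>
      (τ.upd 10 0 0 t).upd arr ((τ.upd 10 0 0 t) 10 0 0) 0 v) (σ 0 0 0) σ := rfl
  rw [hlaw, hn, ← piLaw_uniform]
  refine HasLaw.iterate (fun t τ hτ => ⟨?_, ?_⟩) ⟨fun _ _ _ => rfl, h0⟩
  · intro ρ hρ
    simp only [PMF.support_map, Set.mem_image] at hρ
    obtain ⟨v, hv, rfl⟩ := hρ
    refine ⟨fun a h1 h2 => ?_, fun r => ?_⟩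
    · rw [Memory.upd_of_ne h1, Memory.upd_of_ne h2, hτ.1 a h1 h2]
    · have hv1 : v ≤ 1 := by
        simp only [uniformBelow, PMF.support_map, PMF.support_uniformOfFintype, Set.top_eq_univ,
          Set.image_univ, Set.mem_range] at hv
        obtain ⟨u, rfl⟩ := hv
        omega
      refine Memory.upd_le hv1 ?_
      rw [Memory.upd_of_ne harr]
      exact hτ.2 r
  · rw [PMF.map_comp, ← map_uniformBelow_two, PMF.map_comp]
    congr 1
    funext v
    simp only [Function.comp_apply, Memory.upd_self]
    rw [readSigns_upd, readSigns_congr (Memory.upd_of_ne harr _ _ _)]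

/-- The memory holds the instance and the constants, and the arrays `6` and `7` hold bits. -/
structure Prepared (Φ : Instance n k) (σ : Memory) : Prop where
  input : ∀ a < 5, σ a = inputMemory Φ a
  base_eq : σ 8 0 0 = base n
  modulus_eq : σ 9 0 0 = modulus n k Φ.m
  part : ∀ r, σ 6 r 0 ≤ 1
  assign : ∀ r, σ 7 r 0 ≤ 1

/-- The set of the positive coordinates. -/
def positives (x : Assignment n) : Finset (Fin n) := Finset.univ.filter fun i => x i = 1

theorem positives_bijective : Function.Bijective (positives (n := n)) := by
  constructor
  · intro x x' h
    funext i
    have hi := Finset.ext_iff.1 h i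
    simp only [positives, Finset.mem_filter, Finset.mem_univ, true_and] at hi
    rcases Int.units_eq_one_or (x i) with h1 | h1 <;>
      rcases Int.units_eq_one_or (x' i) with h2 | h2 <;> simp_all
  · intro S
    refine ⟨fun i => if i ∈ S then 1 else -1, ?_⟩
    ext i
    by_cases hi : i ∈ S <;> simp [positives, hi]

theorem hasLaw_sample (hΦ : Φ.TriangleFree) (ε : ℝ) {σ : Memory} (h : Prepared Φ σ) :
    HasLaw ((sample k).law (responseLaw ε) σ) (fun _ => True) (readSigns 5 n) (alg ε Φ) := by
  have hn : ∀ τ : Memory, τ 0 = σ 0 → τ 0 0 0 = n := by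
    intro τ hτ
    rw [hτ, h.input 0 (by norm_num)]
    simp [inputMemory]
  -- The program draws the partition as a uniform vector of bits; its positive coordinates form a
  -- uniform set.
  have halg : alg ε Φ = (PMF.uniformOfFintype (Assignment n)).bind fun g =>
      (PMF.uniformOfFintype (Assignment n)).bind (algGivenF ε Φ (positives g)) := by
    rw [alg, ← map_uniformOfFintype_of_bijective (positives_bijective (n := n)), PMF.bind_map]
    rfl
  rw [halg, sample, RCmd.law]
  refine (hasLaw_sampleBits _ (by norm_num) (hn σ rfl) h.part).bind
    fun τ hτ => ?_
  rw [RCmd.law]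
  refine (hasLaw_sampleBits _ (by norm_num)
    (hn τ (hτ.1 0 (by norm_num) (by norm_num)))
    (by rw [hτ.1 7 (by norm_num) (by norm_num)]; exact h.assign)).bind fun ρ hρ => ?_
  have h6 : ρ 6 = τ 6 := hρ.1 6 (by norm_num) (by norm_num)
  have hfr : ∀ a, a ≠ 6 → a ≠ 7 → a ≠ 10 → ρ a = σ a := fun a h1 h2 h3 => by
    rw [hρ.1 a h2 h3, hτ.1 a h1 h3]
  have hctx : Ctx Φ (positives (readSigns 6 n τ)) (readSigns 7 n ρ) ρ :=
    { input := fun a ha => by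
        rw [hfr a (by omega) (by omega) (by omega), h.input a ha]
      base_eq := by rw [hfr 8 (by omega) (by omega) (by omega), h.base_eq]
      modulus_eq := by rw [hfr 9 (by omega) (by omega) (by omega), h.modulus_eq]
      part := fun i => by
        rw [h6]
        have := hτ.2 i
        simp only [positives, readSigns]
        by_cases h1 : τ 6 i 0 = 1
        · simp [h1]
        · have h0 : τ 6 i 0 = 0 := by omega
          simp [h0]
      assign := fun i => by
        have := hρ.2 i
        simp only [readSigns]
        by_cases h1 : ρ 7 i 0 = 1
        · simp [h1]
        · have h0 : ρ 7 i 0 = 0 := by omega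
          simp [h0] }
  obtain ⟨-, h2⟩ := hasLaw_variables hΦ ε hctx
  exact ⟨fun _ _ => trivial, h2⟩

end Sampler

/-! ### Running time of the program -/

section PreservesRules

variable {Inv : Memory → Prop} {R : ℕ}

theorem RCmd.preserves_seq {c d : RCmd} (hc : c.Preserves Inv R) (hd : d.Preserves Inv R) :
    (RCmd.seq c d).Preserves Inv R := And.intro hc hd

theorem RCmd.preserves_ite {e : RExp} {c d : RCmd} (hc : c.Preserves Inv R)
    (hd : d.Preserves Inv R) : (RCmd.ite e c d).Preserves Inv R := And.intro hc hd

theorem RCmd.preserves_loop {arr : ℕ} {e : RExp} {c : RCmd} (he : ∀ σ, Inv σ → e.eval σ ≤ R)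
    (ht : ∀ σ, Inv σ → ∀ t < R, Inv (σ.upd arr 0 0 t)) (hc : c.Preserves Inv R) :
    (RCmd.loop arr e c).Preserves Inv R := And.intro he (And.intro ht hc)

theorem RCmd.Triple.mono {P Q : Memory → Prop} {c : RCmd} {T T' : ℕ} (h : RCmd.Triple P c Q T)
    (hT : T ≤ T') : RCmd.Triple P c Q T' := fun coin s hs s' hs' =>
  ⟨(h coin s hs s' hs').1, (h coin s hs s' hs').2.trans (Nat.add_le_add_left hT _)⟩

theorem Memory.Short.upd {L : ℕ} {σ : Memory} (h : σ.Short L) {v : ℕ} (hv : Nat.size v ≤ L)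
    (arr row col : ℕ) : (σ.upd arr row col v).Short L := by
  intro a r c
  unfold Memory.upd
  split_ifs
  · exact hv
  · exact h a r c

end PreservesRules

namespace Sampler

variable {n k : ℕ} {Φ : Instance n k}

/-- A bound on the bit length of all numbers that occur on inputs of size `N`. -/
def bitBound (k N : ℕ) : ℕ := k + 2 + (N + 2) * (2 * N + 2)

/-- A bound on the number of rounds of all loops on inputs of size `N`. -/
def roundBound (k N : ℕ) : ℕ := N + k + 2 ^ k

theorem le_roundBound {t N : ℕ} (h : t ≤ N) : t ≤ roundBound k N :=
  h.trans (le_add_right (Nat.le_add_right _ _))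

theorem size_of_lt_roundBound {t N : ℕ} (ht : t ≤ roundBound k N) :
    Nat.size t ≤ bitBound k N := by
  rw [Nat.size_le]
  have h1 := Nat.lt_two_pow_self (n := N)
  have h2 := Nat.lt_two_pow_self (n := k)
  have h3 : 2 ^ (N + k + 2) ≤ 2 ^ bitBound k N := by
    refine Nat.pow_le_pow_right (by norm_num) ?_
    unfold bitBound
    nlinarith
  have h4 : 2 ^ N ≤ 2 ^ (N + k) := Nat.pow_le_pow_right (by norm_num) (by omega)
  have h5 : 2 ^ k ≤ 2 ^ (N + k) := Nat.pow_le_pow_right (by norm_num) (by omega)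
  rw [pow_add] at h3
  unfold roundBound at ht
  omega

theorem size_of_le_modulus {v : ℕ} (hv : v ≤ modulus n k Φ.m) :
    Nat.size v ≤ bitBound k (n + Φ.m) := by
  rw [Nat.size_le]
  refine lt_of_le_of_lt hv ?_
  rw [modulus, base, ← pow_mul, ← pow_add]
  -- The modulus is a power of 2 with exponent k + 1 + (n + 2)(2m + 2).
  refine Nat.pow_lt_pow_right (by norm_num) ?_
  unfold bitBound
  have : (n + 2) * (2 * Φ.m + 2) ≤ (n + Φ.m + 2) * (2 * (n + Φ.m) + 2) :=
    Nat.mul_le_mul (by omega) (by omega)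
  omega

theorem size_of_le_two {v N : ℕ} (hv : v ≤ 2) : Nat.size v ≤ bitBound k N := by
  rw [Nat.size_le]
  calc v < 2 ^ 2 := by omega
    _ ≤ _ := Nat.pow_le_pow_right (by norm_num) (by unfold bitBound; omega)

theorem arity_le_of_input (Φ : Instance n k) (r c : ℕ) : inputMemory Φ 2 r c ≤ k := by
  simp only [inputMemory]
  split_ifs <;> first | omega | exact (Φ.con _).arity_le | simp_all

theorem short_inputMemory (Φ : Instance n k) :
    (inputMemory Φ).Short (bitBound k (n + Φ.m)) := by
  intro a r c
  refine size_of_lt_roundBound ?_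
  have h1 : 1 ≤ 2 ^ k := Nat.one_le_two_pow
  unfold roundBound
  simp only [inputMemory]
  split_ifs with h1 h2 h3 h4 h5 h6 h7 h8 h9 h10 h11
  all_goals try omega
  · have := (Φ.con ⟨r, h5⟩).arity_le
    omega

/-- The invariant of all steps of `sample`. -/
structure Bounded (Φ : Instance n k) (σ : Memory) : Prop where
  input : ∀ a < 5, σ a = inputMemory Φ a
  base_eq : σ 8 0 0 = base n
  modulus_eq : σ 9 0 0 = modulus n k Φ.m
  short : σ.Short (bitBound k (n + Φ.m))

theorem Bounded.upd {σ : Memory} (h : Bounded Φ σ) {a v : ℕ} (h5 : 5 ≤ a) (h8 : a ≠ 8)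
    (h9 : a ≠ 9) (hv : Nat.size v ≤ bitBound k (n + Φ.m)) (r c : ℕ) :
    Bounded Φ (σ.upd a r c v) where
  input b hb := by rw [Memory.upd_of_ne (by omega), h.input b hb]
  base_eq := by rw [Memory.upd_of_ne h8.symm, h.base_eq]
  modulus_eq := by rw [Memory.upd_of_ne h9.symm, h.modulus_eq]
  short := h.short.upd hv _ _ _

/-- The reason for reducing every assignment: the result is short whatever `e` computes, so the time
analysis needs no knowledge of the values. -/
theorem preserves_setMod {R a : ℕ} (h5 : 5 ≤ a) (h8 : a ≠ 8) (h9 : a ≠ 9) (e : RExp) :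
    (setMod a e).Preserves (Bounded Φ) R := by
  intro σ h
  refine h.upd h5 h8 h9 (size_of_le_modulus (Φ := Φ) ?_) _ _
  change e.eval σ % σ 9 0 0 ≤ _
  rw [h.modulus_eq]
  exact (Nat.mod_lt _ (Nat.mul_pos (by positivity) (pow_pos base_pos _))).le

theorem preserves_setCell {R a v : ℕ} (h5 : 5 ≤ a) (h8 : a ≠ 8) (h9 : a ≠ 9) (hv : v ≤ 2) :
    (setCell a (.lit v)).Preserves (Bounded Φ) R :=
  fun _ h => h.upd h5 h8 h9 (size_of_le_two hv) _ _

theorem preserves_loop {a : ℕ} (h5 : 5 ≤ a) (h8 : a ≠ 8) (h9 : a ≠ 9) {e : RExp} {c : RCmd}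
    (he : ∀ σ, Bounded Φ σ → e.eval σ ≤ roundBound k (n + Φ.m))
    (hc : c.Preserves (Bounded Φ) (roundBound k (n + Φ.m))) :
    (RCmd.loop a e c).Preserves (Bounded Φ) (roundBound k (n + Φ.m)) :=
  RCmd.preserves_loop he (fun _ h _ ht => h.upd h5 h8 h9 (size_of_lt_roundBound ht.le) _ _) hc

theorem Bounded.eval_cell_zero {σ : Memory} (h : Bounded Φ σ) : (cell 0).eval σ = n := by
  change σ 0 0 0 = n
  rw [h.input 0 (by norm_num)]
  simp [inputMemory]

theorem Bounded.eval_cell_one {σ : Memory} (h : Bounded Φ σ) : (cell 1).eval σ = Φ.m := by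
  change σ 1 0 0 = Φ.m
  rw [h.input 1 (by norm_num)]
  simp [inputMemory]

theorem preserves_scan : scan.Preserves (Bounded Φ) (roundBound k (n + Φ.m)) := by
  refine RCmd.preserves_seq (preserves_setCell ?_ ?_ ?_ ?_) <| RCmd.preserves_seq
    (preserves_setCell ?_ ?_ ?_ ?_) <| RCmd.preserves_seq (preserves_setCell ?_ ?_ ?_ ?_) <|
    RCmd.preserves_seq (preserves_setCell ?_ ?_ ?_ ?_) <| preserves_loop ?_ ?_ ?_ ?_ <|
    RCmd.preserves_seq (preserves_setMod ?_ ?_ ?_ _) <| RCmd.preserves_seq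
    (preserves_setMod ?_ ?_ ?_ _) <| RCmd.preserves_seq (preserves_setMod ?_ ?_ ?_ _)
    (preserves_setMod ?_ ?_ ?_ _)
  all_goals try norm_num
  intro σ h
  change σ 2 _ _ ≤ _
  rw [h.input 2 (by norm_num)]
  exact (arity_le_of_input Φ _ _).trans (le_add_right (Nat.le_add_left _ _))

theorem preserves_constraintStep :
    (constraintStep k).Preserves (Bounded Φ) (roundBound k (n + Φ.m)) := by
  refine RCmd.preserves_seq preserves_scan <| RCmd.preserves_ite (RCmd.preserves_seq
    (RCmd.preserves_seq (preserves_setCell ?_ ?_ ?_ ?_) <| preserves_loop ?_ ?_ ?_ ?_ <|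
      preserves_setMod ?_ ?_ ?_ _) <| RCmd.preserves_seq (preserves_setMod ?_ ?_ ?_ _)
      (preserves_setMod ?_ ?_ ?_ _)) trivial
  all_goals try norm_num
  intro σ _
  exact Nat.le_add_left _ _

theorem preserves_draw : (draw k).Preserves (Bounded Φ) (roundBound k (n + Φ.m)) := by
  refine RCmd.preserves_seq (RCmd.preserves_seq (preserves_setMod ?_ ?_ ?_ _) <|
    RCmd.preserves_seq (preserves_setCell ?_ ?_ ?_ ?_) <|
    preserves_loop ?_ ?_ ?_ ?_ preserves_constraintStep) <|
    RCmd.preserves_seq ?_ <| RCmd.preserves_seq ?_ ?_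
  all_goals try norm_num
  · intro σ h
    rw [h.eval_cell_one]
    exact le_roundBound (by omega)
  · intro σ h v hv
    refine h.upd (by norm_num) (by norm_num) (by norm_num) ?_ _ _
    refine (Nat.size_le_size (n := base n) ?_).trans (h.base_eq ▸ h.short 8 0 0)
    refine hv.trans ?_
    change _ % σ 8 0 0 ≤ _
    rw [h.base_eq]
    exact (Nat.mod_lt _ base_pos).le
  · intro σ h v hv
    exact h.upd (by norm_num) (by norm_num) (by norm_num) (size_of_le_two (by omega)) _ _
  · intro σ h
    refine h.upd (by norm_num) (by norm_num) (by norm_num) (size_of_le_two ?_) _ _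
    change (if _ then 1 else 0) ≤ 2
    split_ifs <;> norm_num

theorem preserves_sampleBits {a : ℕ} (h5 : 5 ≤ a) (h8 : a ≠ 8) (h9 : a ≠ 9) :
    (sampleBits a).Preserves (Bounded Φ) (roundBound k (n + Φ.m)) := by
  refine preserves_loop (by norm_num) (by norm_num) (by norm_num) ?_ fun σ h v hv =>
    h.upd h5 h8 h9 (size_of_le_two hv) _ _
  intro σ h
  rw [h.eval_cell_zero]
  exact le_roundBound (by omega)

theorem preserves_sample : (sample k).Preserves (Bounded Φ) (roundBound k (n + Φ.m)) := by
  refine RCmd.preserves_seq (preserves_sampleBits (by norm_num) (by norm_num) (by norm_num)) <|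
    RCmd.preserves_seq (preserves_sampleBits (by norm_num) (by norm_num) (by norm_num)) <|
    preserves_loop (by norm_num) (by norm_num) (by norm_num) ?_ <|
    RCmd.preserves_ite preserves_draw fun σ h =>
      h.upd (by norm_num) (by norm_num) (by norm_num) (h.short _ _ _) _ _
  intro σ h
  rw [h.eval_cell_zero]
  exact le_roundBound (by omega)

/-- The memory during the computation of the constants. -/
structure Starting (Φ : Instance n k) (b M : ℕ → Prop) (σ : Memory) : Prop where
  input : ∀ a, a ≠ 8 → a ≠ 9 → a ≠ 10 → σ a = inputMemory Φ a
  base_prop : b (σ 8 0 0)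
  modulus_prop : M (σ 9 0 0)
  short : σ.Short (bitBound k (n + Φ.m))

theorem Starting.eval_cell_zero {b M : ℕ → Prop} {σ : Memory} (h : Starting Φ b M σ) :
    (cell 0).eval σ = n := by
  change σ 0 0 0 = n
  rw [h.input 0 (by norm_num) (by norm_num) (by norm_num)]
  simp [inputMemory]

theorem Starting.eval_cell_one {b M : ℕ → Prop} {σ : Memory} (h : Starting Φ b M σ) :
    (cell 1).eval σ = Φ.m := by
  change σ 1 0 0 = Φ.m
  rw [h.input 1 (by norm_num) (by norm_num) (by norm_num)]
  simp [inputMemory]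

theorem Starting.upd_base {b M b' : ℕ → Prop} {σ : Memory} (h : Starting Φ b M σ) {v : ℕ}
    (hv : b' v) (hs : Nat.size v ≤ bitBound k (n + Φ.m)) :
    Starting Φ b' M (σ.upd 8 0 0 v) where
  input a h8 h9 h10 := by rw [Memory.upd_of_ne h8, h.input a h8 h9 h10]
  base_prop := by rwa [Memory.upd_self]
  modulus_prop := by rw [Memory.upd_of_ne (by decide)]; exact h.modulus_prop
  short := h.short.upd hs _ _ _

theorem Starting.upd_modulus {b M M' : ℕ → Prop} {σ : Memory} (h : Starting Φ b M σ) {v : ℕ}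
    (hv : M' v) (hs : Nat.size v ≤ bitBound k (n + Φ.m)) :
    Starting Φ b M' (σ.upd 9 0 0 v) where
  input a h8 h9 h10 := by rw [Memory.upd_of_ne h9, h.input a h8 h9 h10]
  base_prop := by rw [Memory.upd_of_ne (by decide)]; exact h.base_prop
  modulus_prop := by rwa [Memory.upd_self]
  short := h.short.upd hs _ _ _

theorem Starting.upd_counter {b M : ℕ → Prop} {σ : Memory} (h : Starting Φ b M σ) {v : ℕ}
    (hs : Nat.size v ≤ bitBound k (n + Φ.m)) : Starting Φ b M (σ.upd 10 0 0 v) where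
  input a h8 h9 h10 := by rw [Memory.upd_of_ne h10, h.input a h8 h9 h10]
  base_prop := by rw [Memory.upd_of_ne (by decide)]; exact h.base_prop
  modulus_prop := by rw [Memory.upd_of_ne (by decide)]; exact h.modulus_prop
  short := h.short.upd hs _ _ _

theorem base_le_modulus (m : ℕ) : base n ≤ modulus n k m := by
  calc base n = base n ^ 1 := (pow_one _).symm
    _ ≤ base n ^ (2 * m + 2) := Nat.pow_le_pow_right base_pos (by omega)
    _ ≤ _ := Nat.le_mul_of_pos_left _ (by positivity)

/-- Here the modulus is not yet available, so sizes are controlled by the exact values 4 · 2^t and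
2^(k+1) B^(2t+2) after t rounds. -/
theorem triple_constants (Φ : Instance n k) :
    RCmd.Triple (fun σ => σ = inputMemory Φ) (constants k)
      (Starting Φ (· = base n) (· = modulus n k Φ.m))
      ((constants k).timeBound (bitBound k (n + Φ.m)) (roundBound k (n + Φ.m))) := by
  have hn : n ≤ roundBound k (n + Φ.m) := le_roundBound (by omega)
  have hm : Φ.m ≤ roundBound k (n + Φ.m) := le_roundBound (by omega)
  have hsize : ∀ t < roundBound k (n + Φ.m), Nat.size t ≤ bitBound k (n + Φ.m) :=
    fun t ht => size_of_lt_roundBound ht.le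
  refine RCmd.Triple.seq (Q := Starting Φ (· = 4) fun _ => True) ?_ <|
    RCmd.Triple.seq (Q := Starting Φ (· = base n) fun _ => True) ?_ <|
    RCmd.Triple.seq (Q := Starting Φ (· = base n) (· = 2 ^ (k + 1) * base n ^ 2)) ?_ ?_
  · refine RCmd.triple_set (fun σ h => h ▸ short_inputMemory Φ) fun σ h => ?_
    have h0 : Starting Φ (fun _ => True) (fun _ => True) σ := by
      subst h
      exact ⟨fun _ _ _ _ => rfl, trivial, trivial, short_inputMemory Φ⟩
    exact h0.upd_base rfl (size_of_le_modulus (four_le_base.trans (base_le_modulus _)))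
  · refine (RCmd.triple_loop (N := n) (fun σ h => h.short)
      (fun t => Starting Φ (· = 4 * 2 ^ t) fun _ => True)
      (fun σ h => h.eval_cell_zero.le) (fun σ h => by simpa using h)
      (fun t ht => hsize t (ht.trans_le hn))
      (T := RCmd.timeBound (bitBound k (n + Φ.m)) (roundBound k (n + Φ.m))
        (setCell 8 (.op .mul (cell 8) (.lit 2)))) (fun t ht => ?_) ?_).mono ?_
    · refine RCmd.triple_set (L := bitBound k (n + Φ.m)) ?_ ?_
      · rintro τ ⟨σ, h, rfl⟩
        exact h.short.upd (hsize t (ht.trans_le hn)) _ _ _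
      · rintro τ ⟨σ, h, rfl⟩
        have hc := h.upd_counter (hsize t (ht.trans_le hn))
        have hv : (RExp.op .mul (cell 8) (.lit 2)).eval (σ.upd 10 0 0 t) = 4 * 2 ^ (t + 1) := by
          change (σ.upd 10 0 0 t) 8 0 0 * 2 = _
          rw [hc.base_prop]
          ring
        rw [hv]
        refine hc.upd_base rfl (size_of_le_modulus (le_trans ?_ (base_le_modulus _)))
        rw [base_eq]
        exact Nat.mul_le_mul_left _ (Nat.pow_le_pow_right (by norm_num) ht)
    · intro σ τ h hτ
      rw [h.eval_cell_zero] at hτ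
      rwa [← base_eq] at hτ
    · rw [RCmd.timeBound]
      gcongr
      · exact le_rfl
  · refine RCmd.triple_set (fun σ h => h.short) fun σ h => ?_
    have hv : (RExp.op .mul (.lit (2 ^ (k + 1))) (.op .mul (cell 8) (cell 8))).eval σ
        = 2 ^ (k + 1) * base n ^ 2 := by
      change 2 ^ (k + 1) * (σ 8 0 0 * σ 8 0 0) = _
      rw [h.base_prop]
      ring
    rw [hv]
    refine h.upd_modulus rfl (size_of_le_modulus ?_)
    exact Nat.mul_le_mul_left _ (Nat.pow_le_pow_right base_pos (by omega))
  · refine (RCmd.triple_loop (N := Φ.m) (fun σ h => h.short)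
      (fun t => Starting Φ (· = base n) (· = 2 ^ (k + 1) * base n ^ (2 * t + 2)))
      (fun σ h => h.eval_cell_one.le) (fun σ h => by simpa using h)
      (fun t ht => hsize t (ht.trans_le hm))
      (T := RCmd.timeBound (bitBound k (n + Φ.m)) (roundBound k (n + Φ.m))
        (setCell 9 (.op .mul (cell 9) (.op .mul (cell 8) (cell 8))))) (fun t ht => ?_) ?_).mono ?_
    · refine RCmd.triple_set (L := bitBound k (n + Φ.m)) ?_ ?_
      · rintro τ ⟨σ, h, rfl⟩
        exact h.short.upd (hsize t (ht.trans_le hm)) _ _ _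
      · rintro τ ⟨σ, h, rfl⟩
        have hc := h.upd_counter (hsize t (ht.trans_le hm))
        have hv : (RExp.op .mul (cell 9) (.op .mul (cell 8) (cell 8))).eval (σ.upd 10 0 0 t)
            = 2 ^ (k + 1) * base n ^ (2 * (t + 1) + 2) := by
          change (σ.upd 10 0 0 t) 9 0 0 * ((σ.upd 10 0 0 t) 8 0 0 * (σ.upd 10 0 0 t) 8 0 0) = _
          rw [hc.base_prop, hc.modulus_prop]
          ring
        rw [hv]
        refine hc.upd_modulus rfl (size_of_le_modulus ?_)
        exact Nat.mul_le_mul_left _ (Nat.pow_le_pow_right base_pos (by omega))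
    · intro σ τ h hτ
      rwa [h.eval_cell_one] at hτ
    · rw [RCmd.timeBound]
      gcongr
      · exact le_rfl

theorem Starting.bounded {σ : Memory}
    (h : Starting Φ (· = base n) (· = modulus n k Φ.m) σ) : Bounded Φ σ :=
  ⟨fun a ha => h.input a (by omega) (by omega) (by omega), h.base_prop, h.modulus_prop, h.short⟩

theorem Starting.prepared {σ : Memory}
    (h : Starting Φ (· = base n) (· = modulus n k Φ.m) σ) : Prepared Φ σ where
  input a ha := h.input a (by omega) (by omega) (by omega)
  base_eq := h.base_prop
  modulus_eq := h.modulus_prop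
  part r := by
    rw [h.input 6 (by norm_num) (by norm_num) (by norm_num)]
    simp [inputMemory]
  assign r := by
    rw [h.input 7 (by norm_num) (by norm_num) (by norm_num)]
    simp [inputMemory]

theorem time_le (Φ : Instance n k) (coin : PMF ℤˣ) {s : MState}
    (hs : s ∈ ((program k).exec coin (startState Φ)).support) :
    s.time ≤ (program k).timeBound (bitBound k (n + Φ.m)) (roundBound k (n + Φ.m)) := by
  have h1 := (triple_constants Φ).seq (d := sample k) (R := Bounded Φ)
    (T' := (sample k).timeBound (bitBound k (n + Φ.m)) (roundBound k (n + Φ.m)))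
    fun coin s hs => RCmd.Preserves.triple (Inv := Bounded Φ) (fun _ h => h.short)
      (fun t ht => size_of_lt_roundBound ht.le) preserves_sample coin s hs.bounded
  have h2 := (h1 coin (startState Φ) rfl s hs).2
  rwa [startState, zero_add] at h2

theorem map_outputOf_exec (hΦ : Φ.TriangleFree) (ε : ℝ) :
    ((program k).exec (responseLaw ε) (startState Φ)).map (outputOf n) = alg ε Φ := by
  have hcomp : outputOf n = readSigns 5 n ∘ MState.mem := rfl
  rw [hcomp, ← PMF.map_comp, RCmd.map_mem_exec]
  change ((program k).law (responseLaw ε) (inputMemory Φ)).map (readSigns 5 n) = _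
  -- Only the support matters for the constants; a trivial observable turns the statement about
  -- supports into a `HasLaw` to compose with.
  have h1 : HasLaw ((constants k).law (responseLaw ε) (inputMemory Φ)) (Prepared Φ)
      (fun _ => ()) (PMF.pure ()) := by
    refine ⟨fun σ hσ => ?_, PMF.map_const _ _⟩
    change σ ∈ ((constants k).law (responseLaw ε) (startState Φ).mem).support at hσ
    rw [← RCmd.map_mem_exec, PMF.support_map] at hσ
    obtain ⟨s, hs, rfl⟩ := hσ
    exact (triple_constants Φ _ _ rfl s hs).1.prepared
  have h2 := (h1.bind (q' := fun _ => alg ε Φ) fun σ hσ => hasLaw_sample hΦ ε hσ).2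
  rwa [PMF.pure_bind] at h2

open Polynomial in
/-- A polynomial bound on the running time. -/
def timePolynomial (k : ℕ) : ℕ[X] :=
  (program k).timeBound (C (k + 2) + (X + 2) * (2 * X + 2)) (X + C k + C (2 ^ k))

theorem eval_timePolynomial (N : ℕ) :
    (timePolynomial k).eval N = (program k).timeBound (bitBound k N) (roundBound k N) := by
  rw [timePolynomial, RCmd.eval_timeBound]
  simp [bitBound, roundBound]

end Sampler

end MaxCSP

end

theorem mainTheorem7 :
    -- polynomial running time: one program per arity bound `k`, which samples the algorithm exactly
    (∀ k : ℕ, ∃ (prog : MaxCSP.RCmd) (T : Polynomial ℕ),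
      ∀ (n : ℕ) (Φ : MaxCSP.Instance n k) (ε : ℝ), 0 ≤ ε → ε ≤ 1 → Φ.TriangleFree →
        (prog.exec (MaxCSP.responseLaw ε) (MaxCSP.startState Φ)).map (MaxCSP.outputOf n)
            = MaxCSP.alg ε Φ ∧
        ∀ s ∈ (prog.exec (MaxCSP.responseLaw ε) (MaxCSP.startState Φ)).support,
          s.time ≤ T.eval (n + Φ.m)) ∧
    -- privacy: of the output, and of the assignment given the partition and the values on `F`
    (∀ (n k : ℕ) (ε : ℝ), 0 ≤ ε → ε ≤ 1 →
      MaxCSP.IsDP ε MaxCSP.Instance.Neighboring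
        (fun Φ : MaxCSP.Instance n k => MaxCSP.alg ε Φ) ∧
      ∀ (G : Finset (Fin n)) (y : MaxCSP.Assignment n),
        MaxCSP.IsDP ε MaxCSP.Instance.Neighboring
          (fun Φ : MaxCSP.Instance n k => MaxCSP.algGivenF ε Φ G y)) ∧
    -- given the partition, each variable of `G` is uniform and depends only on `A_j`
    (∀ (n k : ℕ) (ε : ℝ) (Φ : MaxCSP.Instance n k), 0 ≤ ε → ε ≤ 1 → Φ.TriangleFree →
      ∀ (G : Finset (Fin n)), ∀ j ∈ G,
        (MaxCSP.algGiven ε Φ G).map (fun x => x j) = PMF.uniformOfFintype ℤˣ ∧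
        ∀ y y' : MaxCSP.Assignment n, (∀ i ∈ Φ.activeVars G j, y i = y' i) →
          (MaxCSP.algGivenF ε Φ G y).map (fun x => x j)
            = (MaxCSP.algGivenF ε Φ G y').map (fun x => x j)) ∧
    -- the gain of each variable of `G`
    (∃ c C : ℝ, 0 < c ∧ 0 < C ∧
      ∀ (n k : ℕ) (ε : ℝ) (Φ : MaxCSP.Instance n k), 0 ≤ ε → ε ≤ 1 → Φ.TriangleFree →
      ∀ (G : Finset (Fin n)), ∀ j ∈ G,
        (∀ l ∈ Φ.activeAt G j, (Φ.con l).DependsOn j ∧ ∃ i, i ≠ j ∧ (Φ.con l).DependsOn i) →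
        c * ε * Real.exp (-(C * k)) * √((Φ.activeAt G j).card : ℝ) ≤
          MaxCSP.expect (MaxCSP.algGiven ε Φ G) (fun x => ((x j : ℤ) : ℝ) * Φ.gain G j x)) ∧
    -- the expected advantage and the approximation ratio
    (∀ k : ℕ, ∃ c : ℝ, 0 < c ∧
      ∀ (n D : ℕ) (ε : ℝ) (Φ : MaxCSP.Instance n k), 0 ≤ ε → ε ≤ 1 → Φ.TriangleFree →
        (∀ i, Φ.degree i ≤ D) → 0 < Φ.m → (∀ l, (Φ.con l).Nondegenerate) →
        c * ε / √(D : ℝ) ≤ MaxCSP.expect (MaxCSP.alg ε Φ) Φ.advantage ∧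
        (Φ.mu + c * ε / √(D : ℝ)) * (Φ.opt : ℝ) ≤
          MaxCSP.expect (MaxCSP.alg ε Φ) (fun x => (Φ.val x : ℝ))) := by
  -- The constant 1/2560 is 1/640 from the moments times 1/4 from the response sign; the further
  -- factor 2^(-k) is the probability of being active.
  refine ⟨fun k => ⟨MaxCSP.Sampler.program k, MaxCSP.Sampler.timePolynomial k, ?_⟩, ?_, ?_,
    ⟨1 / 2560, 2, by norm_num, by norm_num, ?_⟩, fun k => ⟨1 / (2560 * 4 ^ k * 2 ^ k),
      by positivity, ?_⟩⟩
  · intro n Φ ε _ _ hΦ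
    refine ⟨MaxCSP.Sampler.map_outputOf_exec hΦ ε, fun s hs => ?_⟩
    rw [MaxCSP.Sampler.eval_timePolynomial]
    exact MaxCSP.Sampler.time_le Φ _ hs
  · intro n k ε h0 _
    exact ⟨MaxCSP.isDP_alg h0, MaxCSP.isDP_algGivenF h0⟩
  · intro n k ε Φ _ _ _ G j hj
    refine ⟨MaxCSP.map_eval_algGiven ε Φ hj, fun y y' h => ?_⟩
    rw [MaxCSP.map_eval_algGivenF ε Φ y hj, MaxCSP.map_eval_algGivenF ε Φ y' hj]
    exact MaxCSP.privateSign_congr ε Φ hj h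
  · intro n k ε Φ h0 h1 hΦ G j hj h
    -- When every active constraint at `j` depends on `j`, the count of relevant ones is |N_j|.
    have hrel : Φ.relevantAt G j = Φ.activeAt G j := by
      classical
      rw [MaxCSP.Instance.relevantAt]
      exact Finset.filter_true_of_mem fun l hl => (h l hl).1
    have hmain := hΦ.gain_lower_bound h0 h1 hj fun l hl _ => (h l hl).2
    rw [hrel] at hmain
    refine le_trans ?_ hmain
    have hexp := MaxCSP.exp_neg_two_mul_le k
    rw [div_eq_mul_one_div _ ((4 : ℝ) ^ k)]
    gcongr
  · intro n D ε Φ h0 h1 hΦ hD hm h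
    have hadv := hΦ.advantage_lower_bound h0 h1 hD hm h
    exact ⟨hadv, Φ.mul_opt_le_expect_val hm (by positivity) hadv⟩
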